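/- Let $\nu,a,b>0$ and $\Omega=(0,\frac{\pi}{a})\times(0,\frac{\pi}{b})$. The mixed boundary conditions for a function $w$ on $\overline\Omega$ are: $w=0$ for $y\in\{0,\frac{\pi}{b}\}$, and $w(0,y)=w(\frac{\pi}{a},y)$, $\partial_x w(0,y)=\partial_x w(\frac{\pi}{a},y)$ for $0\le y\le\frac{\pi}{b}$. Let $0<\mu_1<\mu_2<\dots$ be the distinct eigenvalues of $-\Delta$ on $\Omega$ with these boundary conditions and $E_k$ the eigenspace of $\mu_k$. The velocity field $u=(u_1,u_2)$ of a vorticity $\omega$ is the field with $\partial_x u_1+\partial_y u_2=0$ and $\partial_x u_2-\partial_y u_1=\omega$ in $\Omega$, periodic in $x$, with $u_2=0$ for $y\in\{0,\frac{\pi}{b}\}$ and $\int_\Omega u_1=0$ (understood weakly if $\omega$ is only in $L^2(\Omega)$). Put $$\mathcal K(\omega)=\tfrac12\int_\Omega|u|^2,\quad \mathcal E(\omega)=\tfrac12\int_\Omega\omega^2,\quad \mathcal P(\omega)=\tfrac12\int_\Omega|\nabla\omega|^2,\quad \mathcal Q=\frac{\mathcal E}{\mathcal K},\quad \Lambda=\frac{\mathcal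 P}{\mathcal E}.$$ Let $\omega_0\in L^2(\Omega)$, $\omega_0\neq0$. A solution with initial condition $\omega_0$ is a function $\omega$ which, together with its velocity field $u$, is smooth on $(0,\infty)\times\overline\Omega$, satisfies $\partial_t\omega-\nu\Delta\omega+u\cdot\nabla\omega=0$ in $(0,\infty)\times\Omega$ and the mixed boundary conditions for every $t>0$, and satisfies $\omega(0)=\omega_0$ and $\omega(t)\to\omega_0$ in $L^2(\Omega)$ as $t\to0^+$. Then there is a number $q(\omega_0)$ such that for each solution $\omega$ with initial condition $\omega_0$: $\mathcal E(\omega(t))>0$ and $\mathcal K(\omega(t))>0$ for all $t\ge0$; $t\mapsto\mathcal Q(\omega(t))$ is nonincreasing on $[0,\infty)$ and is differentiable with $\frac{d}{dt}\mathcal Q(\omega(t))\le0$ for $t>0$; $$\lim_{t\to\infty}\mathcal Q(\omega(t))=q(\omega_0),\qquad \mu_1\le q(\omega_0)\le\mathcal Q(\omega_0);$$ equality $q(\omega_0)=\mathcal Q(\omega_0)$ holds if and only if $\omega_0\in E_k$ for some $k\ge1$, and also if and only if $\omega$ is a planar Taylor vortex, i.e. $\omega(t)=e^{-\nu\mu_k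 t}w$ for all $t\ge0$, with some $k\ge1$ and $w\in E_k$. Moreover $$\lim_{t\to\infty}\Lambda(\omega(t))=q(\omega_0).$$ -/

import Mathlib

open Set Filter Topology MeasureTheory

noncomputable section

namespace VortexStrip

/-- The open rectangle `Ω = (0, π/a) × (0, π/b)`. -/
def dom (a b : ℝ) : Set (ℝ × ℝ) :=
  Ioo 0 (Real.pi / a) ×ˢ Ioo 0 (Real.pi / b)

/-- The closed rectangle, the closure of `Ω`. -/
def cdom (a b : ℝ) : Set (ℝ × ℝ) :=
  Icc 0 (Real.pi / a) ×ˢ Icc 0 (Real.pi / b)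

/-- Lebesgue measure on `Ω`. -/
def vol (a b : ℝ) : Measure (ℝ × ℝ) := volume.restrict (dom a b)

/-- The partial derivative `∂ₓ f` on the closed rectangle (one-sided at the boundary). -/
def dx (a b : ℝ) (f : ℝ × ℝ → ℝ) (p : ℝ × ℝ) : ℝ :=
  fderivWithin ℝ f (cdom a b) p (1, 0)

/-- The partial derivative `∂_y f` on the closed rectangle (one-sided at the boundary). -/
def dy (a b : ℝ) (f : ℝ × ℝ → ℝ) (p : ℝ × ℝ) : ℝ :=
  fderivWithin ℝ f (cdom a b) p (0, 1)

/-- The Laplacian `Δ f = ∂ₓₓ f + ∂_yy f`. -/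
def lap (a b : ℝ) (f : ℝ × ℝ → ℝ) (p : ℝ × ℝ) : ℝ :=
  dx a b (dx a b f) p + dy a b (dy a b f) p

/-- The mixed boundary conditions: `f = 0` on the walls `y = 0` and `y = π/b`, and periodicity
in `x`, that is, `f` and `∂ₓ f` agree at `x = 0` and `x = π/a`. -/
structure MixedBC (a b : ℝ) (f : ℝ × ℝ → ℝ) : Prop where
  bottom : ∀ x ∈ Icc 0 (Real.pi / a), f (x, 0) = 0
  top : ∀ x ∈ Icc 0 (Real.pi / a), f (x, Real.pi / b) = 0
  periodic : ∀ y ∈ Icc 0 (Real.pi / b), f (0, y) = f (Real.pi / a, y)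
  periodic_dx : ∀ y ∈ Icc 0 (Real.pi / b), dx a b f (0, y) = dx a b f (Real.pi / a, y)

/-- The solutions `w` of `-Δ w = l w` in `Ω` with the mixed boundary conditions. -/
def eigenspace (a b l : ℝ) : Set (ℝ × ℝ → ℝ) :=
  {w | ContDiffOn ℝ 2 w (cdom a b) ∧ MixedBC a b w ∧ ∀ p ∈ dom a b, -lap a b w p = l * w p}

/-- `l` is an eigenvalue of `-Δ` with the mixed boundary conditions. -/
def IsEigenvalue (a b l : ℝ) : Prop :=
  ∃ w ∈ eigenspace a b l, ∃ p ∈ dom a b, w p ≠ 0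

/-- The increasing enumeration `μ₁ < μ₂ < ⋯` of the eigenvalues, all of which are positive:
`μ_{k+1}` is the smallest eigenvalue above `μ_k`. The value `μ₀ = 0` is not an eigenvalue and
only starts the recursion. -/
def mu (a b : ℝ) : ℕ → ℝ
  | 0 => 0
  | k + 1 => sInf {l : ℝ | IsEigenvalue a b l ∧ mu a b k < l}

/-- The eigenspace `E_k` of `μ_k`. -/
def E (a b : ℝ) (k : ℕ) : Set (ℝ × ℝ → ℝ) := eigenspace a b (mu a b k)

/-- Kinetic energy `𝒦 = ½ ∫_Ω |u|²`. -/
def kineticEnergy (a b : ℝ) (u : ℝ × ℝ → ℝ × ℝ) : ℝ :=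
  (1 / 2) * ∫ p, ((u p).1 ^ 2 + (u p).2 ^ 2) ∂(vol a b)

/-- Enstrophy `ℰ = ½ ∫_Ω ω²`. -/
def enstrophy (a b : ℝ) (w : ℝ × ℝ → ℝ) : ℝ :=
  (1 / 2) * ∫ p, (w p) ^ 2 ∂(vol a b)

/-- Palinstrophy `𝒫 = ½ ∫_Ω |∇ω|²`. -/
def palinstrophy (a b : ℝ) (w : ℝ × ℝ → ℝ) : ℝ :=
  (1 / 2) * ∫ p, ((dx a b w p) ^ 2 + (dy a b w p) ^ 2) ∂(vol a b)

/-- `u` is, in the classical sense, the velocity field of the vorticity `w`: it is divergence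
free with `∂ₓ u₂ - ∂_y u₁ = w`, periodic in `x`, does not penetrate the walls, and has no mean
flow along the channel. The last condition singles out one velocity among `u + (c, 0)`. -/
structure IsVelocity (a b : ℝ) (w : ℝ × ℝ → ℝ) (u : ℝ × ℝ → ℝ × ℝ) : Prop where
  div_free : ∀ p ∈ dom a b, dx a b (fun z => (u z).1) p + dy a b (fun z => (u z).2) p = 0
  curl : ∀ p ∈ dom a b, dx a b (fun z => (u z).2) p - dy a b (fun z => (u z).1) p = w p
  bottom : ∀ x ∈ Icc 0 (Real.pi / a), (u (x, 0)).2 = 0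
  top : ∀ x ∈ Icc 0 (Real.pi / a), (u (x, Real.pi / b)).2 = 0
  periodic : ∀ y ∈ Icc 0 (Real.pi / b), u (0, y) = u (Real.pi / a, y)
  mean_zero : ∫ p, (u p).1 ∂(vol a b) = 0

/-- `u ∈ L²` is, in the weak sense, the velocity field of the vorticity `w ∈ L²`: the same
conditions as in `IsVelocity`, integrated by parts against smooth `x`-periodic functions. -/
structure IsWeakVelocity (a b : ℝ) (w : ℝ × ℝ → ℝ) (u : ℝ × ℝ → ℝ × ℝ) : Prop where
  memLp_fst : MemLp (fun p => (u p).1) 2 (vol a b)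
  memLp_snd : MemLp (fun p => (u p).2) 2 (vol a b)
  div_free : ∀ φ : ℝ × ℝ → ℝ, ContDiff ℝ ((⊤ : ℕ∞) : WithTop ℕ∞) φ →
    (∀ x y, φ (x + Real.pi / a, y) = φ (x, y)) →
    ∫ p, ((u p).1 * fderiv ℝ φ p (1, 0) + (u p).2 * fderiv ℝ φ p (0, 1)) ∂(vol a b) = 0
  curl : ∀ φ : ℝ × ℝ → ℝ, ContDiff ℝ ((⊤ : ℕ∞) : WithTop ℕ∞) φ →
    (∀ x y, φ (x + Real.pi / a, y) = φ (x, y)) →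
    (∀ x, φ (x, 0) = 0 ∧ φ (x, Real.pi / b) = 0) →
    ∫ p, ((u p).1 * fderiv ℝ φ p (0, 1) - (u p).2 * fderiv ℝ φ p (1, 0)) ∂(vol a b)
      = ∫ p, w p * φ p ∂(vol a b)
  mean_zero : ∫ p, (u p).1 ∂(vol a b) = 0

/-- `ω` (with velocity field `u`) is a global solution of the vorticity equation
`∂ₜ ω - ν Δ ω + u · ∇ω = 0` with the mixed boundary conditions and the initial vorticity
`ω₀ ∈ L²(Ω)`. For `t > 0` it is smooth up to the boundary and solves the problem in the
classical sense; the initial vorticity is attained in `L²(Ω)`. -/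
structure IsSolution (ν a b : ℝ) (ω₀ : ℝ × ℝ → ℝ)
    (ω : ℝ → ℝ × ℝ → ℝ) (u : ℝ → ℝ × ℝ → ℝ × ℝ) : Prop where
  smooth_vorticity :
    ContDiffOn ℝ ((⊤ : ℕ∞) : WithTop ℕ∞) (fun q : ℝ × (ℝ × ℝ) => ω q.1 q.2) (Ioi 0 ×ˢ cdom a b)
  smooth_velocity :
    ContDiffOn ℝ ((⊤ : ℕ∞) : WithTop ℕ∞) (fun q : ℝ × (ℝ × ℝ) => u q.1 q.2) (Ioi 0 ×ˢ cdom a b)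
  velocity : ∀ t, 0 < t → IsVelocity a b (ω t) (u t)
  bc : ∀ t, 0 < t → MixedBC a b (ω t)
  pde : ∀ t, 0 < t → ∀ p ∈ dom a b,
    deriv (fun s => ω s p) t - ν * lap a b (ω t) p
      + ((u t p).1 * dx a b (ω t) p + (u t p).2 * dy a b (ω t) p) = 0
  initial : ω 0 =ᵐ[vol a b] ω₀
  initial_velocity : IsWeakVelocity a b ω₀ (u 0)
  attained : Tendsto (fun t => eLpNorm (fun p => ω t p - ω₀ p) 2 (vol a b)) (𝓝[>] 0) (𝓝 0)

/-- The Rayleigh quotient `𝒬 = ℰ / 𝒦` of a vorticity `w` with velocity field `u`. -/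
def Q (a b : ℝ) (w : ℝ × ℝ → ℝ) (u : ℝ × ℝ → ℝ × ℝ) : ℝ :=
  enstrophy a b w / kineticEnergy a b u

/-- The dissipation rate quotient `Λ = 𝒫 / ℰ`. -/
def Lam (a b : ℝ) (w : ℝ × ℝ → ℝ) : ℝ :=
  palinstrophy a b w / enstrophy a b w

/-- `ω` is a planar Taylor vortex: `ω(t) = exp(-ν μ_k t) w` for all `t ≥ 0`, with some `k ≥ 1`
and some `w ∈ E_k`. -/
def IsTaylorVortex (ν a b : ℝ) (ω : ℝ → ℝ × ℝ → ℝ) : Prop :=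
  ∃ k : ℕ, 1 ≤ k ∧ ∃ w ∈ E a b k, ∀ t, 0 ≤ t →
    ω t =ᵐ[vol a b] fun p => Real.exp (-ν * mu a b k * t) * w p

end VortexStrip

end

/-! Write K, E, P for kinetic energy, enstrophy and palinstrophy. Testing the vorticity equation
against the stream function and against ω removes the nonlinear term and gives K' = -2νE and E' =
-2νP, hence Q' = -2νQ(Λ - Q). The integral of |∇ω + c(u₂, -u₁)|² equals 2(P - 2cE + c²K)
(`IsVelocity.integral_defect_eq`); its nonnegativity for c = Q says Q ≤ Λ, so Q is nonincreasing.
Wirtinger's inequality across the channel (`wirtinger`) gives E ≥ b²K, so Q has a limit q ≥ b², and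
b² ≥ μ₁ because sin(by) is an eigenfunction.

For the limit of Λ, the maximum of |u|² is bounded by a constant times P (`IsVelocity.sq_le`), and P
= -E'/(2ν) is a derivative in time. Therefore log Λ + cE is nonincreasing for a suitable c
(`IsSolution.palinstrophy_deriv_le`), and Λ converges since E does. Then Q' converges as well; as Q
converges, the limit of Q' is zero, and q > 0 forces lim Λ = q.

If q equals the initial quotient, Q is constant, Λ = Q, and the square above vanishes for c = q: ∇ω
= q(-u₂, u₁). Hence -Δω = qω and u · ∇ω = 0, so ω decays exponentially along a fixed eigenfunction.
Conversely an eigenfunction generates a Taylor vortex, and uniqueness (`IsSolution.eq_of_isFlow`)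
says that it is the solution. The same uniqueness makes q depend on ω₀ only.

As ω₀ is merely in L², the behaviour at t = 0 needs care. The velocity converges in L² because it
depends on the vorticity in a Lipschitz way, and its limit is identified with the prescribed weak
velocity through Fourier modes, whose totality comes from Stone–Weierstrass. Division by K is
legitimate because K cannot vanish in finite time (`IsSolution.kineticEnergy_pos_of_lt`). -/

namespace VortexStrip

/-! ### Calculus on the closed rectangle -/

section Calculus

variable {a b : ℝ} {f g : ℝ × ℝ → ℝ} {p : ℝ × ℝ}

lemma dom_subset_cdom : dom a b ⊆ cdom a b :=
  prod_mono Ioo_subset_Icc_self Ioo_subset_Icc_self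

lemma isOpen_dom : IsOpen (dom a b) := isOpen_Ioo.prod isOpen_Ioo

lemma isCompact_cdom : IsCompact (cdom a b) := isCompact_Icc.prod isCompact_Icc

lemma cdom_eq_Icc : cdom a b = Icc (0, 0) (Real.pi / a, Real.pi / b) := Icc_prod_Icc _ _ _ _

lemma closure_dom (ha : 0 < a) (hb : 0 < b) : closure (dom a b) = cdom a b := by
  rw [dom, cdom, closure_prod_eq, closure_Ioo (by positivity), closure_Ioo (by positivity)]

lemma interior_cdom : interior (cdom a b) = dom a b := by
  rw [dom, cdom, interior_prod_eq, interior_Icc, interior_Icc]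

lemma convex_cdom : Convex ℝ (cdom a b) := (convex_Icc _ _).prod (convex_Icc _ _)

lemma uniqueDiffOn_cdom (ha : 0 < a) (hb : 0 < b) : UniqueDiffOn ℝ (cdom a b) :=
  (uniqueDiffOn_Icc (by positivity)).prod (uniqueDiffOn_Icc (by positivity))

lemma cdom_mem_nhds (hp : p ∈ dom a b) : cdom a b ∈ 𝓝 p :=
  mem_of_superset (isOpen_dom.mem_nhds hp) dom_subset_cdom

lemma nonempty_dom (ha : 0 < a) (hb : 0 < b) : (dom a b).Nonempty :=
  (nonempty_Ioo.2 (by positivity)).prod (nonempty_Ioo.2 (by positivity))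

lemma eqOn_cdom_of_eqOn_dom (ha : 0 < a) (hb : 0 < b) (hf : ContinuousOn f (cdom a b))
    (hg : ContinuousOn g (cdom a b)) (h : EqOn f g (dom a b)) : EqOn f g (cdom a b) :=
  h.of_subset_closure hf hg dom_subset_cdom (closure_dom ha hb).ge

lemma dx_eq_fderiv (hp : p ∈ dom a b) : dx a b f p = fderiv ℝ f p (1, 0) := by
  rw [dx, fderivWithin_of_mem_nhds (cdom_mem_nhds hp)]

lemma dy_eq_fderiv (hp : p ∈ dom a b) : dy a b f p = fderiv ℝ f p (0, 1) := by
  rw [dy, fderivWithin_of_mem_nhds (cdom_mem_nhds hp)]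

lemma hasFDerivAt_of_dom (hf : DifferentiableOn ℝ f (cdom a b)) (hp : p ∈ dom a b) :
    HasFDerivAt f (fderivWithin ℝ f (cdom a b) p) p :=
  (hf p (dom_subset_cdom hp)).hasFDerivWithinAt.hasFDerivAt (cdom_mem_nhds hp)

lemma dx_congr (h : EqOn f g (cdom a b)) (hp : p ∈ cdom a b) : dx a b f p = dx a b g p := by
  rw [dx, dx, fderivWithin_congr h (h hp)]

lemma dy_congr (h : EqOn f g (cdom a b)) (hp : p ∈ cdom a b) : dy a b f p = dy a b g p := by
  rw [dy, dy, fderivWithin_congr h (h hp)]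

lemma dx_congr_dom (h : EqOn f g (dom a b)) (hp : p ∈ dom a b) : dx a b f p = dx a b g p := by
  rw [dx_eq_fderiv hp, dx_eq_fderiv hp, (h.eventuallyEq_of_mem (isOpen_dom.mem_nhds hp)).fderiv_eq]

lemma dy_congr_dom (h : EqOn f g (dom a b)) (hp : p ∈ dom a b) : dy a b f p = dy a b g p := by
  rw [dy_eq_fderiv hp, dy_eq_fderiv hp, (h.eventuallyEq_of_mem (isOpen_dom.mem_nhds hp)).fderiv_eq]

section Arithmetic

variable (ha : 0 < a) (hb : 0 < b) (hf : DifferentiableOn ℝ f (cdom a b))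
  (hg : DifferentiableOn ℝ g (cdom a b)) (hp : p ∈ cdom a b)
include ha hb hp

lemma _root_.HasFDerivWithinAt.dx_eq {f' : ℝ × ℝ →L[ℝ] ℝ}
    (h : HasFDerivWithinAt f f' (cdom a b) p) : dx a b f p = f' (1, 0) := by
  rw [dx, h.fderivWithin (uniqueDiffOn_cdom ha hb p hp)]

lemma _root_.HasFDerivWithinAt.dy_eq {f' : ℝ × ℝ →L[ℝ] ℝ}
    (h : HasFDerivWithinAt f f' (cdom a b) p) : dy a b f p = f' (0, 1) := by
  rw [dy, h.fderivWithin (uniqueDiffOn_cdom ha hb p hp)]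

lemma dx_const_mul (hf : DifferentiableOn ℝ f (cdom a b)) (c : ℝ) :
    dx a b (fun z => c * f z) p = c * dx a b f p := by
  rw [((hf p hp).hasFDerivWithinAt.const_mul c).dx_eq ha hb hp]; simp [dx]

lemma dy_const_mul (hf : DifferentiableOn ℝ f (cdom a b)) (c : ℝ) :
    dy a b (fun z => c * f z) p = c * dy a b f p := by
  rw [((hf p hp).hasFDerivWithinAt.const_mul c).dy_eq ha hb hp]; simp [dy]

lemma dx_neg (hf : DifferentiableOn ℝ f (cdom a b)) :
    dx a b (fun z => - f z) p = - dx a b f p := by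
  rw [((hf p hp).hasFDerivWithinAt.fun_neg).dx_eq ha hb hp]; simp [dx]

lemma dy_neg (hf : DifferentiableOn ℝ f (cdom a b)) :
    dy a b (fun z => - f z) p = - dy a b f p := by
  rw [((hf p hp).hasFDerivWithinAt.fun_neg).dy_eq ha hb hp]; simp [dy]

include hf hg

lemma dx_add : dx a b (fun z => f z + g z) p = dx a b f p + dx a b g p := by
  rw [((hf p hp).hasFDerivWithinAt.fun_add (hg p hp).hasFDerivWithinAt).dx_eq ha hb hp]; simp [dx]

lemma dx_sub : dx a b (fun z => f z - g z) p = dx a b f p - dx a b g p := by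
  rw [((hf p hp).hasFDerivWithinAt.fun_sub (hg p hp).hasFDerivWithinAt).dx_eq ha hb hp]; simp [dx]

lemma dy_sub : dy a b (fun z => f z - g z) p = dy a b f p - dy a b g p := by
  rw [((hf p hp).hasFDerivWithinAt.fun_sub (hg p hp).hasFDerivWithinAt).dy_eq ha hb hp]; simp [dy]

lemma dx_mul : dx a b (fun z => f z * g z) p = dx a b f p * g p + f p * dx a b g p := by
  rw [((hf p hp).hasFDerivWithinAt.fun_mul (hg p hp).hasFDerivWithinAt).dx_eq ha hb hp]
  simp [dx]; ring

lemma dy_mul : dy a b (fun z => f z * g z) p = dy a b f p * g p + f p * dy a b g p := by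
  rw [((hf p hp).hasFDerivWithinAt.fun_mul (hg p hp).hasFDerivWithinAt).dy_eq ha hb hp]
  simp [dy]; ring

end Arithmetic

lemma contDiffOn_dx (ha : 0 < a) (hb : 0 < b) {m n : WithTop ℕ∞} (hf : ContDiffOn ℝ n f (cdom a b))
    (h : m + 1 ≤ n) : ContDiffOn ℝ m (dx a b f) (cdom a b) :=
  (hf.fderivWithin (uniqueDiffOn_cdom ha hb) h).clm_apply contDiffOn_const

lemma contDiffOn_dy (ha : 0 < a) (hb : 0 < b) {m n : WithTop ℕ∞} (hf : ContDiffOn ℝ n f (cdom a b))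
    (h : m + 1 ≤ n) : ContDiffOn ℝ m (dy a b f) (cdom a b) :=
  (hf.fderivWithin (uniqueDiffOn_cdom ha hb) h).clm_apply contDiffOn_const

lemma continuousOn_dx (ha : 0 < a) (hb : 0 < b) (hf : ContDiffOn ℝ 1 f (cdom a b)) :
    ContinuousOn (dx a b f) (cdom a b) :=
  (contDiffOn_dx ha hb hf (m := 0) (by simp)).continuousOn

lemma continuousOn_dy (ha : 0 < a) (hb : 0 < b) (hf : ContDiffOn ℝ 1 f (cdom a b)) :
    ContinuousOn (dy a b f) (cdom a b) :=
  (contDiffOn_dy ha hb hf (m := 0) (by simp)).continuousOn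

/-- Symmetry of second derivatives up to the boundary: each point of `s` is a limit of interior
points. It serves both the rectangle and the space-time cylinder. -/
lemma fderivWithin_apply_comm {E : Type*} [NormedAddCommGroup E] [NormedSpace ℝ E] {s : Set E}
    (hs : UniqueDiffOn ℝ s) (hs' : s ⊆ closure (interior s)) {f : E → ℝ}
    (hf : ContDiffOn ℝ 2 f s) {p : E} (hp : p ∈ s) (v w : E) :
    fderivWithin ℝ (fun z => fderivWithin ℝ f s z v) s p w
      = fderivWithin ℝ (fun z => fderivWithin ℝ f s z w) s p v := by
  have hd : DifferentiableWithinAt ℝ (fderivWithin ℝ f s) s p :=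
    ((hf.fderivWithin hs (m := 1) (by norm_num)).differentiableOn (by norm_num)) p hp
  have key : ∀ v w : E, fderivWithin ℝ (fun z => fderivWithin ℝ f s z v) s p w
      = fderivWithin ℝ (fderivWithin ℝ f s) s p w v := by
    intro v w
    have := (hd.hasFDerivWithinAt.clm_apply (hasFDerivWithinAt_const v p s)).fderivWithin (hs p hp)
    rw [this]; simp
  rw [key, key]
  exact (ContDiffWithinAt.isSymmSndFDerivWithinAt (hf p hp) (by simp) hs (hs' hp) hp) w v

lemma dx_dy_comm (ha : 0 < a) (hb : 0 < b) (hf : ContDiffOn ℝ 2 f (cdom a b)) (hp : p ∈ cdom a b) :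
    dx a b (dy a b f) p = dy a b (dx a b f) p :=
  fderivWithin_apply_comm (uniqueDiffOn_cdom ha hb)
    (by rw [interior_cdom, closure_dom ha hb]) hf hp _ _

lemma hasDerivWithinAt_fst (hf : DifferentiableOn ℝ f (cdom a b)) {x y : ℝ}
    (hp : (x, y) ∈ cdom a b) :
    HasDerivWithinAt (fun s => f (s, y)) (dx a b f (x, y)) (Icc 0 (Real.pi / a)) x := by
  have h1 : HasDerivWithinAt (fun s : ℝ => (s, y)) (1, 0) (Icc 0 (Real.pi / a)) x :=
    (hasDerivWithinAt_id x _).prodMk (hasDerivWithinAt_const x _ y)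
  exact (hf _ hp).hasFDerivWithinAt.comp_hasDerivWithinAt x h1
    (fun s hs => (⟨hs, hp.2⟩ : (s, y) ∈ cdom a b))

lemma hasDerivWithinAt_snd (hf : DifferentiableOn ℝ f (cdom a b)) {x y : ℝ}
    (hp : (x, y) ∈ cdom a b) :
    HasDerivWithinAt (fun s => f (x, s)) (dy a b f (x, y)) (Icc 0 (Real.pi / b)) y := by
  have h1 : HasDerivWithinAt (fun s : ℝ => (x, s)) (0, 1) (Icc 0 (Real.pi / b)) y :=
    (hasDerivWithinAt_const y _ x).prodMk (hasDerivWithinAt_id y _)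
  exact (hf _ hp).hasFDerivWithinAt.comp_hasDerivWithinAt y h1
    (fun s hs => (⟨hp.1, hs⟩ : (x, s) ∈ cdom a b))

lemma dx_eq_zero_of_wall (ha : 0 < a) (hf : DifferentiableOn ℝ f (cdom a b)) {y : ℝ}
    (hy : y ∈ Icc 0 (Real.pi / b)) (h : ∀ x ∈ Icc 0 (Real.pi / a), f (x, y) = 0) :
    ∀ x ∈ Icc 0 (Real.pi / a), dx a b f (x, y) = 0 := by
  intro x hx
  have h1 := hasDerivWithinAt_fst hf (x := x) (y := y) ⟨hx, hy⟩
  have h2 : HasDerivWithinAt (fun s => f (s, y)) 0 (Icc 0 (Real.pi / a)) x :=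
    (hasDerivWithinAt_const x _ 0).congr h (h x hx)
  exact (uniqueDiffOn_Icc (by positivity) x hx).eq_deriv _ h1 h2

lemma dy_periodic (ha : 0 < a) (hb : 0 < b) (hf : DifferentiableOn ℝ f (cdom a b))
    (h : ∀ y ∈ Icc 0 (Real.pi / b), f (0, y) = f (Real.pi / a, y)) :
    ∀ y ∈ Icc 0 (Real.pi / b), dy a b f (0, y) = dy a b f (Real.pi / a, y) := by
  intro y hy
  have hX : 0 ≤ Real.pi / a := by positivity
  have h1 := hasDerivWithinAt_snd hf (x := 0) (y := y) ⟨left_mem_Icc.2 hX, hy⟩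
  have h2 := hasDerivWithinAt_snd hf (x := Real.pi / a) (y := y) ⟨right_mem_Icc.2 hX, hy⟩
  exact (uniqueDiffOn_Icc (by positivity) y hy).eq_deriv _ h1 (h2.congr h (h y hy))

/-! ### Integrals over the rectangle -/

instance : IsFiniteMeasure (vol a b) :=
  ⟨by rw [vol, Measure.restrict_apply_univ]
      exact (measure_mono dom_subset_cdom).trans_lt isCompact_cdom.measure_lt_top⟩

lemma integrable_vol (hf : ContinuousOn f (cdom a b)) : Integrable f (vol a b) :=
  (hf.integrableOn_compact isCompact_cdom).mono_set dom_subset_cdom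

lemma memLp_vol (hf : ContinuousOn f (cdom a b)) : MemLp f 2 (vol a b) := by
  rw [memLp_two_iff_integrable_sq]
  · exact integrable_vol (by fun_prop)
  · exact (integrable_vol hf).1

lemma ae_mem_dom : ∀ᵐ p ∂(vol a b), p ∈ dom a b := ae_restrict_mem isOpen_dom.measurableSet

lemma integral_congr_dom (h : EqOn f g (dom a b)) : ∫ p, f p ∂(vol a b) = ∫ p, g p ∂(vol a b) :=
  setIntegral_congr_fun isOpen_dom.measurableSet h

lemma integral_mono_dom (hf : ContinuousOn f (cdom a b)) (hg : ContinuousOn g (cdom a b))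
    (h : ∀ p ∈ dom a b, f p ≤ g p) : ∫ p, f p ∂(vol a b) ≤ ∫ p, g p ∂(vol a b) :=
  integral_mono_ae (integrable_vol hf) (integrable_vol hg) (ae_mem_dom.mono h)

lemma eqOn_dom_of_ae_eq (hf : ContinuousOn f (cdom a b)) (hg : ContinuousOn g (cdom a b))
    (h : f =ᵐ[vol a b] g) : EqOn f g (dom a b) :=
  Measure.eqOn_open_of_ae_eq h isOpen_dom (hf.mono dom_subset_cdom) (hg.mono dom_subset_cdom)

lemma eq_zero_of_integral_eq_zero (hf : ContinuousOn f (cdom a b)) (h0 : ∀ p ∈ dom a b, 0 ≤ f p)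
    (h : ∫ p, f p ∂(vol a b) = 0) : ∀ p ∈ dom a b, f p = 0 := by
  have h1 := (integral_eq_zero_iff_of_nonneg_ae (ae_mem_dom.mono h0) (integrable_vol hf)).1 h
  exact eqOn_dom_of_ae_eq hf continuousOn_const h1

lemma vol_eq_restrict_cdom : vol a b = volume.restrict (cdom a b) := by
  rw [vol, dom, cdom, Measure.volume_eq_prod, ← Measure.prod_restrict, ← Measure.prod_restrict,
    restrict_Ioo_eq_restrict_Icc, restrict_Ioo_eq_restrict_Icc]

/-- The divergence theorem on the rectangle for fields that are periodic in `x` and have the same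
normal component on both walls. -/
lemma integral_div (ha : 0 < a) (hb : 0 < b) (hf : ContDiffOn ℝ 1 f (cdom a b))
    (hg : ContDiffOn ℝ 1 g (cdom a b))
    (hper : ∀ y ∈ Icc 0 (Real.pi / b), f (0, y) = f (Real.pi / a, y))
    (hwall : ∀ x ∈ Icc 0 (Real.pi / a), g (x, 0) = g (x, Real.pi / b)) :
    ∫ p, (dx a b f p + dy a b g p) ∂(vol a b) = 0 := by
  have hX : 0 ≤ Real.pi / a := by positivity
  have hY : 0 ≤ Real.pi / b := by positivity
  have h1 := integral_divergence_prod_Icc_of_hasFDerivAt_of_le f g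
    (fderivWithin ℝ f (cdom a b)) (fderivWithin ℝ g (cdom a b)) (0, 0)
    (Real.pi / a, Real.pi / b) ⟨hX, hY⟩ (by rw [← cdom_eq_Icc]; exact hf.continuousOn)
    (by rw [← cdom_eq_Icc]; exact hg.continuousOn)
    (fun p hp => hasFDerivAt_of_dom (hf.differentiableOn one_ne_zero) hp)
    (fun p hp => hasFDerivAt_of_dom (hg.differentiableOn one_ne_zero) hp)
    (by
      rw [← cdom_eq_Icc]
      exact ((continuousOn_dx ha hb hf).add (continuousOn_dy ha hb hg)).integrableOn_compact
        isCompact_cdom)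
  rw [← cdom_eq_Icc, ← vol_eq_restrict_cdom] at h1
  simp only [dx, dy]
  rw [h1]
  have e1 : ∫ y in (0:ℝ)..Real.pi / b, f (Real.pi / a, y) = ∫ y in (0:ℝ)..Real.pi / b, f (0, y) :=
    intervalIntegral.integral_congr fun y hy => by
      rw [uIcc_of_le hY] at hy; exact (hper y hy).symm
  have e2 : ∫ x in (0:ℝ)..Real.pi / a, g (x, Real.pi / b) = ∫ x in (0:ℝ)..Real.pi / a, g (x, 0) :=
    intervalIntegral.integral_congr fun x hx => by
      rw [uIcc_of_le hX] at hx; exact (hwall x hx).symm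
  simp only [e1, e2]; ring

lemma integral_vol_eq_iterated (ha : 0 < a) (hb : 0 < b) (hf : ContinuousOn f (cdom a b)) :
    ∫ p, f p ∂(vol a b) = ∫ x in (0:ℝ)..Real.pi / a, ∫ y in (0:ℝ)..Real.pi / b, f (x, y) := by
  have hi : IntegrableOn f (Icc 0 (Real.pi / a) ×ˢ Icc 0 (Real.pi / b)) (volume.prod volume) :=
    hf.integrableOn_compact isCompact_cdom
  rw [vol_eq_restrict_cdom, cdom, Measure.volume_eq_prod, setIntegral_prod _ hi,
    integral_Icc_eq_integral_Ioc, ← intervalIntegral.integral_of_le (by positivity)]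
  refine intervalIntegral.integral_congr fun x _ => ?_
  rw [integral_Icc_eq_integral_Ioc, ← intervalIntegral.integral_of_le (by positivity)]

end Calculus

/-! ### Integral identities as functions of zero mean -/

section ZeroMean

variable {a b : ℝ} {f g : ℝ × ℝ → ℝ} {p : ℝ × ℝ}

/-- Integrable functions on the rectangle with vanishing integral. -/
def ZeroMean (a b : ℝ) (f : ℝ × ℝ → ℝ) : Prop :=
  Integrable f (vol a b) ∧ ∫ p, f p ∂(vol a b) = 0

lemma ZeroMean.add (hf : ZeroMean a b f) (hg : ZeroMean a b g) :
    ZeroMean a b (fun p => f p + g p) :=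
  ⟨hf.1.add hg.1, by rw [integral_add hf.1 hg.1, hf.2, hg.2, add_zero]⟩

lemma ZeroMean.sub (hf : ZeroMean a b f) (hg : ZeroMean a b g) :
    ZeroMean a b (fun p => f p - g p) :=
  ⟨hf.1.sub hg.1, by rw [integral_sub hf.1 hg.1, hf.2, hg.2, sub_zero]⟩

lemma ZeroMean.const_mul (hf : ZeroMean a b f) (c : ℝ) : ZeroMean a b (fun p => c * f p) :=
  ⟨hf.1.const_mul c, by rw [integral_const_mul, hf.2, mul_zero]⟩

lemma ZeroMean.congr (hf : ZeroMean a b f) (h : EqOn f g (dom a b)) : ZeroMean a b g :=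
  ⟨hf.1.congr (ae_mem_dom.mono h), by rw [← integral_congr_dom h, hf.2]⟩

/-- Integrations by parts are recorded as functions of zero mean, so that they can be added, scaled
and rewritten pointwise in the open rectangle. This turns the final combination back into an
equality of integrals. -/
lemma ZeroMean.integral_eq (h : ZeroMean a b (fun p => f p - g p))
    (hf : ContinuousOn f (cdom a b)) (hg : ContinuousOn g (cdom a b)) :
    ∫ p, f p ∂(vol a b) = ∫ p, g p ∂(vol a b) := by
  have := h.2
  rwa [integral_sub (integrable_vol hf) (integrable_vol hg), sub_eq_zero] at this

lemma zeroMean_div (ha : 0 < a) (hb : 0 < b) (hf : ContDiffOn ℝ 1 f (cdom a b))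
    (hg : ContDiffOn ℝ 1 g (cdom a b))
    (hper : ∀ y ∈ Icc 0 (Real.pi / b), f (0, y) = f (Real.pi / a, y))
    (hwall : ∀ x ∈ Icc 0 (Real.pi / a), g (x, 0) = g (x, Real.pi / b)) :
    ZeroMean a b (fun p => dx a b f p + dy a b g p) :=
  ⟨integrable_vol ((continuousOn_dx ha hb hf).add (continuousOn_dy ha hb hg)),
    integral_div ha hb hf hg hper hwall⟩

end ZeroMean

/-! ### Wirtinger's inequality, potentials and stream functions -/

section Static

variable {a b : ℝ} {f g : ℝ × ℝ → ℝ} {p : ℝ × ℝ}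

lemma left_mem (ha : 0 < a) : (0 : ℝ) ∈ Icc 0 (Real.pi / a) := left_mem_Icc.2 (by positivity)

lemma right_mem (ha : 0 < a) : Real.pi / a ∈ Icc 0 (Real.pi / a) :=
  right_mem_Icc.2 (by positivity)

/-- Wirtinger's inequality in the direction across the channel. -/
lemma wirtinger (ha : 0 < a) (hb : 0 < b) (hf : ContDiffOn ℝ 1 f (cdom a b))
    (h0 : ∀ x ∈ Icc 0 (Real.pi / a), f (x, 0) = 0)
    (h1 : ∀ x ∈ Icc 0 (Real.pi / a), f (x, Real.pi / b) = 0) :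
    b ^ 2 * ∫ p, f p ^ 2 ∂(vol a b) ≤ ∫ p, dy a b f p ^ 2 ∂(vol a b) := by
  -- Jacobi's device: for T = tan(c(y - π/(2b))) one has ∂_y T = c(1 + T²), so ∂_y(cTf²) = (∂_y f +
  -- cTf)² - (∂_y f)² + c²f². The left side integrates to zero because f vanishes on the walls. For
  -- c < b the tangent is smooth on the closed rectangle; c = b is reached in the limit.
  have key : ∀ c ∈ Ioo 0 b, c ^ 2 * ∫ p, f p ^ 2 ∂(vol a b) ≤ ∫ p, dy a b f p ^ 2 ∂(vol a b) := by
    intro c hc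
    set θ : ℝ × ℝ → ℝ := fun p => c * (p.2 - Real.pi / b / 2) with hθ
    have hcos : ∀ p ∈ cdom a b, Real.cos (θ p) ≠ 0 := by
      intro p hp
      have hp1 : 0 ≤ p.2 := hp.2.1
      have hp2 : p.2 ≤ Real.pi / b := hp.2.2
      have hpi : c * (Real.pi / b) < Real.pi := by
        rw [mul_div_assoc', div_lt_iff₀ hb, mul_comm]
        exact mul_lt_mul_of_pos_left hc.2 Real.pi_pos
      refine (Real.cos_pos_of_mem_Ioo ⟨?_, ?_⟩).ne' <;> simp only [hθ] <;>
        nlinarith [hc.1, mul_nonneg hc.1.le hp1, mul_nonneg hc.1.le (sub_nonneg.2 hp2)]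
    set T : ℝ × ℝ → ℝ := fun p => Real.sin (θ p) / Real.cos (θ p) with hT
    have hTc : ContDiffOn ℝ 1 T (cdom a b) := by
      refine ContDiffOn.div ?_ ?_ hcos
      · exact (Real.contDiff_sin.comp (by fun_prop : ContDiff ℝ 1 θ)).contDiffOn
      · exact (Real.contDiff_cos.comp (by fun_prop : ContDiff ℝ 1 θ)).contDiffOn
    have hTd : ∀ p ∈ cdom a b, dy a b T p = c * (1 + T p ^ 2) := by
      intro p hp
      have hd : HasDerivWithinAt (fun s => T (p.1, s)) (c * (1 + T p ^ 2))
          (Icc 0 (Real.pi / b)) p.2 := by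
        have h2 : HasDerivAt (fun s : ℝ => c * (s - Real.pi / b / 2)) (c * 1) p.2 :=
          ((hasDerivAt_id p.2).sub_const _).const_mul c
        have h3 := (h2.sin.div h2.cos (hcos p hp)).hasDerivWithinAt (s := Icc 0 (Real.pi / b))
        refine h3.congr_deriv ?_
        have h4 := hcos p hp
        change (Real.cos (θ p) * (c * 1) * Real.cos (θ p)
          - Real.sin (θ p) * (-Real.sin (θ p) * (c * 1))) / Real.cos (θ p) ^ 2
          = c * (1 + (Real.sin (θ p) / Real.cos (θ p)) ^ 2)
        field_simp
        ring
      exact (uniqueDiffOn_Icc (by positivity) p.2 hp.2).eq_deriv _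
        (hasDerivWithinAt_snd (hTc.differentiableOn one_ne_zero) (x := p.1) (y := p.2) hp) hd
    have hF : ContDiffOn ℝ 1 (fun p => c * (T p * (f p * f p))) (cdom a b) := by fun_prop
    have hz := (zeroMean_div ha hb (f := fun _ => 0) contDiffOn_const hF (fun _ _ => rfl)
      (fun x hx => by simp [h0 x hx, h1 x hx]))
    have hfd := hf.differentiableOn one_ne_zero
    have hTdf := hTc.differentiableOn one_ne_zero
    have hfy := continuousOn_dy ha hb hf
    have hf' := hf.continuousOn
    have hT' := hTc.continuousOn
    have heq : EqOn (fun p => dx a b (fun _ => (0 : ℝ)) p + dy a b (fun p => c * (T p * (f p * f p))) p)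
        (fun p => (dy a b f p + c * (T p * f p)) ^ 2 - (dy a b f p ^ 2 - c ^ 2 * f p ^ 2))
        (dom a b) := by
      intro p hp
      have hp' := dom_subset_cdom hp
      simp only
      rw [dy_const_mul ha hb hp' (by fun_prop), dy_mul ha hb hTdf (by fun_prop) hp',
        dy_mul ha hb hfd hfd hp', hTd p hp']
      simp [dx]
      ring
    have h := (hz.congr heq).integral_eq (by fun_prop) (by fun_prop)
    rw [integral_sub (integrable_vol (by fun_prop)) (integrable_vol (by fun_prop)),
      integral_const_mul] at h
    have : 0 ≤ ∫ p, (dy a b f p + c * (T p * f p)) ^ 2 ∂(vol a b) :=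
      integral_nonneg fun _ => sq_nonneg _
    linarith
  have hlim : Tendsto (fun c : ℝ => c ^ 2 * ∫ p, f p ^ 2 ∂(vol a b)) (𝓝[<] b)
      (𝓝 (b ^ 2 * ∫ p, f p ^ 2 ∂(vol a b))) :=
    tendsto_nhdsWithin_of_tendsto_nhds ((continuous_id.pow 2).mul continuous_const).continuousAt
  exact le_of_tendsto hlim (by filter_upwards [Ioo_mem_nhdsLT hb] with c hc using key c hc)

/-- `ψ` is a stream function of the field `(v₁, v₂)`, vanishing on the walls. -/
structure IsStream (a b : ℝ) (ψ v₁ v₂ : ℝ × ℝ → ℝ) : Prop where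
  contDiffOn : ContDiffOn ℝ 2 ψ (cdom a b)
  dx_eq : ∀ p ∈ cdom a b, dx a b ψ p = v₂ p
  dy_eq : ∀ p ∈ cdom a b, dy a b ψ p = -v₁ p
  bottom : ∀ x ∈ Icc 0 (Real.pi / a), ψ (x, 0) = 0
  top : ∀ x ∈ Icc 0 (Real.pi / a), ψ (x, Real.pi / b) = 0
  periodic : ∀ y ∈ Icc 0 (Real.pi / b), ψ (0, y) = ψ (Real.pi / a, y)

/-- Poincaré's lemma on a convex set for the closed 1-form g₁ dx + g₂ dy; closedness extends to the
boundary by continuity. -/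
lemma exists_potential (ha : 0 < a) (hb : 0 < b) {g₁ g₂ : ℝ × ℝ → ℝ}
    (h₁ : ContDiffOn ℝ 1 g₁ (cdom a b)) (h₂ : ContDiffOn ℝ 1 g₂ (cdom a b))
    (h : ∀ p ∈ dom a b, dx a b g₂ p = dy a b g₁ p) :
    ∃ ψ, ContDiffOn ℝ 2 ψ (cdom a b) ∧ (∀ p ∈ cdom a b, dx a b ψ p = g₁ p) ∧
      ∀ p ∈ cdom a b, dy a b ψ p = g₂ p := by
  have hcl : EqOn (dx a b g₂) (dy a b g₁) (cdom a b) :=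
    eqOn_cdom_of_eqOn_dom ha hb (continuousOn_dx ha hb h₂) (continuousOn_dy ha hb h₁) h
  let W : ℝ × ℝ → (ℝ × ℝ →L[ℝ] ℝ) := fun p =>
    g₁ p • ContinuousLinearMap.fst ℝ ℝ ℝ + g₂ p • ContinuousLinearMap.snd ℝ ℝ ℝ
  have hW : ContDiffOn ℝ 1 W (cdom a b) :=
    (h₁.smul contDiffOn_const).add (h₂.smul contDiffOn_const)
  have hexp : ∀ (g : ℝ × ℝ → ℝ) (p v : ℝ × ℝ), fderivWithin ℝ g (cdom a b) p v
      = v.1 * dx a b g p + v.2 * dy a b g p := by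
    intro g p v
    have : v = v.1 • ((1, 0) : ℝ × ℝ) + v.2 • ((0, 1) : ℝ × ℝ) := by ext <;> simp
    conv_lhs => rw [this]
    rw [map_add, map_smul, map_smul]; rfl
  obtain ⟨ψ, hψ⟩ := convex_cdom.exists_forall_hasFDerivWithinAt_of_fderivWithin_symmetric
    (hW.differentiableOn one_ne_zero) (by
      intro p hp x _ y _
      have hd : HasFDerivWithinAt W _ (cdom a b) p :=
        ((h₁.differentiableOn one_ne_zero p hp).hasFDerivWithinAt.smul_const
          (ContinuousLinearMap.fst ℝ ℝ ℝ)).add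
        ((h₂.differentiableOn one_ne_zero p hp).hasFDerivWithinAt.smul_const
          (ContinuousLinearMap.snd ℝ ℝ ℝ))
      rw [hd.fderivWithin (uniqueDiffOn_cdom ha hb p hp)]
      simp only [add_apply, ContinuousLinearMap.smulRight_apply,
        smul_apply, ContinuousLinearMap.coe_fst', ContinuousLinearMap.coe_snd',
        smul_eq_mul, hexp, hcl hp]
      ring)
  refine ⟨ψ, ?_, fun p hp => ?_, fun p hp => ?_⟩
  · rw [show (2 : WithTop ℕ∞) = 1 + 1 by norm_num,
      contDiffOn_succ_iff_fderivWithin (uniqueDiffOn_cdom ha hb)]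
    refine ⟨fun p hp => (hψ p hp).differentiableWithinAt, by simp, hW.congr fun p hp => ?_⟩
    exact (hψ p hp).fderivWithin (uniqueDiffOn_cdom ha hb p hp)
  · rw [(hψ p hp).dx_eq ha hb hp]; simp [W]
  · rw [(hψ p hp).dy_eq ha hb hp]; simp [W]

/-- A potential of (v₂, -v₁) is constant on each wall because v₂ = 0 there. The two constants agree
because v₁ has mean zero, and then the lack of penetration also makes the potential periodic.
Subtracting the common wall value gives the stream function. -/
lemma exists_stream (ha : 0 < a) (hb : 0 < b) {v₁ v₂ : ℝ × ℝ → ℝ}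
    (h₁ : ContDiffOn ℝ 1 v₁ (cdom a b)) (h₂ : ContDiffOn ℝ 1 v₂ (cdom a b))
    (hdiv : ∀ p ∈ dom a b, dx a b v₁ p + dy a b v₂ p = 0)
    (hbot : ∀ x ∈ Icc 0 (Real.pi / a), v₂ (x, 0) = 0)
    (htop : ∀ x ∈ Icc 0 (Real.pi / a), v₂ (x, Real.pi / b) = 0)
    (hper : ∀ y ∈ Icc 0 (Real.pi / b), v₁ (0, y) = v₁ (Real.pi / a, y))
    (hmean : ∫ p, v₁ p ∂(vol a b) = 0) : ∃ ψ, IsStream a b ψ v₁ v₂ := by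
  obtain ⟨ψ, hψ, hx, hy⟩ := exists_potential ha hb h₂ h₁.neg (fun p hp => by
    change dx a b (fun z => - v₁ z) p = _
    rw [dx_neg ha hb (dom_subset_cdom hp) (h₁.differentiableOn one_ne_zero)]
    linarith [hdiv p hp])
  have hd := hψ.differentiableOn (by norm_num : (2 : WithTop ℕ∞) ≠ 0)
  have hwall : ∀ y ∈ Icc 0 (Real.pi / b), (∀ x ∈ Icc 0 (Real.pi / a), v₂ (x, y) = 0) →
      ∀ x ∈ Icc 0 (Real.pi / a), ψ (x, y) = ψ (0, y) := by
    intro y hy' h0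
    refine constant_of_has_deriv_right_zero (f := fun x => ψ (x, y)) ?_ ?_
    · exact fun x hx' => (hasDerivWithinAt_fst hd (x := x) (y := y) ⟨hx', hy'⟩).continuousWithinAt
    · intro x hx'
      have hx'' := Ico_subset_Icc_self hx'
      have := hasDerivWithinAt_fst hd (x := x) (y := y) ⟨hx'', hy'⟩
      rw [hx _ ⟨hx'', hy'⟩, h0 x hx''] at this
      exact this.mono_of_mem_nhdsWithin (Icc_mem_nhdsGE_of_mem hx')
  have hbot' := hwall 0 (left_mem hb) hbot
  have htop' := hwall _ (right_mem hb) htop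
  have hper' : ∀ y ∈ Icc 0 (Real.pi / b), ψ (Real.pi / a, y) - ψ (0, y) = 0 := by
    intro y hy'
    rw [constant_of_has_deriv_right_zero (f := fun y => ψ (Real.pi / a, y) - ψ (0, y)) ?_ ?_ y hy',
      hbot' _ (right_mem ha), sub_self]
    · exact fun y hy' =>
        ((hasDerivWithinAt_snd hd ⟨right_mem ha, hy'⟩).sub
          (hasDerivWithinAt_snd hd ⟨left_mem ha, hy'⟩)).continuousWithinAt
    · intro y hy'
      have hy'' := Ico_subset_Icc_self hy'
      have := (hasDerivWithinAt_snd hd ⟨right_mem ha, hy''⟩).sub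
          (hasDerivWithinAt_snd hd ⟨left_mem ha, hy''⟩)
      rw [hy _ ⟨right_mem ha, hy''⟩, hy _ ⟨left_mem ha, hy''⟩] at this
      rw [hper y hy'', sub_self] at this
      exact this.mono_of_mem_nhdsWithin (Icc_mem_nhdsGE_of_mem hy')
  set C := ψ (0, Real.pi / b) - ψ (0, 0) with hC
  have hC0 : C = 0 := by
    -- Subtracting the linear interpolation of the wall values equalizes them, so the divergence
    -- theorem applies; since v₁ has mean zero, only the integral of the constant C·b/π is left.
    have hg : ContDiffOn ℝ 1 (fun p : ℝ × ℝ => ψ p - C * (b / Real.pi) * p.2) (cdom a b) :=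
      (hψ.of_le (by norm_num)).sub (contDiff_const.mul contDiff_snd).contDiffOn
    have h := (zeroMean_div ha hb (f := fun _ => 0) contDiffOn_const hg (fun _ _ => rfl) (by
      intro x hx'
      simp only [hbot' x hx', htop' x hx', hC]
      have := Real.pi_pos
      field_simp; ring)).2
    have hcg : EqOn (fun p => dx a b (fun _ => (0 : ℝ)) p
        + dy a b (fun p : ℝ × ℝ => ψ p - C * (b / Real.pi) * p.2) p)
        (fun p => - v₁ p - C * (b / Real.pi)) (dom a b) := by
      intro p hp
      have hp' := dom_subset_cdom hp
      have h2 : HasFDerivWithinAt (fun p : ℝ × ℝ => C * (b / Real.pi) * p.2)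
          ((C * (b / Real.pi)) • ContinuousLinearMap.snd ℝ ℝ ℝ) (cdom a b) p :=
        hasFDerivWithinAt_snd.const_mul _
      simp only
      rw [dy_sub ha hb hd (fun q hq => (hasFDerivWithinAt_snd.const_mul _).differentiableWithinAt)
        hp', h2.dy_eq ha hb hp', hy p hp']
      simp [dx]
    rw [integral_congr_dom hcg, integral_sub (integrable_vol h₁.neg.continuousOn)
      (integrable_const _), integral_neg, hmean, neg_zero, zero_sub, neg_eq_zero] at h
    -- The sign of the constant is unknown, so its square is integrated instead.
    have h3 : ∫ p, (C * (b / Real.pi)) * (C * (b / Real.pi)) ∂(vol a b) = 0 := by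
      rw [integral_const_mul, h, mul_zero]
    obtain ⟨p, hp⟩ := nonempty_dom ha hb
    have := eq_zero_of_integral_eq_zero (f := fun _ => (C * (b / Real.pi)) * (C * (b / Real.pi)))
      continuousOn_const (fun _ _ => mul_self_nonneg _) h3 p hp
    have h4 : b / Real.pi ≠ 0 := by positivity
    simpa [h4] using this
  refine ⟨fun p => ψ p - ψ (0, 0), hψ.sub contDiffOn_const, fun p hp => ?_, fun p hp => ?_,
    fun x hx' => ?_, fun x hx' => ?_, fun y hy' => ?_⟩
  · rw [((hd p hp).hasFDerivWithinAt.sub_const _).dx_eq ha hb hp, ← hx p hp]; rfl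
  · rw [((hd p hp).hasFDerivWithinAt.sub_const _).dy_eq ha hb hp]; exact hy p hp
  · simp [hbot' x hx']
  · simp only [htop' x hx']; exact hC0
  · have := hper' y hy'
    linarith

end Static

/-! ### Integration by parts and a Sobolev inequality -/

section Static

variable {a b : ℝ} {f g : ℝ × ℝ → ℝ} {p : ℝ × ℝ}

/-- The inner product of a field with `z` is minus the integral of ψ curl z. As ψ vanishes on the
walls, `z` needs no wall condition. -/
lemma IsStream.zeroMean_inner (ha : 0 < a) (hb : 0 < b) {ψ v₁ v₂ z₁ z₂ : ℝ × ℝ → ℝ}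
    (hψ : IsStream a b ψ v₁ v₂) (hz₁ : ContDiffOn ℝ 1 z₁ (cdom a b))
    (hz₂ : ContDiffOn ℝ 1 z₂ (cdom a b))
    (hper : ∀ y ∈ Icc 0 (Real.pi / b), z₂ (0, y) = z₂ (Real.pi / a, y)) :
    ZeroMean a b (fun p => v₁ p * z₁ p + v₂ p * z₂ p + ψ p * (dx a b z₂ p - dy a b z₁ p)) := by
  have hψ1 : ContDiffOn ℝ 1 ψ (cdom a b) := hψ.contDiffOn.of_le (by norm_num)
  have d0 := hψ1.differentiableOn one_ne_zero
  have d1 := hz₁.differentiableOn one_ne_zero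
  have d2 := hz₂.differentiableOn one_ne_zero
  refine (zeroMean_div ha hb (f := fun p => ψ p * z₂ p) (g := fun p => -(ψ p * z₁ p))
    (hψ1.mul hz₂) (hψ1.mul hz₁).neg (fun y hy => ?_) (fun x hx => ?_)).congr fun p hp => ?_
  · simp only [hψ.periodic y hy, hper y hy]
  · simp only [hψ.bottom x hx, hψ.top x hx, zero_mul]
  · have hp' := dom_subset_cdom hp
    simp only
    rw [dy_neg ha hb hp' (d0.fun_mul d1), dx_mul ha hb d0 d2 hp', dy_mul ha hb d0 d1 hp',
      hψ.dx_eq p hp', hψ.dy_eq p hp']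
    ring

lemma zeroMean_green (ha : 0 < a) (hb : 0 < b) (hf : ContDiffOn ℝ 1 f (cdom a b))
    (hg : ContDiffOn ℝ 2 g (cdom a b))
    (hbot : ∀ x ∈ Icc 0 (Real.pi / a), f (x, 0) = 0)
    (htop : ∀ x ∈ Icc 0 (Real.pi / a), f (x, Real.pi / b) = 0)
    (hper : ∀ y ∈ Icc 0 (Real.pi / b), f (0, y) = f (Real.pi / a, y))
    (hper' : ∀ y ∈ Icc 0 (Real.pi / b), dx a b g (0, y) = dx a b g (Real.pi / a, y)) :
    ZeroMean a b
      (fun p => f p * lap a b g p + (dx a b f p * dx a b g p + dy a b f p * dy a b g p)) := by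
  have hgx := contDiffOn_dx ha hb hg (m := 1) (by norm_num)
  have hgy := contDiffOn_dy ha hb hg (m := 1) (by norm_num)
  have d0 := hf.differentiableOn one_ne_zero
  refine (zeroMean_div ha hb (hf.mul hgx) (hf.mul hgy) (fun y hy => ?_)
    (fun x hx => ?_)).congr fun p hp => ?_
  · simp only [hper y hy, hper' y hy]
  · simp only [hbot x hx, htop x hx, zero_mul]
  · have hp' := dom_subset_cdom hp
    simp only
    rw [dx_mul ha hb d0 (hgx.differentiableOn one_ne_zero) hp',
      dy_mul ha hb d0 (hgy.differentiableOn one_ne_zero) hp', lap]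
    ring

lemma zeroMean_transport (ha : 0 < a) (hb : 0 < b) {u₁ u₂ : ℝ × ℝ → ℝ}
    (h₁ : ContDiffOn ℝ 1 u₁ (cdom a b)) (h₂ : ContDiffOn ℝ 1 u₂ (cdom a b))
    (hf : ContDiffOn ℝ 1 f (cdom a b))
    (hdiv : ∀ p ∈ dom a b, dx a b u₁ p + dy a b u₂ p = 0)
    (hbot : ∀ x ∈ Icc 0 (Real.pi / a), u₂ (x, 0) = 0)
    (htop : ∀ x ∈ Icc 0 (Real.pi / a), u₂ (x, Real.pi / b) = 0)
    (hper : ∀ y ∈ Icc 0 (Real.pi / b), u₁ (0, y) = u₁ (Real.pi / a, y))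
    (hfper : ∀ y ∈ Icc 0 (Real.pi / b), f (0, y) = f (Real.pi / a, y)) :
    ZeroMean a b (fun p => u₁ p * dx a b f p + u₂ p * dy a b f p) := by
  have d0 := hf.differentiableOn one_ne_zero
  refine (zeroMean_div ha hb (h₁.mul hf) (h₂.mul hf) (fun y hy => ?_)
    (fun x hx => ?_)).congr fun p hp => ?_
  · simp only [hper y hy, hfper y hy]
  · simp only [hbot x hx, htop x hx, zero_mul]
  · have hp' := dom_subset_cdom hp
    simp only
    rw [dx_mul ha hb (h₁.differentiableOn one_ne_zero) d0 hp',
      dy_mul ha hb (h₂.differentiableOn one_ne_zero) d0 hp']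
    linear_combination f p * hdiv p hp

/-- For a field that is tangent to the walls and periodic in `x`, divergence and curl control the
full gradient. -/
lemma zeroMean_gradient (ha : 0 < a) (hb : 0 < b) {u₁ u₂ : ℝ × ℝ → ℝ}
    (h₁ : ContDiffOn ℝ 2 u₁ (cdom a b)) (h₂ : ContDiffOn ℝ 2 u₂ (cdom a b))
    (hbot : ∀ x ∈ Icc 0 (Real.pi / a), u₂ (x, 0) = 0)
    (htop : ∀ x ∈ Icc 0 (Real.pi / a), u₂ (x, Real.pi / b) = 0)
    (hper₁ : ∀ y ∈ Icc 0 (Real.pi / b), u₁ (0, y) = u₁ (Real.pi / a, y))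
    (hper₂ : ∀ y ∈ Icc 0 (Real.pi / b), u₂ (0, y) = u₂ (Real.pi / a, y)) :
    ZeroMean a b (fun p => dx a b u₁ p ^ 2 + dy a b u₁ p ^ 2 + dx a b u₂ p ^ 2 + dy a b u₂ p ^ 2
      - ((dx a b u₁ p + dy a b u₂ p) ^ 2 + (dx a b u₂ p - dy a b u₁ p) ^ 2)) := by
  have c1 : ContDiffOn ℝ 1 u₁ (cdom a b) := h₁.of_le (by norm_num)
  have h2x := contDiffOn_dx ha hb h₂ (m := 1) (by norm_num)
  have h2y := contDiffOn_dy ha hb h₂ (m := 1) (by norm_num)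
  have d0 := c1.differentiableOn one_ne_zero
  have hwall : ∀ y ∈ Icc 0 (Real.pi / b), (∀ x ∈ Icc 0 (Real.pi / a), u₂ (x, y) = 0) →
      ∀ x ∈ Icc 0 (Real.pi / a), dx a b u₂ (x, y) = 0 := fun y hy =>
    dx_eq_zero_of_wall ha (h₂.differentiableOn (by norm_num)) hy
  -- The integrand is -2 times the Jacobian of (u₁, u₂), which is the divergence of (u₁ ∂_y u₂, -u₁
  -- ∂ₓu₂). The flux through the walls vanishes because u₂ = 0 there implies ∂ₓu₂ = 0.
  refine ((zeroMean_div ha hb (f := fun p => u₁ p * dy a b u₂ p)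
    (g := fun p => -(u₁ p * dx a b u₂ p)) (c1.mul h2y) (c1.mul h2x).neg (fun y hy => ?_)
    (fun x hx => ?_)).const_mul (-2)).congr fun p hp => ?_
  · simp only [hper₁ y hy, dy_periodic ha hb (h₂.differentiableOn (by norm_num)) hper₂ y hy]
  · simp only [hwall 0 (left_mem hb) hbot x hx, hwall _ (right_mem hb) htop x hx, mul_zero]
  · have hp' := dom_subset_cdom hp
    simp only
    rw [dy_neg ha hb hp' (d0.fun_mul (h2x.differentiableOn one_ne_zero)),
      dx_mul ha hb d0 (h2y.differentiableOn one_ne_zero) hp',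
      dy_mul ha hb d0 (h2x.differentiableOn one_ne_zero) hp', dx_dy_comm ha hb h₂ hp']
    ring

/-- The square of `h` changes between two points by at most ∫ |2hh'| ≤ ∫ (h² + h'²); averaging over
the second point gives the bound. -/
lemma sq_le_integral_Icc {L : ℝ} (hL : 0 < L) {h h' : ℝ → ℝ}
    (hd : ∀ x ∈ Icc 0 L, HasDerivWithinAt h (h' x) (Icc 0 L) x) (hc : ContinuousOn h' (Icc 0 L))
    {x : ℝ} (hx : x ∈ Icc 0 L) :
    h x ^ 2 ≤ (1 / L + 1) * ∫ s in (0:ℝ)..L, (h s ^ 2 + h' s ^ 2) := by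
  have hh : ContinuousOn h (Icc 0 L) := fun s hs => (hd s hs).continuousWithinAt
  set S := ∫ s in (0:ℝ)..L, (h s ^ 2 + h' s ^ 2) with hS
  have hii : ∀ {G : ℝ → ℝ}, ContinuousOn G (Icc 0 L) → ∀ {s t : ℝ}, s ∈ Icc 0 L → t ∈ Icc 0 L →
      IntervalIntegrable G volume s t := by
    intro G hG s t hs ht
    exact (hG.mono (by
      rw [← uIcc_of_le hL.le] at hs ht ⊢; exact uIcc_subset_uIcc hs ht)).intervalIntegrable
  have h0 : (0:ℝ) ∈ Icc 0 L := ⟨le_rfl, hL.le⟩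
  have h1 : L ∈ Icc 0 L := ⟨hL.le, le_rfl⟩
  have key : ∀ s ∈ Icc 0 L, h x ^ 2 - S ≤ h s ^ 2 := by
    intro s hs
    have hsub : uIcc s x ⊆ Icc 0 L := by
      rw [← uIcc_of_le hL.le] at hs hx ⊢; exact uIcc_subset_uIcc hs hx
    have e : ∫ r in s..x, 2 * h r * h' r = h x ^ 2 - h s ^ 2 := by
      refine intervalIntegral.integral_eq_sub_of_hasDeriv_right (f := fun r => h r ^ 2)
        ((hh.mono hsub).pow 2) ?_ (hii (by fun_prop) hs hx)
      intro r hr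
      have hr' : r ∈ Ioo 0 L := by
        constructor
        · exact lt_of_le_of_lt (le_min hs.1 hx.1) hr.1
        · exact lt_of_lt_of_le hr.2 (max_le hs.2 hx.2)
      have h3 := (hd r (Ioo_subset_Icc_self hr')).hasDerivAt (Icc_mem_nhds hr'.1 hr'.2)
      have := (h3.fun_pow 2).hasDerivWithinAt (s := Ioi r)
      simpa using this
    have e2 : |∫ r in s..x, 2 * h r * h' r| ≤ S := by
      refine (intervalIntegral.norm_integral_le_integral_norm_uIoc
        (f := fun r => 2 * h r * h' r) (μ := volume)).trans ?_
      rw [hS, intervalIntegral.integral_of_le hL.le]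
      have hsub' : uIoc s x ⊆ Ioc 0 L := by
        intro r hr
        exact ⟨lt_of_le_of_lt (le_min hs.1 hx.1) hr.1, hr.2.trans (max_le hs.2 hx.2)⟩
      have hi2 := (hii (G := fun r => h r ^ 2 + h' r ^ 2) (by fun_prop) h0 h1).1
      have hi3 := (hii (G := fun r => |2 * h r * h' r|) (by fun_prop) h0 h1).1
      calc ∫ r in uIoc s x, |2 * h r * h' r| ≤ ∫ r in uIoc s x, (h r ^ 2 + h' r ^ 2) := by
            refine setIntegral_mono (hi3.mono_set hsub') (hi2.mono_set hsub') fun r => ?_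
            exact abs_le.2 ⟨by nlinarith [sq_nonneg (h r + h' r)],
              by nlinarith [sq_nonneg (h r - h' r)]⟩
        _ ≤ _ := setIntegral_mono_set hi2 (ae_of_all _ fun r => by positivity)
            hsub'.eventuallyLE
    rw [e] at e2
    linarith [(abs_le.1 e2).2]
  have h2 : ∫ _ in (0:ℝ)..L, (h x ^ 2 - S) ≤ ∫ s in (0:ℝ)..L, h s ^ 2 :=
    intervalIntegral.integral_mono_on hL.le (by simp) (hii (by fun_prop) h0 h1) key
  have h3 : ∫ s in (0:ℝ)..L, h s ^ 2 ≤ S :=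
    intervalIntegral.integral_mono_on hL.le (hii (by fun_prop) h0 h1) (hii (by fun_prop) h0 h1)
      fun s _ => le_add_of_nonneg_right (sq_nonneg _)
  rw [intervalIntegral.integral_const, smul_eq_mul, sub_zero] at h2
  have h4 : h x ^ 2 - S ≤ 1 / L * S := by
    rw [div_mul_eq_mul_div, one_mul, le_div_iff₀ hL]; linarith
  linarith

/-- A Sobolev inequality on the rectangle: one derivative in each direction suffices. -/
lemma sq_le_integral_vol (ha : 0 < a) (hb : 0 < b) (hf : ContDiffOn ℝ 2 f (cdom a b))
    (hp : p ∈ cdom a b) :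
    f p ^ 2 ≤ (1 / (Real.pi / a) + 1) * (1 / (Real.pi / b) + 1) *
      ∫ q, (f q ^ 2 + dx a b f q ^ 2 + dy a b f q ^ 2 + dy a b (dx a b f) q ^ 2) ∂(vol a b) := by
  have hX : 0 < Real.pi / a := by positivity
  have hY : 0 < Real.pi / b := by positivity
  have c1 : ContDiffOn ℝ 1 f (cdom a b) := hf.of_le (by norm_num)
  have hfx := contDiffOn_dx ha hb hf (m := 1) (by norm_num)
  have k0 := c1.continuousOn
  have k1 := continuousOn_dx ha hb c1
  have k2 := continuousOn_dy ha hb c1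
  have k3 := continuousOn_dy ha hb hfx
  set G : ℝ × ℝ → ℝ := fun q =>
    f q ^ 2 + dx a b f q ^ 2 + dy a b f q ^ 2 + dy a b (dx a b f) q ^ 2 with hG
  have hGc : ContinuousOn G (cdom a b) := by fun_prop
  obtain ⟨x, y⟩ := p
  have hy : y ∈ Icc 0 (Real.pi / b) := hp.2
  have hfst : ∀ {F : ℝ × ℝ → ℝ}, ContinuousOn F (cdom a b) →
      ContinuousOn (fun s => F (s, y)) (Icc 0 (Real.pi / a)) := fun hF =>
    hF.comp (by fun_prop) fun s hs => ⟨hs, hy⟩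
  have hsnd : ∀ {F : ℝ × ℝ → ℝ}, ContinuousOn F (cdom a b) → ∀ s ∈ Icc 0 (Real.pi / a),
      ContinuousOn (fun r => F (s, r)) (Icc 0 (Real.pi / b)) := fun hF s hs =>
    hF.comp (by fun_prop) fun r hr => ⟨hs, hr⟩
  -- The one-dimensional inequality is used along x, then along y for both f and ∂ₓf. Thus the mixed
  -- derivative is the only second derivative that enters.
  have e1 := sq_le_integral_Icc hX (h := fun s => f (s, y)) (h' := fun s => dx a b f (s, y))
    (fun s hs => hasDerivWithinAt_fst (c1.differentiableOn one_ne_zero) ⟨hs, hy⟩) (hfst k1) hp.1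
  have hGi : IntervalIntegrable (fun s => ∫ r in (0:ℝ)..Real.pi / b, G (s, r)) volume 0
      (Real.pi / a) := by
    have hi : Integrable G (vol a b) := integrable_vol hGc
    rw [vol_eq_restrict_cdom, cdom, Measure.volume_eq_prod, ← Measure.prod_restrict] at hi
    have := hi.integral_prod_left
    rw [intervalIntegrable_iff_integrableOn_Icc_of_le hX.le]
    refine this.congr (ae_of_all _ fun s => ?_)
    simp only
    rw [integral_Icc_eq_integral_Ioc, intervalIntegral.integral_of_le hY.le]
  have e2 : ∫ s in (0:ℝ)..Real.pi / a, (f (s, y) ^ 2 + dx a b f (s, y) ^ 2) ≤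
      ∫ s in (0:ℝ)..Real.pi / a, (1 / (Real.pi / b) + 1) * ∫ r in (0:ℝ)..Real.pi / b, G (s, r) := by
    refine intervalIntegral.integral_mono_on hX.le ?_ (hGi.const_mul _) fun s hs => ?_
    · refine ContinuousOn.intervalIntegrable ?_
      rw [uIcc_of_le hX.le]
      exact ((hfst k0).pow 2).add ((hfst k1).pow 2)
    · have e3 := sq_le_integral_Icc hY (h := fun r => f (s, r)) (h' := fun r => dy a b f (s, r))
        (fun r hr => hasDerivWithinAt_snd (c1.differentiableOn one_ne_zero) ⟨hs, hr⟩)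
        (hsnd k2 s hs) hy
      have e4 := sq_le_integral_Icc hY (h := fun r => dx a b f (s, r))
        (h' := fun r => dy a b (dx a b f) (s, r))
        (fun r hr => hasDerivWithinAt_snd (hfx.differentiableOn one_ne_zero) ⟨hs, hr⟩)
        (hsnd k3 s hs) hy
      refine (add_le_add e3 e4).trans_eq ?_
      rw [← mul_add, ← intervalIntegral.integral_add]
      · congr 2; funext r; simp only [hG]; ring
      all_goals
        refine ContinuousOn.intervalIntegrable ?_
        rw [uIcc_of_le hY.le]
      · exact ((hsnd k0 s hs).pow 2).add ((hsnd k2 s hs).pow 2)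
      · exact ((hsnd k1 s hs).pow 2).add ((hsnd k3 s hs).pow 2)
  rw [intervalIntegral.integral_const_mul, ← integral_vol_eq_iterated ha hb hGc] at e2
  calc f (x, y) ^ 2 ≤ _ := e1
    _ ≤ _ := by
      rw [mul_assoc]
      exact mul_le_mul_of_nonneg_left e2 (by positivity)

end Static

/-! ### Estimates for the velocity of a vorticity -/

section Velocity

variable {a b : ℝ} {w : ℝ × ℝ → ℝ} {u : ℝ × ℝ → ℝ × ℝ}

lemma IsVelocity.periodic_fst (h : IsVelocity a b w u) :
    ∀ y ∈ Icc 0 (Real.pi / b), (u (0, y)).1 = (u (Real.pi / a, y)).1 :=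
  fun y hy => by rw [h.periodic y hy]

lemma IsVelocity.periodic_snd (h : IsVelocity a b w u) :
    ∀ y ∈ Icc 0 (Real.pi / b), (u (0, y)).2 = (u (Real.pi / a, y)).2 :=
  fun y hy => by rw [h.periodic y hy]

lemma IsVelocity.exists_stream (ha : 0 < a) (hb : 0 < b) (h : IsVelocity a b w u)
    (hu : ContDiffOn ℝ 1 u (cdom a b)) :
    ∃ ψ, IsStream a b ψ (fun z => (u z).1) (fun z => (u z).2) :=
  VortexStrip.exists_stream ha hb hu.fst hu.snd h.div_free h.bottom h.top h.periodic_fst h.mean_zero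

/-- With the stream function, ∫|u|² = -∫ψw ≤ (b²/2)∫ψ² + (1/(2b²))∫w². Wirtinger's inequality for ψ
bounds the first term by ½∫|u|², which is absorbed on the left. -/
lemma IsVelocity.kinetic_le (ha : 0 < a) (hb : 0 < b) (h : IsVelocity a b w u)
    (hu : ContDiffOn ℝ 1 u (cdom a b)) (hw : ContinuousOn w (cdom a b)) :
    b ^ 2 * ∫ p, ((u p).1 ^ 2 + (u p).2 ^ 2) ∂(vol a b) ≤ ∫ p, w p ^ 2 ∂(vol a b) := by
  obtain ⟨ψ, hψ⟩ := h.exists_stream ha hb hu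
  have c1 : ContinuousOn (fun z => (u z).1) (cdom a b) := hu.fst.continuousOn
  have c2 : ContinuousOn (fun z => (u z).2) (cdom a b) := hu.snd.continuousOn
  have c0 := hψ.contDiffOn.continuousOn
  have hz := hψ.zeroMean_inner ha hb hu.fst hu.snd h.periodic_snd
  have e1 : ∫ p, ((u p).1 ^ 2 + (u p).2 ^ 2) ∂(vol a b) = ∫ p, - (ψ p * w p) ∂(vol a b) :=
    (hz.congr (g := fun p => ((u p).1 ^ 2 + (u p).2 ^ 2) - (-(ψ p * w p)))
      fun p hp => by simp only; rw [h.curl p hp]; ring).integral_eq (by fun_prop) (by fun_prop)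
  have e2 := wirtinger ha hb (hψ.contDiffOn.of_le (by norm_num)) hψ.bottom hψ.top
  have e3 : ∫ p, dy a b ψ p ^ 2 ∂(vol a b) ≤ ∫ p, ((u p).1 ^ 2 + (u p).2 ^ 2) ∂(vol a b) := by
    rw [integral_congr_dom (g := fun p => (u p).1 ^ 2) fun p hp => by
      simp only; rw [hψ.dy_eq p (dom_subset_cdom hp), neg_sq]]
    exact integral_mono_dom (by fun_prop) (by fun_prop) fun p _ => by
      nlinarith [sq_nonneg (u p).2]
  have e4 : ∫ p, - (ψ p * w p) ∂(vol a b)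
      ≤ ∫ p, (b ^ 2 / 2 * ψ p ^ 2 + 1 / (2 * b ^ 2) * w p ^ 2) ∂(vol a b) := by
    refine integral_mono_dom (by fun_prop) (by fun_prop) fun p _ => ?_
    have : 0 ≤ (b * ψ p + 1 / b * w p) ^ 2 := sq_nonneg _
    have h2 : (b * ψ p + 1 / b * w p) ^ 2
        = 2 * (b ^ 2 / 2 * ψ p ^ 2 + 1 / (2 * b ^ 2) * w p ^ 2 + ψ p * w p) := by
      field_simp
      ring
    linarith
  rw [integral_add (integrable_vol (by fun_prop)) (integrable_vol (by fun_prop)),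
    integral_const_mul, integral_const_mul] at e4
  have hb2 : 0 < b ^ 2 := by positivity
  have e5 : ∫ p, ((u p).1 ^ 2 + (u p).2 ^ 2) ∂(vol a b) ≤
      1 / b ^ 2 * ∫ p, w p ^ 2 ∂(vol a b) := by
    have : 1 / (2 * b ^ 2) * ∫ p, w p ^ 2 ∂(vol a b)
        = 1 / b ^ 2 * (∫ p, w p ^ 2 ∂(vol a b)) / 2 := by field_simp
    linarith
  calc _ ≤ b ^ 2 * (1 / b ^ 2 * ∫ p, w p ^ 2 ∂(vol a b)) := mul_le_mul_of_nonneg_left e5 hb2.le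
    _ = _ := by field_simp

lemma IsVelocity.integral_mul_eq (ha : 0 < a) (hb : 0 < b) (h : IsVelocity a b w u)
    (hu : ContDiffOn ℝ 1 u (cdom a b)) (hw : ContinuousOn w (cdom a b)) {φ : ℝ × ℝ → ℝ}
    (hφ : ContDiffOn ℝ 1 φ (cdom a b))
    (hbot : ∀ x ∈ Icc 0 (Real.pi / a), φ (x, 0) = 0)
    (htop : ∀ x ∈ Icc 0 (Real.pi / a), φ (x, Real.pi / b) = 0)
    (hper : ∀ y ∈ Icc 0 (Real.pi / b), φ (0, y) = φ (Real.pi / a, y)) :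
    ∫ p, w p * φ p ∂(vol a b)
      = ∫ p, ((u p).1 * dy a b φ p - (u p).2 * dx a b φ p) ∂(vol a b) := by
  have c1 : ContinuousOn (fun z => (u z).1) (cdom a b) := hu.fst.continuousOn
  have c2 : ContinuousOn (fun z => (u z).2) (cdom a b) := hu.snd.continuousOn
  have c0 := hφ.continuousOn
  have c3 := continuousOn_dx ha hb hφ
  have c4 := continuousOn_dy ha hb hφ
  have d0 := hφ.differentiableOn one_ne_zero
  have d1 : DifferentiableOn ℝ (fun z => (u z).1) (cdom a b) := hu.fst.differentiableOn one_ne_zero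
  have d2 : DifferentiableOn ℝ (fun z => (u z).2) (cdom a b) := hu.snd.differentiableOn one_ne_zero
  refine ((zeroMean_div ha hb (f := fun p => φ p * (u p).2) (g := fun p => -(φ p * (u p).1))
    (hφ.mul hu.snd) (hφ.mul hu.fst).neg (fun y hy => ?_) (fun x hx => ?_)).congr
    (g := fun p => w p * φ p - ((u p).1 * dy a b φ p - (u p).2 * dx a b φ p))
    fun p hp => ?_).integral_eq (by fun_prop) (by fun_prop)
  · simp only [hper y hy, h.periodic y hy]
  · simp only [hbot x hx, htop x hx, zero_mul]
  · have hp' := dom_subset_cdom hp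
    simp only
    rw [dy_neg ha hb hp' (d0.fun_mul d1), dx_mul ha hb d0 d2 hp', dy_mul ha hb d0 d1 hp']
    linear_combination φ p * h.curl p hp

lemma IsVelocity.isWeakVelocity (ha : 0 < a) (hb : 0 < b) (h : IsVelocity a b w u)
    (hu : ContDiffOn ℝ 1 u (cdom a b)) (hw : ContinuousOn w (cdom a b)) :
    IsWeakVelocity a b w u where
  memLp_fst := memLp_vol hu.fst.continuousOn
  memLp_snd := memLp_vol hu.snd.continuousOn
  div_free φ hφ hper := by
    have hφ1 : ContDiffOn ℝ 1 φ (cdom a b) := (hφ.of_le (by exact_mod_cast le_top)).contDiffOn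
    refine ((zeroMean_transport ha hb hu.fst hu.snd hφ1 h.div_free h.bottom h.top h.periodic_fst
      fun y _ => ?_).congr fun p hp => ?_).2
    · rw [← hper 0 y, zero_add]
    · simp only [dx_eq_fderiv hp, dy_eq_fderiv hp]
  curl φ hφ hper hwall := by
    have hφ1 : ContDiffOn ℝ 1 φ (cdom a b) := (hφ.of_le (by exact_mod_cast le_top)).contDiffOn
    rw [h.integral_mul_eq ha hb hu hw hφ1 (fun x _ => (hwall x).1) (fun x _ => (hwall x).2)
      fun y _ => by rw [← hper 0 y, zero_add]]
    refine integral_congr_dom fun p hp => ?_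
    simp only [dx_eq_fderiv hp, dy_eq_fderiv hp]
  mean_zero := h.mean_zero

/-- The energy balance for the difference `(d, v)` of two flows, one of which is `(w, u)`. -/
lemma IsVelocity.integral_inner_eq (ha : 0 < a) (hb : 0 < b) {ν : ℝ}
    {d w' z₁ z₂ : ℝ × ℝ → ℝ} {v : ℝ × ℝ → ℝ × ℝ}
    (hv : IsVelocity a b d v) (hvc : ContDiffOn ℝ 1 v (cdom a b))
    (hd : ContDiffOn ℝ 2 d (cdom a b)) (hdbc : MixedBC a b d)
    (hu : IsVelocity a b w u) (huc : ContDiffOn ℝ 1 u (cdom a b))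
    (hw' : ContDiffOn ℝ 1 w' (cdom a b))
    (hwper : ∀ y ∈ Icc 0 (Real.pi / b), w' (0, y) = w' (Real.pi / a, y))
    (hz₁ : ContDiffOn ℝ 1 z₁ (cdom a b)) (hz₂ : ContDiffOn ℝ 1 z₂ (cdom a b))
    (hzper : ∀ y ∈ Icc 0 (Real.pi / b), z₂ (0, y) = z₂ (Real.pi / a, y))
    (hz : ∀ p ∈ dom a b, dx a b z₂ p - dy a b z₁ p = ν * lap a b d p
      - ((u p).1 * dx a b d p + (u p).2 * dy a b d p)
      - ((v p).1 * dx a b w' p + (v p).2 * dy a b w' p)) :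
    ∫ p, ((v p).1 * z₁ p + (v p).2 * z₂ p) ∂(vol a b)
      = ∫ p, (-ν * d p ^ 2 - d p * ((u p).1 * (v p).2 - (u p).2 * (v p).1)) ∂(vol a b) := by
  obtain ⟨ψ, hψ⟩ := hv.exists_stream ha hb hvc
  have hd1 : ContDiffOn ℝ 1 d (cdom a b) := hd.of_le (by norm_num)
  have hψ1 : ContDiffOn ℝ 1 ψ (cdom a b) := hψ.contDiffOn.of_le (by norm_num)
  have c1 : ContinuousOn (fun z => (u z).1) (cdom a b) := huc.fst.continuousOn
  have c2 : ContinuousOn (fun z => (u z).2) (cdom a b) := huc.snd.continuousOn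
  have c3 : ContinuousOn (fun z => (v z).1) (cdom a b) := hvc.fst.continuousOn
  have c4 : ContinuousOn (fun z => (v z).2) (cdom a b) := hvc.snd.continuousOn
  have c5 := hz₁.continuousOn
  have c6 := hz₂.continuousOn
  have c7 := hd1.continuousOn
  have dd := hd1.differentiableOn one_ne_zero
  have dψ := hψ1.differentiableOn one_ne_zero
  have dw := hw'.differentiableOn one_ne_zero
  have hψper' : ∀ y ∈ Icc 0 (Real.pi / b), dx a b ψ (0, y) = dx a b ψ (Real.pi / a, y) := by
    intro y hy
    rw [hψ.dx_eq _ ⟨left_mem ha, hy⟩, hψ.dx_eq _ ⟨right_mem ha, hy⟩, hv.periodic y hy]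
  -- The stream function ψ of `v` is the test function. Two Green identities and Δψ = d turn ν∫ψΔd
  -- into ν∫d². In the transport terms u · ∇ψ = u₁v₂ - u₂v₁ survives, while v · ∇ψ = 0 removes `w'`
  -- altogether.
  have i1 := hψ.zeroMean_inner ha hb hz₁ hz₂ hzper
  have i2 := zeroMean_green ha hb hψ1 hd hψ.bottom hψ.top hψ.periodic hdbc.periodic_dx
  have i3 := zeroMean_green ha hb hd1 hψ.contDiffOn hdbc.bottom hdbc.top hdbc.periodic hψper'
  have i4 := zeroMean_transport ha hb huc.fst huc.snd (hψ1.mul hd1) hu.div_free hu.bottom hu.top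
    hu.periodic_fst (fun y hy => by simp only [hψ.periodic y hy, hdbc.periodic y hy])
  have i5 := zeroMean_transport ha hb hvc.fst hvc.snd (hψ1.mul hw') hv.div_free hv.bottom hv.top
    hv.periodic_fst (fun y hy => by simp only [hψ.periodic y hy, hwper y hy])
  have hlap : ∀ p ∈ dom a b, lap a b ψ p = d p := by
    intro p hp
    have hp' := dom_subset_cdom hp
    rw [lap, dx_congr (fun q hq => hψ.dx_eq q hq) hp', dy_congr (fun q hq => hψ.dy_eq q hq) hp',
      dy_neg ha hb hp' (hvc.fst.differentiableOn one_ne_zero), ← hv.curl p hp]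
    ring
  refine (((i1.sub ((i2.sub i3).const_mul ν)).add (i4.add i5)).congr
    fun p hp => ?_).integral_eq (by fun_prop) (by fun_prop)
  have hp' := dom_subset_cdom hp
  rw [hz p hp, hlap p hp, dx_mul ha hb dψ dd hp', dy_mul ha hb dψ dd hp', dx_mul ha hb dψ dw hp',
    dy_mul ha hb dψ dw hp', hψ.dx_eq p hp', hψ.dy_eq p hp']
  ring

set_option maxHeartbeats 800000 in
-- The Sobolev inequality needs u, ∇u and ∂_y∂ₓu in L². The div-curl identity bounds ∇u by w.
-- Differentiation in x keeps the field tangent to the walls and periodic, so the same identity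
-- bounds ∇∂ₓu by ∂ₓw; no wall condition for ∂_y u is needed. The weights 1/b⁴ and 1/b² reduce the
-- norms of u and w to that of ∇w.
lemma IsVelocity.sq_le (ha : 0 < a) (hb : 0 < b) : ∃ C : ℝ, 0 < C ∧
    ∀ (w : ℝ × ℝ → ℝ) (u : ℝ × ℝ → ℝ × ℝ), IsVelocity a b w u → ContDiffOn ℝ 3 u (cdom a b) →
      ContDiffOn ℝ 1 w (cdom a b) → MixedBC a b w → ∀ p ∈ cdom a b,
      (u p).1 ^ 2 + (u p).2 ^ 2 ≤ C * ∫ q, (dx a b w q ^ 2 + dy a b w q ^ 2) ∂(vol a b) := by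
  have hA : 0 < (1 / (Real.pi / a) + 1) * (1 / (Real.pi / b) + 1) := by positivity
  set A := (1 / (Real.pi / a) + 1) * (1 / (Real.pi / b) + 1)
  refine ⟨A * (1 / b ^ 4 + 1 / b ^ 2 + 1), by positivity, ?_⟩
  intro w u h hu hw hbc p hp
  set u₁ : ℝ × ℝ → ℝ := fun z => (u z).1 with hu₁
  set u₂ : ℝ × ℝ → ℝ := fun z => (u z).2 with hu₂
  have h₁ : ContDiffOn ℝ 3 u₁ (cdom a b) := hu.fst
  have h₂ : ContDiffOn ℝ 3 u₂ (cdom a b) := hu.snd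
  have h₁2 : ContDiffOn ℝ 2 u₁ (cdom a b) := h₁.of_le (by norm_num)
  have h₂2 : ContDiffOn ℝ 2 u₂ (cdom a b) := h₂.of_le (by norm_num)
  have h₁1 : ContDiffOn ℝ 1 u₁ (cdom a b) := h₁.of_le (by norm_num)
  have h₂1 : ContDiffOn ℝ 1 u₂ (cdom a b) := h₂.of_le (by norm_num)
  have h₁x := contDiffOn_dx ha hb h₁ (m := 2) (by norm_num)
  have h₂x := contDiffOn_dx ha hb h₂ (m := 2) (by norm_num)
  have h₁y := contDiffOn_dy ha hb h₁ (m := 2) (by norm_num)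
  have h₂y := contDiffOn_dy ha hb h₂ (m := 2) (by norm_num)
  have two : (2 : WithTop ℕ∞) ≠ 0 := by norm_num
  have hdv : ∀ q ∈ dom a b, dx a b u₁ q + dy a b u₂ q = 0 := h.div_free
  have hcv : ∀ q ∈ dom a b, dx a b u₂ q - dy a b u₁ q = w q := h.curl
  -- The two equations are extended to the boundary: there they express ∂ₓu through ∂_y u and w,
  -- whose periodicity is known, so that ∂ₓu is periodic too.
  have hdiv : EqOn (dx a b u₁) (fun p => - dy a b u₂ p) (cdom a b) :=
    eqOn_cdom_of_eqOn_dom ha hb h₁x.continuousOn h₂y.continuousOn.neg fun p hp => by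
      linarith [hdv p hp]
  have hcurl : EqOn (dx a b u₂) (fun p => w p + dy a b u₁ p) (cdom a b) :=
    eqOn_cdom_of_eqOn_dom ha hb h₂x.continuousOn (hw.continuousOn.add h₁y.continuousOn)
      fun p hp => by
        linarith [hcv p hp]
  have per₁ := dy_periodic ha hb (h₁2.differentiableOn two) h.periodic_fst
  have per₂ := dy_periodic ha hb (h₂2.differentiableOn two) h.periodic_snd
  have k0 := hw.continuousOn
  have kx := continuousOn_dx ha hb hw
  have ky := continuousOn_dy ha hb hw
  have k1 := h₁1.continuousOn
  have k2 := h₂1.continuousOn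
  have k3 := h₁x.continuousOn
  have k4 := h₂x.continuousOn
  have k5 := h₁y.continuousOn
  have k6 := h₂y.continuousOn
  have k7 := continuousOn_dx ha hb (h₁x.of_le (by norm_num) : ContDiffOn ℝ 1 _ _)
  have k8 := continuousOn_dy ha hb (h₁x.of_le (by norm_num) : ContDiffOn ℝ 1 _ _)
  have k9 := continuousOn_dx ha hb (h₂x.of_le (by norm_num) : ContDiffOn ℝ 1 _ _)
  have k10 := continuousOn_dy ha hb (h₂x.of_le (by norm_num) : ContDiffOn ℝ 1 _ _)
  have g1 : ∫ q, (dx a b u₁ q ^ 2 + dy a b u₁ q ^ 2 + dx a b u₂ q ^ 2 + dy a b u₂ q ^ 2) ∂(vol a b)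
      = ∫ q, w q ^ 2 ∂(vol a b) :=
    ((zeroMean_gradient ha hb h₁2 h₂2 h.bottom h.top h.periodic_fst h.periodic_snd).congr
      fun q hq => by
        rw [hdv q hq, hcv q hq]
        simp).integral_eq (by fun_prop) (by fun_prop)
  have g2 : ∫ q, (dx a b (dx a b u₁) q ^ 2 + dy a b (dx a b u₁) q ^ 2 + dx a b (dx a b u₂) q ^ 2
      + dy a b (dx a b u₂) q ^ 2) ∂(vol a b) = ∫ q, dx a b w q ^ 2 ∂(vol a b) := by
    refine ((zeroMean_gradient ha hb h₁x h₂x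
      (dx_eq_zero_of_wall ha (h₂2.differentiableOn two) (left_mem hb) h.bottom)
      (dx_eq_zero_of_wall ha (h₂2.differentiableOn two) (right_mem hb) h.top)
      (fun y hy => ?_) (fun y hy => ?_)).congr fun q hq => ?_).integral_eq
      (by fun_prop) (by fun_prop)
    · rw [hdiv ⟨left_mem ha, hy⟩, hdiv ⟨right_mem ha, hy⟩]
      simp only [per₂ y hy]
    · rw [hcurl ⟨left_mem ha, hy⟩, hcurl ⟨right_mem ha, hy⟩]
      simp only [per₁ y hy, hbc.periodic y hy]
    · have hq' := dom_subset_cdom hq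
      have e1 : dx a b (dx a b u₁) q + dy a b (dx a b u₂) q = 0 := by
        rw [dx_congr hdiv hq', dx_neg ha hb hq' (h₂y.differentiableOn two),
          dx_dy_comm ha hb h₂2 hq']
        ring
      have e2 : dx a b (dx a b u₂) q - dy a b (dx a b u₁) q = dx a b w q := by
        rw [dx_congr hcurl hq', dx_add ha hb (hw.differentiableOn one_ne_zero)
          (h₁y.differentiableOn two) hq', dx_dy_comm ha hb h₁2 hq']
        ring
      simp only [e1, e2]
      ring
  have s1 := sq_le_integral_vol ha hb h₁2 hp
  have s2 := sq_le_integral_vol ha hb h₂2 hp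
  have t1 := h.kinetic_le ha hb (hu.of_le (by norm_num)) k0
  have t2 := wirtinger ha hb hw hbc.bottom hbc.top
  have t3 : ∫ q, (dx a b w q ^ 2 + dy a b w q ^ 2) ∂(vol a b)
      = ∫ q, dx a b w q ^ 2 ∂(vol a b) + ∫ q, dy a b w q ^ 2 ∂(vol a b) :=
    integral_add (integrable_vol (by fun_prop)) (integrable_vol (by fun_prop))
  have n1 : 0 ≤ ∫ q, dx a b w q ^ 2 ∂(vol a b) := integral_nonneg fun _ => sq_nonneg _
  have n2 : 0 ≤ ∫ q, dy a b w q ^ 2 ∂(vol a b) := integral_nonneg fun _ => sq_nonneg _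
  have r : ∫ q, (u₁ q ^ 2 + dx a b u₁ q ^ 2 + dy a b u₁ q ^ 2 + dy a b (dx a b u₁) q ^ 2) ∂(vol a b)
      + ∫ q, (u₂ q ^ 2 + dx a b u₂ q ^ 2 + dy a b u₂ q ^ 2 + dy a b (dx a b u₂) q ^ 2) ∂(vol a b)
      ≤ ∫ q, (u₁ q ^ 2 + u₂ q ^ 2) ∂(vol a b) + ∫ q, w q ^ 2 ∂(vol a b)
        + ∫ q, dx a b w q ^ 2 ∂(vol a b) := by
    rw [← g1, ← g2, ← integral_add (integrable_vol (by fun_prop)) (integrable_vol (by fun_prop)),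
      ← integral_add (integrable_vol (by fun_prop)) (integrable_vol (by fun_prop)),
      ← integral_add (integrable_vol (by fun_prop)) (integrable_vol (by fun_prop))]
    refine integral_mono_dom (by fun_prop) (by fun_prop) fun q _ => ?_
    linarith [sq_nonneg (dx a b (dx a b u₁) q), sq_nonneg (dx a b (dx a b u₂) q)]
  set I := ∫ q, dx a b w q ^ 2 ∂(vol a b)
  set J := ∫ q, dy a b w q ^ 2 ∂(vol a b)
  set N := ∫ q, w q ^ 2 ∂(vol a b)
  have b2 : 0 < b ^ 2 := by positivity
  have q1 : N ≤ 1 / b ^ 2 * (I + J) := by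
    rw [div_mul_eq_mul_div, one_mul, le_div_iff₀ b2]; linarith
  have q2 : ∫ q, (u₁ q ^ 2 + u₂ q ^ 2) ∂(vol a b) ≤ 1 / b ^ 4 * (I + J) := by
    have : ∫ q, (u₁ q ^ 2 + u₂ q ^ 2) ∂(vol a b) ≤ N / b ^ 2 := by
      rw [le_div_iff₀ b2, mul_comm]; exact t1
    refine this.trans ?_
    rw [div_le_iff₀ b2]
    refine q1.trans_eq ?_
    field_simp
  rw [t3]
  calc u₁ p ^ 2 + u₂ p ^ 2 ≤ A * (∫ q, (u₁ q ^ 2 + u₂ q ^ 2) ∂(vol a b) + N + I) := by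
        refine (add_le_add s1 s2).trans ?_
        rw [← mul_add]
        exact mul_le_mul_of_nonneg_left r hA.le
    _ ≤ A * (1 / b ^ 4 * (I + J) + 1 / b ^ 2 * (I + J) + (I + J)) := by
        refine mul_le_mul_of_nonneg_left ?_ hA.le
        linarith
    _ = _ := by ring

end Velocity

/-! ### Totality of the trigonometric modes -/

section Totality

variable {a b : ℝ}

/-- The modes `cos (2 a j x + θ) cos (b k y)`. -/
noncomputable def cosMode (a b : ℝ) (j k : ℤ) (θ : ℝ) (p : ℝ × ℝ) : ℝ :=
  Real.cos (2 * a * j * p.1 + θ) * Real.cos (b * k * p.2)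

/-- The modes `cos (2 a j x + θ) sin (b k y)`. -/
noncomputable def sinMode (a b : ℝ) (j k : ℤ) (θ : ℝ) (p : ℝ × ℝ) : ℝ :=
  Real.cos (2 * a * j * p.1 + θ) * Real.sin (b * k * p.2)

lemma contDiff_cosMode {n : WithTop ℕ∞} (j k : ℤ) (θ : ℝ) : ContDiff ℝ n (cosMode a b j k θ) := by
  unfold cosMode; fun_prop

lemma contDiff_sinMode {n : WithTop ℕ∞} (j k : ℤ) (θ : ℝ) : ContDiff ℝ n (sinMode a b j k θ) := by
  unfold sinMode; fun_prop

lemma abs_cosMode_le (j k : ℤ) (θ : ℝ) (p : ℝ × ℝ) : |cosMode a b j k θ p| ≤ 1 := by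
  rw [cosMode, abs_mul]
  exact mul_le_one₀ (Real.abs_cos_le_one _) (abs_nonneg _) (Real.abs_cos_le_one _)

lemma abs_sinMode_le (j k : ℤ) (θ : ℝ) (p : ℝ × ℝ) : |sinMode a b j k θ p| ≤ 1 := by
  rw [sinMode, abs_mul]
  exact mul_le_one₀ (Real.abs_cos_le_one _) (abs_nonneg _) (Real.abs_sin_le_one _)

lemma cosMode_mul_cosMode (j k j' k' : ℤ) (θ θ' : ℝ) (p : ℝ × ℝ) :
    cosMode a b j k θ p * cosMode a b j' k' θ' p = 1 / 4 *
      (cosMode a b (j + j') (k + k') (θ + θ') p + cosMode a b (j + j') (k - k') (θ + θ') p +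
      (cosMode a b (j - j') (k + k') (θ - θ') p + cosMode a b (j - j') (k - k') (θ - θ') p)) := by
  have h : ∀ s t : ℝ, Real.cos s * Real.cos t = 1 / 2 * (Real.cos (s + t) + Real.cos (s - t)) := by
    intro s t; rw [Real.cos_add, Real.cos_sub]; ring
  have e1 := h (2 * a * j * p.1 + θ) (2 * a * j' * p.1 + θ')
  have e2 := h (b * k * p.2) (b * k' * p.2)
  rw [show 2 * a * j * p.1 + θ + (2 * a * j' * p.1 + θ')
      = 2 * a * (j + j' : ℤ) * p.1 + (θ + θ') by push_cast; ring,
    show 2 * a * j * p.1 + θ - (2 * a * j' * p.1 + θ')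
      = 2 * a * (j - j' : ℤ) * p.1 + (θ - θ') by push_cast; ring] at e1
  rw [show b * k * p.2 + b * k' * p.2 = b * (k + k' : ℤ) * p.2 by push_cast; ring,
    show b * k * p.2 - b * k' * p.2 = b * (k - k' : ℤ) * p.2 by push_cast; ring] at e2
  simp only [cosMode]
  rw [mul_mul_mul_comm, e1, e2]
  ring

/-- The cosine modes as bounded continuous functions on the open rectangle. -/
noncomputable def cosModeBCF (a b : ℝ) (m : ℤ × ℤ × ℝ) : BoundedContinuousFunction (dom a b) ℝ :=
  BoundedContinuousFunction.ofNormedAddCommGroup (fun p => cosMode a b m.1 m.2.1 m.2.2 p)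
    ((contDiff_cosMode (n := 0) _ _ _).continuous.comp continuous_subtype_val) 1
    fun _ => abs_cosMode_le _ _ _ _

/-- The algebra spanned by the cosine modes. -/
noncomputable def cosAlgebra (a b : ℝ) : StarSubalgebra ℝ (BoundedContinuousFunction (dom a b) ℝ) :=
  { Submodule.toSubalgebra (Submodule.span ℝ (range (cosModeBCF a b)))
      (Submodule.subset_span ⟨(0, 0, 0), by ext p; simp [cosModeBCF, cosMode]⟩)
      (by
        intro f g hf hg
        induction hf, hg using Submodule.span_induction₂ with
        | mem_mem x y hx hy =>
          obtain ⟨⟨j, k, θ⟩, rfl⟩ := hx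
          obtain ⟨⟨j', k', θ'⟩, rfl⟩ := hy
          have : cosModeBCF a b (j, k, θ) * cosModeBCF a b (j', k', θ') = (1 / 4 : ℝ) •
              (cosModeBCF a b (j + j', k + k', θ + θ') + cosModeBCF a b (j + j', k - k', θ + θ') +
              (cosModeBCF a b (j - j', k + k', θ - θ')
                + cosModeBCF a b (j - j', k - k', θ - θ'))) := by
            ext p; exact cosMode_mul_cosMode j k j' k' θ θ' p
          rw [this]
          refine Submodule.smul_mem _ _ (Submodule.add_mem _ (Submodule.add_mem _ ?_ ?_)
            (Submodule.add_mem _ ?_ ?_)) <;> exact Submodule.subset_span ⟨_, rfl⟩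
        | zero_left y hy => simp
        | zero_right x hx => simp
        | add_left x y z _ _ _ h1 h2 => rw [add_mul]; exact Submodule.add_mem _ h1 h2
        | add_right x y z _ _ _ h1 h2 => rw [mul_add]; exact Submodule.add_mem _ h1 h2
        | smul_left r x y _ _ h => rw [smul_mul_assoc]; exact Submodule.smul_mem _ _ h
        | smul_right r x y _ _ h => rw [mul_smul_comm]; exact Submodule.smul_mem _ _ h) with
    star_mem' := fun {f} hf => by
      have : star f = f := by ext p; simp
      rwa [this] }

/-- For different abscissas, the mode cos(2a(· - x)) takes the value 1 at x and nowhere else in the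
open period. For equal abscissas, cos(by) is injective on [0, π/b]. -/
lemma cosAlgebra_separatesPoints (ha : 0 < a) (hb : 0 < b) :
    ((cosAlgebra a b).map
      (BoundedContinuousFunction.toContinuousMapStarₐ ℝ)).SeparatesPoints := by
  have hmem : ∀ m, (cosModeBCF a b m : dom a b → ℝ) ∈
      (fun f : C(dom a b, ℝ) => (f : dom a b → ℝ)) '' ((cosAlgebra a b).map
      (BoundedContinuousFunction.toContinuousMapStarₐ ℝ) : Set C(dom a b, ℝ)) := fun m =>
    ⟨_, ⟨cosModeBCF a b m, Submodule.subset_span ⟨m, rfl⟩, rfl⟩, rfl⟩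
  rintro ⟨⟨x, y⟩, hp⟩ ⟨⟨x', y'⟩, hq⟩ hne
  have hx : x ∈ Ioo 0 (Real.pi / a) := hp.1
  have hy : y ∈ Ioo 0 (Real.pi / b) := hp.2
  have hx' : x' ∈ Ioo 0 (Real.pi / a) := hq.1
  have hy' : y' ∈ Ioo 0 (Real.pi / b) := hq.2
  by_cases hxx : x = x'
  · have hyy : y ≠ y' := by rintro rfl; exact hne (by simp [hxx])
    refine ⟨_, hmem (0, 1, 0), fun h => hyy ?_⟩
    have h : Real.cos (b * y) = Real.cos (b * y') := by
      simpa [cosModeBCF, cosMode] using h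
    have e := Real.injOn_cos (x₁ := b * y) (x₂ := b * y') ?_ ?_ h
    · exact mul_left_cancel₀ hb.ne' e
    · exact ⟨mul_nonneg hb.le hy.1.le, by
        rw [mul_comm]; exact ((lt_div_iff₀ hb).1 hy.2).le⟩
    · exact ⟨mul_nonneg hb.le hy'.1.le, by
        rw [mul_comm]; exact ((lt_div_iff₀ hb).1 hy'.2).le⟩
  · refine ⟨_, hmem (1, 0, -(2 * a * x)), fun h => hxx ?_⟩
    have h : 1 = Real.cos (2 * a * x' + -(2 * a * x)) := by
      simpa [cosModeBCF, cosMode] using h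
    have l1 := (lt_div_iff₀ ha).1 hx.2
    have l2 := (lt_div_iff₀ ha).1 hx'.2
    have l3 := mul_pos ha hx.1
    have l4 := mul_pos ha hx'.1
    have := (Real.cos_eq_one_iff_of_lt_of_lt (x := 2 * a * x' + -(2 * a * x)) (by nlinarith)
      (by nlinarith)).1 h.symm
    have h2 : 2 * a * (x' - x) = 0 := by linarith
    have h3 : x' - x = 0 := by
      rcases mul_eq_zero.1 h2 with h | h
      · linarith
      · exact h
    linarith

/-- The positive and negative parts of `f` are densities of two finite measures that agree on the
algebra of cosine modes. A point-separating algebra of bounded continuous functions determines a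
finite measure on a Polish space, so the measures, hence the two parts, coincide; since at most one
part is nonzero at a point, both vanish. -/
lemma ae_eq_zero_of_cosMode (ha : 0 < a) (hb : 0 < b) {f : ℝ × ℝ → ℝ}
    (hf : Integrable f (vol a b))
    (h : ∀ (j k : ℤ) (θ : ℝ), ∫ p, f p * cosMode a b j k θ p ∂(vol a b) = 0) :
    f =ᵐ[vol a b] 0 := by
  have hms : MeasurableSet (dom a b) := isOpen_dom.measurableSet
  have hemb : MeasurableEmbedding (Subtype.val : dom a b → ℝ × ℝ) := .subtype_coe hms
  set μ : Measure (dom a b) := Measure.comap Subtype.val volume with hμ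
  have hmap : μ.map Subtype.val = vol a b := by
    rw [hμ, hemb.map_comap, Subtype.range_coe]; rfl
  set F : dom a b → ℝ := fun p => f p with hF
  have hFi : Integrable F μ := by
    rw [← hmap, hemb.integrable_map_iff] at hf; exact hf
  have hint : ∀ G : ℝ × ℝ → ℝ, ∫ p, G p ∂μ = ∫ p, G p ∂(vol a b) := by
    intro G; rw [← hmap, hemb.integral_map]
  have : PolishSpace (dom a b) := isOpen_dom.polishSpace
  set P := μ.withDensity fun p => ENNReal.ofReal (F p) with hP
  set P' := μ.withDensity fun p => ENNReal.ofReal (- F p) with hP'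
  have : IsFiniteMeasure P := isFiniteMeasure_withDensity_ofReal hFi.2
  have : IsFiniteMeasure P' := isFiniteMeasure_withDensity_ofReal hFi.neg.2
  have hFm : AEMeasurable F μ := hFi.1.aemeasurable
  have hFm' : AEMeasurable (fun p => ENNReal.ofReal (- F p)) μ := hFm.neg.ennreal_ofReal
  have hb1 : ∀ g : BoundedContinuousFunction (dom a b) ℝ, Integrable (fun p => F p * g p) μ :=
    fun g => hFi.mul_bdd (c := ‖g‖) g.continuous.aestronglyMeasurable
      (ae_of_all _ fun p => g.norm_coe_le_norm p)
  have hz : ∀ g ∈ cosAlgebra a b, ∫ p, F p * g p ∂μ = 0 := by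
    intro g hg
    change g ∈ Submodule.span ℝ (range (cosModeBCF a b)) at hg
    induction hg using Submodule.span_induction with
    | mem x hx =>
      obtain ⟨⟨j, k, θ⟩, rfl⟩ := hx
      exact (hint fun p => f p * cosMode a b j k θ p).trans (h j k θ)
    | zero => simp
    | add x y _ _ hx hy =>
      simp only [BoundedContinuousFunction.coe_add, Pi.add_apply, mul_add]
      rw [integral_add (hb1 x) (hb1 y), hx, hy, add_zero]
    | smul r x _ hx =>
      have : (fun p => F p * (r • x) p) = fun p => r * (F p * x p) := by
        funext p; simp; ring
      rw [this, integral_const_mul, hx, mul_zero]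
  have hPP : P = P' := by
    refine ext_of_forall_mem_subalgebra_integral_eq_of_polish
      (cosAlgebra_separatesPoints ha hb) fun g hg => ?_
    rw [hP, hP', integral_withDensity_eq_integral_toReal_smul₀ hFm.ennreal_ofReal
      (ae_of_all _ fun _ => ENNReal.ofReal_lt_top),
      integral_withDensity_eq_integral_toReal_smul₀ hFm'
      (ae_of_all _ fun _ => ENNReal.ofReal_lt_top), ← sub_eq_zero, ← integral_sub]
    · rw [← hz g hg]
      refine integral_congr_ae (ae_of_all _ fun p => ?_)
      simp only [ENNReal.toReal_ofReal', smul_eq_mul]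
      rcases le_total 0 (F p) with h0 | h0
      · rw [max_eq_left h0, max_eq_right (by linarith)]; ring
      · rw [max_eq_right h0, max_eq_left (by linarith)]; ring
    · refine (hFi.pos_part.mul_bdd (c := ‖g‖) g.continuous.aestronglyMeasurable
        (ae_of_all _ fun p => g.norm_coe_le_norm p)).congr (ae_of_all _ fun p => ?_)
      simp [ENNReal.toReal_ofReal']
    · refine (hFi.neg_part.mul_bdd (c := ‖g‖) g.continuous.aestronglyMeasurable
        (ae_of_all _ fun p => g.norm_coe_le_norm p)).congr (ae_of_all _ fun p => ?_)
      simp [ENNReal.toReal_ofReal']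
  have hae : (fun p => ENNReal.ofReal (F p)) =ᵐ[μ] fun p => ENNReal.ofReal (- F p) :=
    (withDensity_eq_iff hFm.ennreal_ofReal hFm'
      (by
        have := measure_ne_top P Set.univ
        rwa [hP, withDensity_apply _ MeasurableSet.univ, Measure.restrict_univ] at this)).1 hPP
  have hF0 : ∀ᵐ p : dom a b ∂μ, f p = 0 := by
    filter_upwards [hae] with p hp
    rcases lt_trichotomy (F p) 0 with h0 | h0 | h0
    · rw [ENNReal.ofReal_of_nonpos h0.le, eq_comm, ENNReal.ofReal_eq_zero] at hp
      linarith
    · exact h0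
    · rw [ENNReal.ofReal_of_nonpos (p := -F p) (by linarith), ENNReal.ofReal_eq_zero] at hp
      linarith
  rw [← hmap]
  exact hemb.ae_map_iff.2 hF0

/-- The sine modes do not form an algebra, but sin(by) times a cosine mode is half a difference of
two sine modes. So f sin(by) is orthogonal to all cosine modes, and sin(by) > 0 inside the channel.
-/
lemma ae_eq_zero_of_sinMode (ha : 0 < a) (hb : 0 < b) {f : ℝ × ℝ → ℝ}
    (hf : Integrable f (vol a b))
    (h : ∀ (j k : ℤ) (θ : ℝ), ∫ p, f p * sinMode a b j k θ p ∂(vol a b) = 0) :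
    f =ᵐ[vol a b] 0 := by
  have hi : ∀ j k θ, Integrable (fun p => f p * sinMode a b j k θ p) (vol a b) := fun j k θ =>
    hf.mul_bdd (c := 1) (contDiff_sinMode (n := 0) j k θ).continuous.aestronglyMeasurable
      (ae_of_all _ fun p => abs_sinMode_le j k θ p)
  have h1 : Integrable (fun p => f p * Real.sin (b * p.2)) (vol a b) :=
    hf.mul_bdd (c := 1) (by fun_prop : Continuous fun p : ℝ × ℝ =>
      Real.sin (b * p.2)).aestronglyMeasurable (ae_of_all _ fun p => Real.abs_sin_le_one _)
  have h2 := ae_eq_zero_of_cosMode ha hb h1 fun j k θ => by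
    have : ∀ p : ℝ × ℝ, f p * Real.sin (b * p.2) * cosMode a b j k θ p
        = 1 / 2 * (f p * sinMode a b j (k + 1) θ p) - 1 / 2 * (f p * sinMode a b j (k - 1) θ p) := by
      intro p
      simp only [cosMode, sinMode]
      rw [show b * (k + 1 : ℤ) * p.2 = b * k * p.2 + b * p.2 by push_cast; ring,
        show b * (k - 1 : ℤ) * p.2 = b * k * p.2 - b * p.2 by push_cast; ring,
        Real.sin_add, Real.sin_sub]
      ring
    simp only [this]
    rw [integral_sub ((hi _ _ _).const_mul _) ((hi _ _ _).const_mul _), integral_const_mul,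
      integral_const_mul, h, h]
    simp
  filter_upwards [h2, ae_mem_dom] with p hp hd
  have hd2 : p.2 ∈ Ioo 0 (Real.pi / b) := hd.2
  have : 0 < Real.sin (b * p.2) :=
    Real.sin_pos_of_pos_of_lt_pi (mul_pos hb hd2.1) (by
      rw [mul_comm]; exact (lt_div_iff₀ hb).1 hd2.2)
  exact (mul_eq_zero.1 hp).resolve_right this.ne'

end Totality

/-! ### Derivatives of modes, Fourier coefficients and eigenvalues -/

section Modes

variable {a b : ℝ}

lemma hasFDerivAt_prod_mul {F G : ℝ → ℝ} {F' G' : ℝ} {p : ℝ × ℝ} (hF : HasDerivAt F F' p.1)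
    (hG : HasDerivAt G G' p.2) :
    HasFDerivAt (fun p : ℝ × ℝ => F p.1 * G p.2)
      ((F' * G p.2) • ContinuousLinearMap.fst ℝ ℝ ℝ
        + (F p.1 * G') • ContinuousLinearMap.snd ℝ ℝ ℝ) p := by
  have h1 : HasFDerivAt (fun p : ℝ × ℝ => F p.1) (F' • ContinuousLinearMap.fst ℝ ℝ ℝ) p :=
    hF.comp_hasFDerivAt p hasFDerivAt_fst
  have h2 : HasFDerivAt (fun p : ℝ × ℝ => G p.2) (G' • ContinuousLinearMap.snd ℝ ℝ ℝ) p :=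
    hG.comp_hasFDerivAt p hasFDerivAt_snd
  refine (h1.fun_mul h2).congr_fderiv ?_
  ext <;> simp [mul_comm]

/-- Writing the derivative as a phase shift by π/2 keeps it, up to a factor, in the family of modes
with free phase. -/
lemma hasDerivAt_cos_affine (c θ x : ℝ) :
    HasDerivAt (fun x => Real.cos (c * x + θ)) (c * Real.cos (c * x + (θ + Real.pi / 2))) x := by
  have h : HasDerivAt (fun x : ℝ => c * x + θ) (c * 1) x :=
    ((hasDerivAt_id x).const_mul c).add_const θ
  refine h.cos.congr_deriv ?_
  rw [← add_assoc, Real.cos_add_pi_div_two]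
  ring

lemma hasDerivAt_cos_mul (c x : ℝ) :
    HasDerivAt (fun x => Real.cos (c * x)) (-(c * Real.sin (c * x))) x := by
  have h : HasDerivAt (fun x : ℝ => c * x) (c * 1) x := (hasDerivAt_id x).const_mul c
  exact h.cos.congr_deriv (by ring)

lemma hasDerivAt_sin_mul (c x : ℝ) :
    HasDerivAt (fun x => Real.sin (c * x)) (c * Real.cos (c * x)) x := by
  have h : HasDerivAt (fun x : ℝ => c * x) (c * 1) x := (hasDerivAt_id x).const_mul c
  exact h.sin.congr_deriv (by ring)

lemma hasFDerivAt_cosMode (j k : ℤ) (θ : ℝ) (p : ℝ × ℝ) :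
    HasFDerivAt (cosMode a b j k θ)
      ((2 * a * j * cosMode a b j k (θ + Real.pi / 2) p) • ContinuousLinearMap.fst ℝ ℝ ℝ
        + (-(b * k) * sinMode a b j k θ p) • ContinuousLinearMap.snd ℝ ℝ ℝ) p := by
  refine (hasFDerivAt_prod_mul (hasDerivAt_cos_affine (2 * a * j) θ p.1)
    (hasDerivAt_cos_mul (b * k) p.2)).congr_fderiv ?_
  ext <;> simp [cosMode, sinMode] <;> ring

lemma hasFDerivAt_sinMode (j k : ℤ) (θ : ℝ) (p : ℝ × ℝ) :
    HasFDerivAt (sinMode a b j k θ)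
      ((2 * a * j * sinMode a b j k (θ + Real.pi / 2) p) • ContinuousLinearMap.fst ℝ ℝ ℝ
        + (b * k * cosMode a b j k θ p) • ContinuousLinearMap.snd ℝ ℝ ℝ) p := by
  refine (hasFDerivAt_prod_mul (hasDerivAt_cos_affine (2 * a * j) θ p.1)
    (hasDerivAt_sin_mul (b * k) p.2)).congr_fderiv ?_
  ext <;> simp [cosMode, sinMode] <;> ring

lemma cos_periodic_mode (ha : 0 < a) (j : ℤ) (θ x : ℝ) :
    Real.cos (2 * a * j * (x + Real.pi / a) + θ) = Real.cos (2 * a * j * x + θ) := by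
  rw [show 2 * a * j * (x + Real.pi / a) + θ = 2 * a * j * x + θ + j * (2 * Real.pi) by
    field_simp; ring, Real.cos_add_int_mul_two_pi]

lemma cosMode_periodic (ha : 0 < a) (j k : ℤ) (θ x y : ℝ) :
    cosMode a b j k θ (x + Real.pi / a, y) = cosMode a b j k θ (x, y) := by
  simp only [cosMode, cos_periodic_mode ha]

lemma sinMode_periodic (ha : 0 < a) (j k : ℤ) (θ x y : ℝ) :
    sinMode a b j k θ (x + Real.pi / a, y) = sinMode a b j k θ (x, y) := by
  simp only [sinMode, cos_periodic_mode ha]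

lemma sinMode_bottom (j k : ℤ) (θ x : ℝ) : sinMode a b j k θ (x, 0) = 0 := by simp [sinMode]

lemma sinMode_top (hb : 0 < b) (j k : ℤ) (θ x : ℝ) :
    sinMode a b j k θ (x, Real.pi / b) = 0 := by
  simp only [sinMode]
  rw [show b * k * (Real.pi / b) = k * Real.pi by field_simp, Real.sin_int_mul_pi, mul_zero]

lemma sinMode_add_pi_div_two (j k : ℤ) (θ : ℝ) (p : ℝ × ℝ) :
    sinMode a b j k (θ + Real.pi / 2 + Real.pi / 2) p = - sinMode a b j k θ p := by
  simp only [sinMode]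
  rw [show 2 * a * j * p.1 + (θ + Real.pi / 2 + Real.pi / 2) = 2 * a * j * p.1 + θ + Real.pi by ring,
    Real.cos_add_pi]
  ring

lemma dx_sinMode (ha : 0 < a) (hb : 0 < b) (j k : ℤ) (θ : ℝ) {p : ℝ × ℝ} (hp : p ∈ cdom a b) :
    dx a b (sinMode a b j k θ) p = 2 * a * j * sinMode a b j k (θ + Real.pi / 2) p := by
  rw [(hasFDerivAt_sinMode j k θ p).hasFDerivWithinAt.dx_eq ha hb hp]; simp

lemma dy_sinMode (ha : 0 < a) (hb : 0 < b) (j k : ℤ) (θ : ℝ) {p : ℝ × ℝ} (hp : p ∈ cdom a b) :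
    dy a b (sinMode a b j k θ) p = b * k * cosMode a b j k θ p := by
  rw [(hasFDerivAt_sinMode j k θ p).hasFDerivWithinAt.dy_eq ha hb hp]; simp

lemma dy_cosMode (ha : 0 < a) (hb : 0 < b) (j k : ℤ) (θ : ℝ) {p : ℝ × ℝ} (hp : p ∈ cdom a b) :
    dy a b (cosMode a b j k θ) p = -(b * k) * sinMode a b j k θ p := by
  rw [(hasFDerivAt_cosMode j k θ p).hasFDerivWithinAt.dy_eq ha hb hp]; simp

lemma mixedBC_sinMode (ha : 0 < a) (hb : 0 < b) (j k : ℤ) (θ : ℝ) :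
    MixedBC a b (sinMode a b j k θ) where
  bottom x _ := sinMode_bottom j k θ x
  top x _ := sinMode_top hb j k θ x
  periodic y _ := by rw [← sinMode_periodic ha j k θ 0 y, zero_add]
  periodic_dx y hy := by
    rw [dx_sinMode ha hb j k θ ⟨left_mem ha, hy⟩, dx_sinMode ha hb j k θ ⟨right_mem ha, hy⟩,
      ← sinMode_periodic ha j k _ 0 y, zero_add]

lemma lap_sinMode (ha : 0 < a) (hb : 0 < b) (j k : ℤ) (θ : ℝ) {p : ℝ × ℝ} (hp : p ∈ cdom a b) :
    lap a b (sinMode a b j k θ) p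
      = -((2 * a * j) ^ 2 + (b * k) ^ 2) * sinMode a b j k θ p := by
  rw [lap, dx_congr (fun q hq => dx_sinMode ha hb j k θ hq) hp,
    dy_congr (fun q hq => dy_sinMode ha hb j k θ hq) hp,
    dx_const_mul ha hb hp ((contDiff_sinMode (n := 1) _ _ _).differentiable
      one_ne_zero).differentiableOn,
    dy_const_mul ha hb hp ((contDiff_cosMode (n := 1) _ _ _).differentiable
      one_ne_zero).differentiableOn,
    dx_sinMode ha hb _ _ _ hp, dy_cosMode ha hb _ _ _ hp, sinMode_add_pi_div_two]
  ring

lemma integrable_mul_cosMode {f : ℝ × ℝ → ℝ} (hf : Integrable f (vol a b)) (j k : ℤ) (θ : ℝ) :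
    Integrable (fun p => f p * cosMode a b j k θ p) (vol a b) :=
  hf.mul_bdd (c := 1) (contDiff_cosMode (n := 0) j k θ).continuous.aestronglyMeasurable
      (ae_of_all _ fun p => abs_cosMode_le j k θ p)

lemma integrable_mul_sinMode {f : ℝ × ℝ → ℝ} (hf : Integrable f (vol a b)) (j k : ℤ) (θ : ℝ) :
    Integrable (fun p => f p * sinMode a b j k θ p) (vol a b) :=
  hf.mul_bdd (c := 1) (contDiff_sinMode (n := 0) j k θ).continuous.aestronglyMeasurable
      (ae_of_all _ fun p => abs_sinMode_le j k θ p)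

/-- The Fourier coefficients of a weak velocity field, in terms of those of the vorticity. -/
lemma IsWeakVelocity.integral_modes (ha : 0 < a) (hb : 0 < b) {w : ℝ × ℝ → ℝ}
    {u : ℝ × ℝ → ℝ × ℝ} (h : IsWeakVelocity a b w u) (j k : ℤ) (θ : ℝ) :
    ((2 * a * j) ^ 2 + (b * k) ^ 2) * ∫ p, (u p).1 * cosMode a b j k θ p ∂(vol a b)
        = b * k * ∫ p, w p * sinMode a b j k θ p ∂(vol a b) ∧
      ((2 * a * j) ^ 2 + (b * k) ^ 2)
          * ∫ p, (u p).2 * sinMode a b j k (θ + Real.pi / 2) p ∂(vol a b)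
        = -(2 * a * j) * ∫ p, w p * sinMode a b j k θ p ∂(vol a b) := by
  have i1 : Integrable (fun p => (u p).1) (vol a b) := h.memLp_fst.integrable (by norm_num)
  have i2 : Integrable (fun p => (u p).2) (vol a b) := h.memLp_snd.integrable (by norm_num)
  -- The two test functions give a linear system for the coefficients A of u₁ and B of u₂, with
  -- determinant (2aj)² + (bk)² up to sign. The phase shift makes both equations involve the same A
  -- and B.
  have e1 := h.div_free (cosMode a b j k (θ + Real.pi / 2)) (contDiff_cosMode _ _ _)
    (cosMode_periodic ha j k _)
  have e2 := h.curl (sinMode a b j k θ) (contDiff_sinMode _ _ _)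
    (sinMode_periodic ha j k _) fun x => ⟨sinMode_bottom _ _ _ _, sinMode_top hb _ _ _ _⟩
  set A := ∫ p, (u p).1 * cosMode a b j k θ p ∂(vol a b)
  set B := ∫ p, (u p).2 * sinMode a b j k (θ + Real.pi / 2) p ∂(vol a b)
  set G := ∫ p, w p * sinMode a b j k θ p ∂(vol a b)
  have f1 : -(2 * a * j) * A - b * k * B = 0 := by
    rw [← e1, ← integral_const_mul, ← integral_const_mul,
      ← integral_sub ((integrable_mul_cosMode i1 _ _ _).const_mul _)
        ((integrable_mul_sinMode i2 _ _ _).const_mul _)]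
    refine integral_congr_ae (ae_of_all _ fun p => ?_)
    simp only [(hasFDerivAt_cosMode j k (θ + Real.pi / 2) p).fderiv]
    have : cosMode a b j k (θ + Real.pi / 2 + Real.pi / 2) p = - cosMode a b j k θ p := by
      simp only [cosMode]
      rw [show 2 * a * j * p.1 + (θ + Real.pi / 2 + Real.pi / 2) = 2 * a * j * p.1 + θ + Real.pi
        by ring, Real.cos_add_pi]
      ring
    simp [this]
    ring
  have f2 : b * k * A - 2 * a * j * B = G := by
    rw [← e2, ← integral_const_mul, ← integral_const_mul,
      ← integral_sub ((integrable_mul_cosMode i1 _ _ _).const_mul _)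
        ((integrable_mul_sinMode i2 _ _ _).const_mul _)]
    refine integral_congr_ae (ae_of_all _ fun p => ?_)
    simp only [(hasFDerivAt_sinMode j k θ p).fderiv]
    simp
    ring
  constructor
  · linear_combination b * k * f2 - 2 * a * j * f1
  · linear_combination -(2 * a * j) * f2 - b * k * f1

/-- By symmetry of the Laplacian, an eigenfunction for `l` is orthogonal to every mode with a
different eigenvalue. If `l` were none of these values, all sine coefficients would vanish and so
would the eigenfunction. -/
lemma eigenvalue_form (ha : 0 < a) (hb : 0 < b) {l : ℝ} (hl : IsEigenvalue a b l) :
    ∃ j k : ℤ, k ≠ 0 ∧ l = (2 * a * j) ^ 2 + (b * k) ^ 2 := by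
  obtain ⟨w, ⟨hw, hbc, heq⟩, p, hp, hne⟩ := hl
  by_contra! hcon
  have hw1 : ContDiffOn ℝ 1 w (cdom a b) := hw.of_le (by norm_num)
  refine hne (eqOn_dom_of_ae_eq hw1.continuousOn continuousOn_const
    (ae_eq_zero_of_sinMode ha hb (integrable_vol hw1.continuousOn) fun j k θ => ?_) hp)
  rcases eq_or_ne k 0 with rfl | hk
  · simp [sinMode]
  have hφ := contDiff_sinMode (a := a) (b := b) (n := 2) j k θ
  have bφ := mixedBC_sinMode ha hb j k θ
  have i1 := zeroMean_green ha hb hw1 hφ.contDiffOn hbc.bottom hbc.top hbc.periodic bφ.periodic_dx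
  have i2 := zeroMean_green ha hb (hφ.of_le (by norm_num)).contDiffOn hw bφ.bottom bφ.top
    bφ.periodic hbc.periodic_dx
  have := ((i1.sub i2).congr (g := fun p =>
    (l - ((2 * a * j) ^ 2 + (b * k) ^ 2)) * (w p * sinMode a b j k θ p)) fun q hq => by
      simp only
      rw [lap_sinMode ha hb j k θ (dom_subset_cdom hq)]
      linear_combination sinMode a b j k θ q * heq q hq).2
  rw [integral_const_mul] at this
  exact (mul_eq_zero.1 this).resolve_left (sub_ne_zero.2 (hcon j k hk))

lemma IsEigenvalue.pos (ha : 0 < a) (hb : 0 < b) {l : ℝ} (hl : IsEigenvalue a b l) : 0 < l := by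
  obtain ⟨j, k, hk, rfl⟩ := eigenvalue_form ha hb hl
  positivity

lemma finite_eigenvalue_le (ha : 0 < a) (hb : 0 < b) (M : ℝ) :
    {l : ℝ | IsEigenvalue a b l ∧ l ≤ M}.Finite := by
  -- N bounds j² and k², hence also |j| and |k|, as |i| ≤ i² for integers.
  obtain ⟨N, hN⟩ := exists_nat_ge (max (M / (2 * a) ^ 2) (M / b ^ 2))
  have hfin : ((fun q : ℤ × ℤ => (2 * a * q.1) ^ 2 + (b * q.2) ^ 2) ''
      (Icc (-N : ℤ) N ×ˢ Icc (-N : ℤ) N)).Finite :=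
    ((finite_Icc _ _).prod (finite_Icc _ _)).image _
  refine hfin.subset ?_
  rintro l ⟨hl, hM⟩
  obtain ⟨j, k, -, rfl⟩ := eigenvalue_form ha hb hl
  have key : ∀ (c : ℝ) (i : ℤ), 0 < c → (c * i) ^ 2 ≤ M → M / c ^ 2 ≤ N →
      i ∈ Icc (-N : ℤ) N := by
    intro c i hc h1 h2
    have h3 : (i : ℝ) ^ 2 ≤ N := by
      refine le_trans ?_ h2
      rw [le_div_iff₀ (by positivity), ← mul_pow, mul_comm]; exact h1
    have h4 : i ^ 2 ≤ (N : ℤ) := by exact_mod_cast h3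
    constructor <;> nlinarith [Int.le_self_sq i, Int.le_self_sq (-i)]
  refine ⟨(j, k), ⟨key (2 * a) j (by positivity) ?_ ((le_max_left _ _).trans hN),
    key b k hb ?_ ((le_max_right _ _).trans hN)⟩, rfl⟩
  · nlinarith [sq_nonneg (b * k)]
  · nlinarith [sq_nonneg (2 * a * j)]

/-- Only finitely many eigenvalues lie below `l`, so each infimum in the recursion is attained as
long as the current value is below `l`. If `l` were never hit, infinitely many distinct eigenvalues
would lie below it. -/
lemma exists_mu_eq (ha : 0 < a) (hb : 0 < b) {l : ℝ} (hl : IsEigenvalue a b l) (h0 : 0 < l) :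
    ∃ k : ℕ, 1 ≤ k ∧ mu a b k = l := by
  by_contra! hcon
  have step : ∀ k, mu a b k < l →
      IsEigenvalue a b (mu a b (k + 1)) ∧ mu a b k < mu a b (k + 1) ∧ mu a b (k + 1) < l := by
    intro k hk
    set S := {m : ℝ | IsEigenvalue a b m ∧ mu a b k < m} with hS
    have hlS : l ∈ S := ⟨hl, hk⟩
    have hbdd : BddBelow S := ⟨mu a b k, fun m hm => hm.2.le⟩
    set T := {m : ℝ | IsEigenvalue a b m ∧ m ≤ l} ∩ S with hT
    have hTf : T.Finite := (finite_eigenvalue_le ha hb l).inter_of_left _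
    have hTn : T.Nonempty := ⟨l, ⟨hl, le_rfl⟩, hlS⟩
    obtain ⟨m, hm, hmin⟩ := exists_min_image T id hTf hTn
    have hleast : IsLeast S m := by
      refine ⟨hm.2, fun m' hm' => ?_⟩
      rcases le_total m' l with h | h
      · exact hmin m' ⟨⟨hm'.1, h⟩, hm'⟩
      · exact hm.1.2.trans h
    have hmu : mu a b (k + 1) = m := hleast.csInf_eq
    rw [hmu]
    refine ⟨hm.2.1, hm.2.2, lt_of_le_of_ne hm.1.2 fun h => hcon (k + 1) (by omega) (hmu.trans h)⟩
  have hlt : ∀ k, mu a b k < l := by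
    intro k
    induction k with
    | zero => exact h0
    | succ k ih => exact (step k ih).2.2
  have hmono : StrictMono (mu a b) := strictMono_nat_of_lt_succ fun k => (step k (hlt k)).2.1
  refine (finite_eigenvalue_le ha hb l).not_infinite ((infinite_range_of_injective
    (hmono.injective.comp (add_left_injective 1))).mono ?_)
  rintro _ ⟨k, rfl⟩
  exact ⟨(step k (hlt k)).1, (hlt (k + 1)).le⟩

/-- The function sin(by) is an eigenfunction for b². Only this inequality is needed, since b² is a
lower bound of the Rayleigh quotient. -/
lemma mu_one_le (ha : 0 < a) (hb : 0 < b) : mu a b 1 ≤ b ^ 2 := by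
  refine csInf_le ⟨0, fun l hl => hl.2.le⟩ ⟨⟨sinMode a b 0 1 0,
    ⟨(contDiff_sinMode _ _ _).contDiffOn, mixedBC_sinMode ha hb _ _ _, fun p hp => ?_⟩,
    ?_⟩, (by simp only [mu]; positivity)⟩
  · rw [lap_sinMode ha hb _ _ _ (dom_subset_cdom hp)]; simp
  · obtain ⟨p, hp⟩ := nonempty_dom ha hb
    refine ⟨p, hp, ?_⟩
    have hd2 : p.2 ∈ Ioo 0 (Real.pi / b) := hp.2
    have : 0 < Real.sin (b * p.2) :=
      Real.sin_pos_of_pos_of_lt_pi (mul_pos hb hd2.1) (by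
        rw [mul_comm]; exact (lt_div_iff₀ hb).1 hd2.2)
    simp [sinMode, this.ne']

end Modes

/-! ### Time derivatives on the space-time cylinder -/

section Time

variable {a b : ℝ} {Φ : ℝ → ℝ × ℝ → ℝ} {t : ℝ} {p : ℝ × ℝ}

/-- The space-time cylinder over the closed rectangle. -/
def cyl (a b : ℝ) : Set (ℝ × (ℝ × ℝ)) := Ioi 0 ×ˢ cdom a b

lemma uniqueDiffOn_cyl (ha : 0 < a) (hb : 0 < b) : UniqueDiffOn ℝ (cyl a b) :=
  (uniqueDiffOn_Ioi 0).prod (uniqueDiffOn_cdom ha hb)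

lemma cyl_subset_closure_interior (ha : 0 < a) (hb : 0 < b) :
    cyl a b ⊆ closure (interior (cyl a b)) := by
  rw [cyl, interior_prod_eq, interior_cdom, interior_Ioi, closure_prod_eq, closure_dom ha hb,
    closure_Ioi]
  exact prod_mono Ioi_subset_Ici_self le_rfl

/-- Joint regularity of a time-dependent function up to the boundary, for positive times. -/
def SmoothCyl (a b : ℝ) (n : WithTop ℕ∞) (Φ : ℝ → ℝ × ℝ → ℝ) : Prop :=
  ContDiffOn ℝ n (fun q : ℝ × (ℝ × ℝ) => Φ q.1 q.2) (cyl a b)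

/-- The time derivative. -/
noncomputable def dt (a b : ℝ) (Φ : ℝ → ℝ × ℝ → ℝ) (t : ℝ) (p : ℝ × ℝ) : ℝ :=
  fderivWithin ℝ (fun q : ℝ × (ℝ × ℝ) => Φ q.1 q.2) (cyl a b) (t, p) (1, 0)

variable {n : WithTop ℕ∞}

lemma SmoothCyl.hasDerivAt (h : SmoothCyl a b n Φ) (hn : n ≠ 0) (ht : 0 < t) (hp : p ∈ cdom a b) :
    HasDerivAt (fun s => Φ s p) (dt a b Φ t p) t := by
  have h1 : HasDerivWithinAt (fun s : ℝ => (s, p)) (1, 0) (Ioi 0) t :=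
    (hasDerivWithinAt_id t _).prodMk (hasDerivWithinAt_const t _ p)
  have h0 : HasFDerivWithinAt (fun q : ℝ × (ℝ × ℝ) => Φ q.1 q.2)
      (fderivWithin ℝ (fun q : ℝ × (ℝ × ℝ) => Φ q.1 q.2) (cyl a b) (t, p)) (cyl a b) (t, p) :=
    (h.differentiableOn hn (t, p) ⟨ht, hp⟩).hasFDerivWithinAt
  have hm : MapsTo (fun s : ℝ => (s, p)) (Ioi 0) (cyl a b) := fun s hs => ⟨hs, hp⟩
  have h2 := HasFDerivWithinAt.comp_hasDerivWithinAt t h0 h1 hm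
  exact h2.hasDerivAt (Ioi_mem_nhds ht)

lemma SmoothCyl.slice (h : SmoothCyl a b n Φ) (ht : 0 < t) : ContDiffOn ℝ n (Φ t) (cdom a b) :=
  ContDiffOn.comp (g := fun q : ℝ × (ℝ × ℝ) => Φ q.1 q.2) (t := cyl a b) h
    (contDiff_const.prodMk contDiff_id).contDiffOn fun _ hp => ⟨ht, hp⟩

lemma SmoothCyl.hasFDerivWithinAt_slice (h : SmoothCyl a b n Φ) (hn : n ≠ 0) (ht : 0 < t)
    (hp : p ∈ cdom a b) :
    HasFDerivWithinAt (Φ t)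
      ((fderivWithin ℝ (fun q : ℝ × (ℝ × ℝ) => Φ q.1 q.2) (cyl a b) (t, p)).comp
        (ContinuousLinearMap.inr ℝ ℝ (ℝ × ℝ))) (cdom a b) p := by
  have h1 : HasFDerivWithinAt (fun z : ℝ × ℝ => (t, z)) (ContinuousLinearMap.inr ℝ ℝ (ℝ × ℝ))
      (cdom a b) p := by
    refine ((hasFDerivWithinAt_const t p _).prodMk (hasFDerivWithinAt_id p _)).congr_fderiv ?_
    ext <;> simp
  exact (h.differentiableOn hn (t, p) ⟨ht, hp⟩).hasFDerivWithinAt.comp p h1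
    fun z hz => (⟨ht, hz⟩ : (t, z) ∈ cyl a b)

lemma SmoothCyl.dx_eq (ha : 0 < a) (hb : 0 < b) (h : SmoothCyl a b n Φ) (hn : n ≠ 0) (ht : 0 < t)
    (hp : p ∈ cdom a b) : VortexStrip.dx a b (Φ t) p
      = fderivWithin ℝ (fun q : ℝ × (ℝ × ℝ) => Φ q.1 q.2) (cyl a b) (t, p) (0, (1, 0)) :=
  (h.hasFDerivWithinAt_slice hn ht hp).dx_eq ha hb hp

lemma SmoothCyl.dy_eq (ha : 0 < a) (hb : 0 < b) (h : SmoothCyl a b n Φ) (hn : n ≠ 0) (ht : 0 < t)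
    (hp : p ∈ cdom a b) : VortexStrip.dy a b (Φ t) p
      = fderivWithin ℝ (fun q : ℝ × (ℝ × ℝ) => Φ q.1 q.2) (cyl a b) (t, p) (0, (0, 1)) :=
  (h.hasFDerivWithinAt_slice hn ht hp).dy_eq ha hb hp

lemma ne_zero_of_add_one_le (hmn : m + 1 ≤ n) : n ≠ 0 := by
  rintro rfl
  simp at hmn

lemma SmoothCyl.dx (ha : 0 < a) (hb : 0 < b) (h : SmoothCyl a b n Φ) (hmn : m + 1 ≤ n) :
    SmoothCyl a b m (fun t => VortexStrip.dx a b (Φ t)) := by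
  have h1 : ContDiffOn ℝ m (fun q => fderivWithin ℝ (fun q : ℝ × (ℝ × ℝ) => Φ q.1 q.2)
      (cyl a b) q (0, (1, 0))) (cyl a b) :=
    (ContDiffOn.fderivWithin h (uniqueDiffOn_cyl ha hb) hmn).clm_apply contDiffOn_const
  exact h1.congr fun q hq => h.dx_eq ha hb (ne_zero_of_add_one_le hmn) hq.1 hq.2

lemma SmoothCyl.dy (ha : 0 < a) (hb : 0 < b) (h : SmoothCyl a b n Φ) (hmn : m + 1 ≤ n) :
    SmoothCyl a b m (fun t => VortexStrip.dy a b (Φ t)) := by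
  have h1 : ContDiffOn ℝ m (fun q => fderivWithin ℝ (fun q : ℝ × (ℝ × ℝ) => Φ q.1 q.2)
      (cyl a b) q (0, (0, 1))) (cyl a b) :=
    (ContDiffOn.fderivWithin h (uniqueDiffOn_cyl ha hb) hmn).clm_apply contDiffOn_const
  exact h1.congr fun q hq => h.dy_eq ha hb (ne_zero_of_add_one_le hmn) hq.1 hq.2

lemma SmoothCyl.dt (ha : 0 < a) (hb : 0 < b) (h : SmoothCyl a b n Φ) (hmn : m + 1 ≤ n) :
    SmoothCyl a b m (VortexStrip.dt a b Φ) :=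
  (ContDiffOn.fderivWithin h (uniqueDiffOn_cyl ha hb) hmn).clm_apply contDiffOn_const

/-- This is ∂ₜ∂ₓ = ∂ₓ∂ₜ, valid up to the lateral boundary by symmetry of the second derivative on
the cylinder. -/
lemma SmoothCyl.hasDerivAt_dx (ha : 0 < a) (hb : 0 < b) (h : SmoothCyl a b 2 Φ) (ht : 0 < t)
    (hp : p ∈ cdom a b) :
    HasDerivAt (fun s => VortexStrip.dx a b (Φ s) p)
      (VortexStrip.dx a b (VortexStrip.dt a b Φ t) p) t := by
  have h1 := (h.dx ha hb (m := 1) (by norm_num)).hasDerivAt one_ne_zero ht hp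
  convert! h1 using 1
  rw [(h.dt ha hb (m := 1) (by norm_num)).dx_eq ha hb one_ne_zero ht hp]
  have := fderivWithin_apply_comm (uniqueDiffOn_cyl ha hb) (cyl_subset_closure_interior ha hb) h
    (p := (t, p)) ⟨ht, hp⟩ (1, 0) (0, (1, 0))
  refine this.trans ?_
  exact congrArg (fun L : ℝ × (ℝ × ℝ) →L[ℝ] ℝ => L (1, 0)) (fderivWithin_congr
    (fun q hq => (h.dx_eq ha hb (by norm_num) hq.1 hq.2).symm)
    (h.dx_eq ha hb (by norm_num) ht hp).symm)

lemma SmoothCyl.hasDerivAt_dy (ha : 0 < a) (hb : 0 < b) (h : SmoothCyl a b 2 Φ) (ht : 0 < t)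
    (hp : p ∈ cdom a b) :
    HasDerivAt (fun s => VortexStrip.dy a b (Φ s) p)
      (VortexStrip.dy a b (VortexStrip.dt a b Φ t) p) t := by
  have h1 := (h.dy ha hb (m := 1) (by norm_num)).hasDerivAt one_ne_zero ht hp
  convert! h1 using 1
  rw [(h.dt ha hb (m := 1) (by norm_num)).dy_eq ha hb one_ne_zero ht hp]
  have := fderivWithin_apply_comm (uniqueDiffOn_cyl ha hb) (cyl_subset_closure_interior ha hb) h
    (p := (t, p)) ⟨ht, hp⟩ (1, 0) (0, (0, 1))
  refine this.trans ?_
  exact congrArg (fun L : ℝ × (ℝ × ℝ) →L[ℝ] ℝ => L (1, 0)) (fderivWithin_congr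
    (fun q hq => (h.dy_eq ha hb (by norm_num) hq.1 hq.2).symm)
    (h.dy_eq ha hb (by norm_num) ht hp).symm)

lemma SmoothCyl.hasDerivAt_integral (ha : 0 < a) (hb : 0 < b) (h : SmoothCyl a b 1 Φ) (ht : 0 < t)
    {g : ℝ × ℝ → ℝ} (hg : ∀ p ∈ dom a b, HasDerivAt (fun s => Φ s p) (g p) t) :
    HasDerivAt (fun s => ∫ p, Φ s p ∂(vol a b)) (∫ p, g p ∂(vol a b)) t := by
  have hgt : EqOn g (VortexStrip.dt a b Φ t) (dom a b) := fun p hp =>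
    (hg p hp).unique (h.hasDerivAt one_ne_zero ht (dom_subset_cdom hp))
  rw [integral_congr_dom hgt]
  have hdt : ContinuousOn (fun q : ℝ × (ℝ × ℝ) => VortexStrip.dt a b Φ q.1 q.2) (cyl a b) :=
    (h.dt ha hb (m := 0) (by simp)).continuousOn
  -- The time derivative is bounded on this compact part of the cylinder, and that bound is the
  -- dominating function.
  have hK : Icc (t / 2) (2 * t) ×ˢ cdom a b ⊆ cyl a b :=
    prod_mono (fun s hs => lt_of_lt_of_le (half_pos ht) hs.1) le_rfl
  obtain ⟨M, hM⟩ := (isCompact_Icc.prod isCompact_cdom).exists_bound_of_continuousOn (hdt.mono hK)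
  have hnhds : Ioo (t / 2) (2 * t) ∈ 𝓝 t := Ioo_mem_nhds (by linarith) (by linarith)
  refine (hasDerivAt_integral_of_dominated_loc_of_deriv_le (bound := fun _ => M)
    (F := fun s p => Φ s p) (F' := fun s p => VortexStrip.dt a b Φ s p) hnhds ?_ ?_ ?_ ?_ ?_ ?_).2
  · filter_upwards [Ioi_mem_nhds ht] with s hs
    exact (integrable_vol (h.slice hs).continuousOn).1
  · exact integrable_vol (h.slice ht).continuousOn
  · exact (integrable_vol ((h.dt ha hb (m := 0) (by simp)).slice ht).continuousOn).1
  · filter_upwards [ae_mem_dom] with p hp s hs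
    exact hM (s, p) ⟨Ioo_subset_Icc_self hs, dom_subset_cdom hp⟩
  · exact integrable_const _
  · filter_upwards [ae_mem_dom] with p hp s hs
    exact h.hasDerivAt one_ne_zero (lt_trans (half_pos ht) hs.1) (dom_subset_cdom hp)

end Time

/-! ### Linearity of the Laplacian, the boundary conditions and the velocity -/

section Static

variable {a b : ℝ} {f g : ℝ × ℝ → ℝ} {p : ℝ × ℝ}

lemma lap_sub (ha : 0 < a) (hb : 0 < b) (hf : ContDiffOn ℝ 2 f (cdom a b))
    (hg : ContDiffOn ℝ 2 g (cdom a b)) (hp : p ∈ cdom a b) :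
    lap a b (fun z => f z - g z) p = lap a b f p - lap a b g p := by
  have two : (2 : WithTop ℕ∞) ≠ 0 := by norm_num
  have df := hf.differentiableOn two
  have dg := hg.differentiableOn two
  rw [lap, dx_congr (fun q hq => dx_sub ha hb df dg hq) hp,
    dy_congr (fun q hq => dy_sub ha hb df dg hq) hp,
    dx_sub ha hb ((contDiffOn_dx ha hb hf (m := 1) (by norm_num)).differentiableOn one_ne_zero)
      ((contDiffOn_dx ha hb hg (m := 1) (by norm_num)).differentiableOn one_ne_zero) hp,
    dy_sub ha hb ((contDiffOn_dy ha hb hf (m := 1) (by norm_num)).differentiableOn one_ne_zero)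
      ((contDiffOn_dy ha hb hg (m := 1) (by norm_num)).differentiableOn one_ne_zero) hp, lap, lap]
  ring

lemma lap_const_mul (ha : 0 < a) (hb : 0 < b) (hf : ContDiffOn ℝ 2 f (cdom a b))
    (hp : p ∈ cdom a b) (c : ℝ) : lap a b (fun z => c * f z) p = c * lap a b f p := by
  have df := hf.differentiableOn (by norm_num : (2 : WithTop ℕ∞) ≠ 0)
  rw [lap, dx_congr (fun q hq => dx_const_mul ha hb hq df c) hp,
    dy_congr (fun q hq => dy_const_mul ha hb hq df c) hp,
    dx_const_mul ha hb hp
      ((contDiffOn_dx ha hb hf (m := 1) (by norm_num)).differentiableOn one_ne_zero),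
    dy_const_mul ha hb hp
      ((contDiffOn_dy ha hb hf (m := 1) (by norm_num)).differentiableOn one_ne_zero), lap]
  ring

lemma MixedBC.sub (ha : 0 < a) (hb : 0 < b) (hf : MixedBC a b f) (hg : MixedBC a b g)
    (df : DifferentiableOn ℝ f (cdom a b)) (dg : DifferentiableOn ℝ g (cdom a b)) :
    MixedBC a b (fun z => f z - g z) where
  bottom x hx := by rw [hf.bottom x hx, hg.bottom x hx, sub_zero]
  top x hx := by rw [hf.top x hx, hg.top x hx, sub_zero]
  periodic y hy := by rw [hf.periodic y hy, hg.periodic y hy]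
  periodic_dx y hy := by
    rw [dx_sub ha hb df dg ⟨left_mem ha, hy⟩, dx_sub ha hb df dg ⟨right_mem ha, hy⟩,
      hf.periodic_dx y hy, hg.periodic_dx y hy]

lemma MixedBC.const_mul (ha : 0 < a) (hb : 0 < b) (hf : MixedBC a b f)
    (df : DifferentiableOn ℝ f (cdom a b)) (c : ℝ) : MixedBC a b (fun z => c * f z) where
  bottom x hx := by rw [hf.bottom x hx, mul_zero]
  top x hx := by rw [hf.top x hx, mul_zero]
  periodic y hy := by rw [hf.periodic y hy]
  periodic_dx y hy := by
    rw [dx_const_mul ha hb ⟨left_mem ha, hy⟩ df, dx_const_mul ha hb ⟨right_mem ha, hy⟩ df,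
      hf.periodic_dx y hy]

lemma IsVelocity.sub (ha : 0 < a) (hb : 0 < b) {w w' : ℝ × ℝ → ℝ} {u u' : ℝ × ℝ → ℝ × ℝ}
    (h : IsVelocity a b w u) (h' : IsVelocity a b w' u') (hu : ContDiffOn ℝ 1 u (cdom a b))
    (hu' : ContDiffOn ℝ 1 u' (cdom a b)) :
    IsVelocity a b (fun p => w p - w' p) (fun p => u p - u' p) := by
  have d1 : DifferentiableOn ℝ (fun z => (u z).1) (cdom a b) := hu.fst.differentiableOn one_ne_zero
  have d2 : DifferentiableOn ℝ (fun z => (u z).2) (cdom a b) := hu.snd.differentiableOn one_ne_zero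
  have d1' : DifferentiableOn ℝ (fun z => (u' z).1) (cdom a b) :=
    hu'.fst.differentiableOn one_ne_zero
  have d2' : DifferentiableOn ℝ (fun z => (u' z).2) (cdom a b) :=
    hu'.snd.differentiableOn one_ne_zero
  constructor
  · intro p hp
    have hp' := dom_subset_cdom hp
    simp only [Prod.fst_sub, Prod.snd_sub]
    rw [dx_sub ha hb d1 d1' hp', dy_sub ha hb d2 d2' hp']
    linear_combination h.div_free p hp - h'.div_free p hp
  · intro p hp
    have hp' := dom_subset_cdom hp
    simp only [Prod.fst_sub, Prod.snd_sub]
    rw [dx_sub ha hb d2 d2' hp', dy_sub ha hb d1 d1' hp']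
    linear_combination h.curl p hp - h'.curl p hp
  · intro x hx
    simp only [Prod.snd_sub, h.bottom x hx, h'.bottom x hx, sub_zero]
  · intro x hx
    simp only [Prod.snd_sub, h.top x hx, h'.top x hx, sub_zero]
  · intro y hy
    simp only [h.periodic y hy, h'.periodic y hy]
  · simp only [Prod.fst_sub]
    rw [integral_sub (integrable_vol hu.fst.continuousOn) (integrable_vol hu'.fst.continuousOn),
      h.mean_zero, h'.mean_zero, sub_zero]

end Static

/-! ### Flows and the energy balance -/

/-- Classical solutions of the vorticity equation with just enough regularity for energy
estimates. The last field is the curl of the momentum equation, with `z = ∂ₜ u`. -/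
structure IsFlow (ν a b : ℝ) (ω : ℝ → ℝ × ℝ → ℝ) (u : ℝ → ℝ × ℝ → ℝ × ℝ) : Prop where
  smooth_fst : SmoothCyl a b 1 (fun t p => (u t p).1)
  smooth_snd : SmoothCyl a b 1 (fun t p => (u t p).2)
  contDiffOn : ∀ t, 0 < t → ContDiffOn ℝ 2 (ω t) (cdom a b)
  velocity : ∀ t, 0 < t → IsVelocity a b (ω t) (u t)
  bc : ∀ t, 0 < t → MixedBC a b (ω t)
  vorticity_eq : ∀ t, 0 < t → ∃ z₁ z₂ : ℝ × ℝ → ℝ,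
    ContDiffOn ℝ 1 z₁ (cdom a b) ∧ ContDiffOn ℝ 1 z₂ (cdom a b) ∧
    (∀ y ∈ Icc 0 (Real.pi / b), z₂ (0, y) = z₂ (Real.pi / a, y)) ∧
    (∀ p ∈ dom a b, HasDerivAt (fun s => (u s p).1) (z₁ p) t) ∧
    (∀ p ∈ dom a b, HasDerivAt (fun s => (u s p).2) (z₂ p) t) ∧
    ∀ p ∈ dom a b, dx a b z₂ p - dy a b z₁ p = ν * lap a b (ω t) p
      - ((u t p).1 * dx a b (ω t) p + (u t p).2 * dy a b (ω t) p)

section Flow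

variable {ν a b : ℝ} {ω ω' : ℝ → ℝ × ℝ → ℝ} {u u' : ℝ → ℝ × ℝ → ℝ × ℝ} {t : ℝ}

lemma IsFlow.contDiffOn_velocity (h : IsFlow ν a b ω u) (ht : 0 < t) :
    ContDiffOn ℝ 1 (u t) (cdom a b) :=
  (h.smooth_fst.slice ht).prodMk (h.smooth_snd.slice ht)

/-- For d = ω - ω' and v = u - u' the nonlinear terms differ by u · ∇d + v · ∇ω'. The second part
drops out of the balance, so no derivative of either vorticity remains. -/
lemma IsFlow.hasDerivAt_kineticEnergy_sub (ha : 0 < a) (hb : 0 < b) (h : IsFlow ν a b ω u)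
    (h' : IsFlow ν a b ω' u') (ht : 0 < t) :
    HasDerivAt (fun s => kineticEnergy a b (fun p => u s p - u' s p))
      (∫ p, (-ν * (ω t p - ω' t p) ^ 2 - (ω t p - ω' t p)
        * ((u t p).1 * ((u t p).2 - (u' t p).2) - (u t p).2 * ((u t p).1 - (u' t p).1)))
        ∂(vol a b)) t := by
  obtain ⟨z₁, z₂, hz₁, hz₂, hper, hd₁, hd₂, heq⟩ := h.vorticity_eq t ht
  obtain ⟨z₁', z₂', hz₁', hz₂', hper', hd₁', hd₂', heq'⟩ := h'.vorticity_eq t ht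
  have hw := h.contDiffOn t ht
  have hw' := h'.contDiffOn t ht
  have two : (2 : WithTop ℕ∞) ≠ 0 := by norm_num
  have dw := hw.differentiableOn two
  have dw' := hw'.differentiableOn two
  have hu := h.contDiffOn_velocity ht
  have hu' := h'.contDiffOn_velocity ht
  have key := ((h.velocity t ht).sub ha hb (h'.velocity t ht) hu hu').integral_inner_eq ha hb
    (ν := ν) (hu.sub hu') (hw.sub hw') ((h.bc t ht).sub ha hb (h'.bc t ht) dw dw')
    (h.velocity t ht) hu (hw'.of_le (by norm_num)) (h'.bc t ht).periodic (hz₁.sub hz₁')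
    (hz₂.sub hz₂') (fun y hy => by
      simp only [hper y hy, hper' y hy]) (fun p hp => by
      have hp' := dom_subset_cdom hp
      have e1 := dx_sub ha hb (hz₂.differentiableOn one_ne_zero)
        (hz₂'.differentiableOn one_ne_zero) hp'
      have e2 := dy_sub ha hb (hz₁.differentiableOn one_ne_zero)
        (hz₁'.differentiableOn one_ne_zero) hp'
      change dx a b (fun z => z₂ z - z₂' z) p - dy a b (fun z => z₁ z - z₁' z) p = _
      rw [e1, e2, lap_sub ha hb hw hw' hp', dx_sub ha hb dw dw' hp', dy_sub ha hb dw dw' hp']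
      simp only [Prod.fst_sub, Prod.snd_sub]
      linear_combination heq p hp - heq' p hp)
  simp only [Prod.fst_sub, Prod.snd_sub] at key
  rw [← key]
  have s1 : SmoothCyl a b 1 (fun t p => (u t p).1 - (u' t p).1) := h.smooth_fst.sub h'.smooth_fst
  have s2 : SmoothCyl a b 1 (fun t p => (u t p).2 - (u' t p).2) := h.smooth_snd.sub h'.smooth_snd
  have s3 : SmoothCyl a b 1 (fun t p => ((u t p).1 - (u' t p).1) ^ 2
      + ((u t p).2 - (u' t p).2) ^ 2) := (ContDiffOn.pow s1 2).add (ContDiffOn.pow s2 2)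
  have hD := (s3.hasDerivAt_integral ha hb ht (g := fun p =>
    2 * (((u t p).1 - (u' t p).1) * (z₁ p - z₁' p) + ((u t p).2 - (u' t p).2) * (z₂ p - z₂' p)))
    fun p hp => by
      refine ((((hd₁ p hp).fun_sub (hd₁' p hp)).fun_pow 2).fun_add
        (((hd₂ p hp).fun_sub (hd₂' p hp)).fun_pow 2)).congr_deriv ?_
      norm_num
      ring).const_mul (1 / 2)
  rw [integral_const_mul] at hD
  refine hD.congr_deriv ?_
  ring

/-- Comparison with the zero flow turns the balance for differences into the energy law of a single
flow. -/
lemma isFlow_zero : IsFlow ν a b (fun _ _ => 0) (fun _ _ => 0) where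
  smooth_fst := contDiffOn_const
  smooth_snd := contDiffOn_const
  contDiffOn _ _ := contDiffOn_const
  velocity _ _ := ⟨by simp [dx, dy], by simp [dx, dy], by simp, by simp, by simp, by simp⟩
  bc _ _ := ⟨by simp, by simp, by simp, by simp [dx]⟩
  vorticity_eq _ _ := ⟨fun _ => 0, fun _ => 0, contDiffOn_const, contDiffOn_const, by simp,
    fun _ _ => hasDerivAt_const _ _, fun _ _ => hasDerivAt_const _ _, by
      intro p _
      have h1 : dx a b (fun _ => (0 : ℝ)) = fun _ => 0 := by funext q; simp [dx]
      have h2 : dy a b (fun _ => (0 : ℝ)) = fun _ => 0 := by funext q; simp [dy]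
      simp only [lap, h1, h2]
      ring⟩

lemma IsFlow.hasDerivAt_kineticEnergy (ha : 0 < a) (hb : 0 < b) (h : IsFlow ν a b ω u)
    (ht : 0 < t) :
    HasDerivAt (fun s => kineticEnergy a b (u s)) (-2 * ν * enstrophy a b (ω t)) t := by
  have := h.hasDerivAt_kineticEnergy_sub ha hb isFlow_zero ht
  simp only [sub_zero, Prod.fst_zero, Prod.snd_zero] at this
  refine this.congr_deriv ?_
  rw [enstrophy, ← integral_const_mul, ← integral_const_mul]
  congr 1
  funext p
  ring

end Flow

/-! ### Energy, enstrophy and palinstrophy laws of a solution -/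

section Solution

variable {ν a b : ℝ} {ω₀ : ℝ × ℝ → ℝ} {ω : ℝ → ℝ × ℝ → ℝ} {u : ℝ → ℝ × ℝ → ℝ × ℝ} {t : ℝ}
  {p : ℝ × ℝ}

lemma IsSolution.smoothCyl (h : IsSolution ν a b ω₀ ω u) (n : ℕ) : SmoothCyl a b n ω :=
  h.smooth_vorticity.of_le (by exact_mod_cast le_top)

lemma IsSolution.smoothCyl_fst (h : IsSolution ν a b ω₀ ω u) (n : ℕ) :
    SmoothCyl a b n (fun t p => (u t p).1) :=
  h.smooth_velocity.fst.of_le (by exact_mod_cast le_top)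

lemma IsSolution.smoothCyl_snd (h : IsSolution ν a b ω₀ ω u) (n : ℕ) :
    SmoothCyl a b n (fun t p => (u t p).2) :=
  h.smooth_velocity.snd.of_le (by exact_mod_cast le_top)

lemma IsSolution.contDiffOn (h : IsSolution ν a b ω₀ ω u) (n : ℕ) (ht : 0 < t) :
    ContDiffOn ℝ n (ω t) (cdom a b) := (h.smoothCyl n).slice ht

lemma IsSolution.contDiffOn_velocity (h : IsSolution ν a b ω₀ ω u) (n : ℕ) (ht : 0 < t) :
    ContDiffOn ℝ n (u t) (cdom a b) :=
  ((h.smoothCyl_fst n).slice ht).prodMk ((h.smoothCyl_snd n).slice ht)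

lemma IsSolution.hasDerivAt (h : IsSolution ν a b ω₀ ω u) (ht : 0 < t) (hp : p ∈ cdom a b) :
    HasDerivAt (fun s => ω s p) (dt a b ω t p) t :=
  (h.smoothCyl 1).hasDerivAt (by norm_num) ht hp

lemma IsSolution.dt_eq (h : IsSolution ν a b ω₀ ω u) (ht : 0 < t) (hp : p ∈ dom a b) :
    dt a b ω t p = ν * lap a b (ω t) p
      - ((u t p).1 * dx a b (ω t) p + (u t p).2 * dy a b (ω t) p) := by
  have := h.pde t ht p hp
  rw [(h.hasDerivAt ht (dom_subset_cdom hp)).deriv] at this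
  linarith

/-- With z = ∂ₜu, interchanging derivatives gives curl z = ∂ₜ curl u = ∂ₜω, and periodicity of z₂
comes from differentiating that of u₂ in time. -/
lemma IsSolution.isFlow (ha : 0 < a) (hb : 0 < b) (h : IsSolution ν a b ω₀ ω u) :
    IsFlow ν a b ω u where
  smooth_fst := h.smoothCyl_fst 1
  smooth_snd := h.smoothCyl_snd 1
  contDiffOn t ht := h.contDiffOn 2 ht
  velocity := h.velocity
  bc := h.bc
  vorticity_eq t ht := by
    have s1 : SmoothCyl a b 2 (fun t p => (u t p).1) := h.smoothCyl_fst 2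
    have s2 : SmoothCyl a b 2 (fun t p => (u t p).2) := h.smoothCyl_snd 2
    have d1 := fun {p} (hp : p ∈ cdom a b) => s1.hasDerivAt (by norm_num) ht hp
    have d2 := fun {p} (hp : p ∈ cdom a b) => s2.hasDerivAt (by norm_num) ht hp
    refine ⟨dt a b (fun t p => (u t p).1) t, dt a b (fun t p => (u t p).2) t,
      (s1.dt ha hb (m := 1) (by norm_num)).slice ht, (s2.dt ha hb (m := 1) (by norm_num)).slice ht,
      fun y hy => ?_, fun p hp => d1 (dom_subset_cdom hp), fun p hp => d2 (dom_subset_cdom hp),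
      fun p hp => ?_⟩
    · refine (d2 ⟨left_mem ha, hy⟩).unique
        ((d2 ⟨right_mem ha, hy⟩).congr_of_eventuallyEq ?_)
      filter_upwards [Ioi_mem_nhds ht] with s hs
      rw [(h.velocity s hs).periodic y hy]
    · have hp' := dom_subset_cdom hp
      rw [← h.dt_eq ht hp]
      have e := (s2.hasDerivAt_dx ha hb ht hp').sub (s1.hasDerivAt_dy ha hb ht hp')
      refine e.unique ((h.hasDerivAt ht hp').congr_of_eventuallyEq ?_)
      filter_upwards [Ioi_mem_nhds ht] with s hs
      exact (h.velocity s hs).curl p hp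

/-- Tested against ω, the diffusion term gives -ν∫|∇ω|² by Green's identity, and the advection term
is half the transport of ω² by a divergence-free field, with integral zero. -/
lemma IsSolution.hasDerivAt_enstrophy (ha : 0 < a) (hb : 0 < b) (h : IsSolution ν a b ω₀ ω u)
    (ht : 0 < t) :
    HasDerivAt (fun s => enstrophy a b (ω s)) (-2 * ν * palinstrophy a b (ω t)) t := by
  have s1 : SmoothCyl a b 1 ω := h.smoothCyl 1
  have s2 : SmoothCyl a b 1 (fun t p => ω t p ^ 2) := ContDiffOn.pow s1 2
  have hD := (s2.hasDerivAt_integral ha hb ht (g := fun p => 2 * (ω t p * dt a b ω t p))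
    fun p hp => by
      refine ((h.hasDerivAt ht (dom_subset_cdom hp)).fun_pow 2).congr_deriv ?_
      norm_num
      ring).const_mul (1 / 2)
  refine hD.congr_deriv ?_
  have hw2 : ContDiffOn ℝ 2 (ω t) (cdom a b) := h.contDiffOn 2 ht
  have hw1 : ContDiffOn ℝ 1 (ω t) (cdom a b) := h.contDiffOn 1 ht
  have hu1 : ContDiffOn ℝ 1 (u t) (cdom a b) := h.contDiffOn_velocity 1 ht
  have hv := h.velocity t ht
  have hbc := h.bc t ht
  have i1 := zeroMean_green ha hb hw1 hw2 hbc.bottom hbc.top hbc.periodic hbc.periodic_dx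
  have i2 := zeroMean_transport ha hb hu1.fst hu1.snd (hw1.mul hw1) hv.div_free hv.bottom hv.top
    hv.periodic_fst (fun y hy => by simp only [hbc.periodic y hy])
  have c0 := hw1.continuousOn
  have c1 := continuousOn_dx ha hb hw1
  have c2 := continuousOn_dy ha hb hw1
  have c3 : ContinuousOn (dt a b ω t) (cdom a b) :=
    ((s1.dt ha hb (m := 0) (by simp)).slice ht).continuousOn
  have e := (((i1.const_mul (2 * ν)).sub i2).congr (g := fun p => 2 * (ω t p * dt a b ω t p)
    - (-(2 * ν) * (dx a b (ω t) p ^ 2 + dy a b (ω t) p ^ 2))) fun p hp => by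
      have hp' := dom_subset_cdom hp
      have d0 := hw1.differentiableOn one_ne_zero
      simp only
      rw [h.dt_eq ht hp, dx_mul ha hb d0 d0 hp', dy_mul ha hb d0 d0 hp']
      ring).integral_eq (by fun_prop) (by fun_prop)
  rw [e, integral_const_mul, palinstrophy]
  ring

lemma IsSolution.hasDerivAt_palinstrophy (ha : 0 < a) (hb : 0 < b) (h : IsSolution ν a b ω₀ ω u)
    (ht : 0 < t) :
    HasDerivAt (fun s => palinstrophy a b (ω s))
      (-∫ p, lap a b (ω t) p * dt a b ω t p ∂(vol a b)) t := by
  have s2 : SmoothCyl a b 2 ω := h.smoothCyl 2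
  have sx := s2.dx ha hb (m := 1) (by norm_num)
  have sy := s2.dy ha hb (m := 1) (by norm_num)
  have st := s2.dt ha hb (m := 1) (by norm_num)
  have s3 : SmoothCyl a b 1 (fun t p => dx a b (ω t) p ^ 2 + dy a b (ω t) p ^ 2) :=
    (ContDiffOn.pow sx 2).add (ContDiffOn.pow sy 2)
  have hD := (s3.hasDerivAt_integral ha hb ht (g := fun p => 2 * (dx a b (ω t) p
      * dx a b (dt a b ω t) p + dy a b (ω t) p * dy a b (dt a b ω t) p))
    fun p hp => by
      have hp' := dom_subset_cdom hp
      refine (((s2.hasDerivAt_dx ha hb ht hp').fun_pow 2).fun_add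
        ((s2.hasDerivAt_dy ha hb ht hp').fun_pow 2)).congr_deriv ?_
      norm_num
      ring).const_mul (1 / 2)
  refine hD.congr_deriv ?_
  have hw2 : ContDiffOn ℝ 2 (ω t) (cdom a b) := h.contDiffOn 2 ht
  have hw1 : ContDiffOn ℝ 1 (ω t) (cdom a b) := h.contDiffOn 1 ht
  have hg : ContDiffOn ℝ 1 (dt a b ω t) (cdom a b) := st.slice ht
  -- The wall and periodicity conditions hold for all positive times, so ∂ₜω inherits them; this
  -- allows Green's identity with ∂ₜω as test function.
  have hwall : ∀ y ∈ Icc 0 (Real.pi / b), (∀ s, 0 < s → ∀ x ∈ Icc 0 (Real.pi / a), ω s (x, y) = 0) →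
      ∀ x ∈ Icc 0 (Real.pi / a), dt a b ω t (x, y) = 0 := by
    intro y hy h0 x hx
    refine (h.hasDerivAt ht ⟨hx, hy⟩).unique
      ((hasDerivAt_const t (0 : ℝ)).congr_of_eventuallyEq ?_)
    filter_upwards [Ioi_mem_nhds ht] with s hs
    exact h0 s hs x hx
  have i1 := zeroMean_green ha hb hg hw2
    (hwall 0 (left_mem hb) fun s hs => (h.bc s hs).bottom)
    (hwall _ (right_mem hb) fun s hs => (h.bc s hs).top)
    (fun y hy => by
      refine (h.hasDerivAt ht ⟨left_mem ha, hy⟩).unique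
        ((h.hasDerivAt ht ⟨right_mem ha, hy⟩).congr_of_eventuallyEq ?_)
      filter_upwards [Ioi_mem_nhds ht] with s hs
      exact (h.bc s hs).periodic y hy) (h.bc t ht).periodic_dx
  have c1 := continuousOn_dx ha hb hw1
  have c2 := continuousOn_dy ha hb hw1
  have c3 := hg.continuousOn
  have c4 := continuousOn_dx ha hb hg
  have c5 := continuousOn_dy ha hb hg
  have c6 : ContinuousOn (lap a b (ω t)) (cdom a b) :=
    (continuousOn_dx ha hb (contDiffOn_dx ha hb hw2 (by norm_num))).add
      (continuousOn_dy ha hb (contDiffOn_dy ha hb hw2 (by norm_num)))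
  have e := (i1.congr (g := fun p => (dx a b (ω t) p * dx a b (dt a b ω t) p
      + dy a b (ω t) p * dy a b (dt a b ω t) p) - -(lap a b (ω t) p * dt a b ω t p))
      fun p hp => by simp only; ring).integral_eq (by fun_prop) (by fun_prop)
  rw [integral_const_mul, e, integral_neg]
  ring

end Solution

/-! ### Classes in L² and the energies as norms -/

section L2

variable {a b : ℝ} {f g : ℝ × ℝ → ℝ}

open Classical in
/-- The class in `L²(Ω)` of a square-integrable function (and `0` for other functions). -/
noncomputable def toL2 (a b : ℝ) (f : ℝ × ℝ → ℝ) : Lp ℝ 2 (vol a b) :=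
  if h : MemLp f 2 (vol a b) then h.toLp f else 0

lemma toL2_eq (hf : MemLp f 2 (vol a b)) : toL2 a b f = hf.toLp f := dif_pos hf

lemma inner_toL2 (hf : MemLp f 2 (vol a b)) (hg : MemLp g 2 (vol a b)) :
    inner ℝ (toL2 a b f) (toL2 a b g) = ∫ p, f p * g p ∂(vol a b) := by
  rw [toL2_eq hf, toL2_eq hg, L2.inner_def]
  refine integral_congr_ae ?_
  filter_upwards [hf.coeFn_toLp, hg.coeFn_toLp] with p h1 h2
  rw [h1, h2]
  simp [mul_comm]

lemma norm_toL2_sq (hf : MemLp f 2 (vol a b)) :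
    ‖toL2 a b f‖ ^ 2 = ∫ p, f p ^ 2 ∂(vol a b) := by
  rw [← real_inner_self_eq_norm_sq, inner_toL2 hf hf]
  simp only [sq]

lemma toL2_sub (hf : MemLp f 2 (vol a b)) (hg : MemLp g 2 (vol a b)) :
    toL2 a b f - toL2 a b g = toL2 a b (fun p => f p - g p) := by
  have hfg : MemLp (fun p => f p - g p) 2 (vol a b) := hf.sub hg
  rw [toL2_eq hf, toL2_eq hg, toL2_eq hfg, ← MemLp.toLp_sub hf hg]
  rfl

lemma norm_toL2_sub (hf : MemLp f 2 (vol a b)) (hg : MemLp g 2 (vol a b)) :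
    ‖toL2 a b f - toL2 a b g‖ = (eLpNorm (fun p => f p - g p) 2 (vol a b)).toReal := by
  have hfg : MemLp (fun p => f p - g p) 2 (vol a b) := hf.sub hg
  rw [toL2_sub hf hg, toL2_eq hfg, Lp.norm_toLp]

lemma toL2_const_mul (hf : MemLp f 2 (vol a b)) (c : ℝ) :
    toL2 a b (fun p => c * f p) = c • toL2 a b f := by
  rw [toL2_eq hf, toL2_eq (hf.const_mul c)]; rfl

lemma toL2_eq_iff (hf : MemLp f 2 (vol a b)) (hg : MemLp g 2 (vol a b)) :
    toL2 a b f = toL2 a b g ↔ f =ᵐ[vol a b] g := by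
  rw [toL2_eq hf, toL2_eq hg, MemLp.toLp_eq_toLp_iff]

lemma toL2_congr (h : f =ᵐ[vol a b] g) : toL2 a b f = toL2 a b g := by
  by_cases hf : MemLp f 2 (vol a b)
  · exact (toL2_eq_iff hf ((memLp_congr_ae h).1 hf)).2 h
  · rw [toL2, toL2, dif_neg hf, dif_neg fun hg => hf ((memLp_congr_ae h).2 hg)]

lemma enstrophy_eq_norm (hf : MemLp f 2 (vol a b)) :
    enstrophy a b f = 1 / 2 * ‖toL2 a b f‖ ^ 2 := by
  rw [norm_toL2_sq hf, enstrophy]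

lemma kineticEnergy_eq_norm {u : ℝ × ℝ → ℝ × ℝ} (h₁ : MemLp (fun p => (u p).1) 2 (vol a b))
    (h₂ : MemLp (fun p => (u p).2) 2 (vol a b)) : kineticEnergy a b u
      = 1 / 2 * (‖toL2 a b (fun p => (u p).1)‖ ^ 2 + ‖toL2 a b (fun p => (u p).2)‖ ^ 2) := by
  rw [norm_toL2_sq h₁, norm_toL2_sq h₂, kineticEnergy,
    integral_add h₁.integrable_sq h₂.integrable_sq]

lemma kineticEnergy_nonneg (u : ℝ × ℝ → ℝ × ℝ) : 0 ≤ kineticEnergy a b u :=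
  mul_nonneg (by norm_num) (integral_nonneg fun _ => by positivity)

lemma enstrophy_nonneg (w : ℝ × ℝ → ℝ) : 0 ≤ enstrophy a b w :=
  mul_nonneg (by norm_num) (integral_nonneg fun _ => sq_nonneg _)

lemma IsVelocity.kineticEnergy_le (ha : 0 < a) (hb : 0 < b) {w : ℝ × ℝ → ℝ}
    {u : ℝ × ℝ → ℝ × ℝ} (h : IsVelocity a b w u)
    (hu : ContDiffOn ℝ 1 u (cdom a b)) (hw : ContinuousOn w (cdom a b)) :
    b ^ 2 * kineticEnergy a b u ≤ enstrophy a b w := by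
  have := h.kinetic_le ha hb hu hw
  rw [kineticEnergy, enstrophy]
  linarith

lemma eq_zero_of_kineticEnergy_eq_zero {u : ℝ × ℝ → ℝ × ℝ} (hu : ContinuousOn u (cdom a b))
    (h : kineticEnergy a b u = 0) : ∀ p ∈ dom a b, u p = 0 := by
  have c1 : ContinuousOn (fun p => (u p).1) (cdom a b) := hu.fst
  have c2 : ContinuousOn (fun p => (u p).2) (cdom a b) := hu.snd
  rw [kineticEnergy] at h
  intro p hp
  have := eq_zero_of_integral_eq_zero (f := fun p => (u p).1 ^ 2 + (u p).2 ^ 2) (by fun_prop)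
    (fun p _ => by positivity) (by linarith) p hp
  have h1 : (u p).1 = 0 := by nlinarith [sq_nonneg (u p).1, sq_nonneg (u p).2]
  have h2 : (u p).2 = 0 := by nlinarith [sq_nonneg (u p).1, sq_nonneg (u p).2]
  exact Prod.ext h1 h2

lemma IsVelocity.eqOn_zero {w : ℝ × ℝ → ℝ} {u : ℝ × ℝ → ℝ × ℝ} (h : IsVelocity a b w u)
    (hu : ContinuousOn u (cdom a b)) (h0 : kineticEnergy a b u = 0) : ∀ p ∈ dom a b, w p = 0 := by
  intro p hp
  have hz := eq_zero_of_kineticEnergy_eq_zero hu h0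
  rw [← h.curl p hp, dx_congr_dom (g := fun _ => 0) (fun q hq => by simp only [hz q hq]; rfl) hp,
    dy_congr_dom (g := fun _ => 0) (fun q hq => by simp only [hz q hq]; rfl) hp]
  simp [dx, dy]

end L2

/-! ### Uniqueness -/

section Uniqueness

variable {ν a b : ℝ} {ω₀ : ℝ × ℝ → ℝ} {ω ω' : ℝ → ℝ × ℝ → ℝ} {u u' : ℝ → ℝ × ℝ → ℝ × ℝ} {t : ℝ}

lemma IsSolution.memLp (h : IsSolution ν a b ω₀ ω u) (ht : 0 < t) : MemLp (ω t) 2 (vol a b) :=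
  memLp_vol (h.contDiffOn 1 ht).continuousOn

lemma IsFlow.memLp (h : IsFlow ν a b ω u) (ht : 0 < t) : MemLp (ω t) 2 (vol a b) :=
  memLp_vol (h.contDiffOn t ht).continuousOn

lemma IsSolution.tendsto_toL2 (h : IsSolution ν a b ω₀ ω u) (hω₀ : MemLp ω₀ 2 (vol a b)) :
    Tendsto (fun t => toL2 a b (ω t)) (𝓝[>] 0) (𝓝 (toL2 a b ω₀)) := by
  rw [tendsto_iff_norm_sub_tendsto_zero]
  have := (ENNReal.tendsto_toReal ENNReal.zero_ne_top).comp h.attained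
  refine this.congr' ?_
  filter_upwards [self_mem_nhdsWithin] with t ht
  rw [norm_toL2_sub (h.memLp ht) hω₀]
  rfl

lemma IsSolution.tendsto_enstrophy (h : IsSolution ν a b ω₀ ω u) (hω₀ : MemLp ω₀ 2 (vol a b)) :
    Tendsto (fun t => enstrophy a b (ω t)) (𝓝[>] 0) (𝓝 (enstrophy a b ω₀)) := by
  rw [enstrophy_eq_norm hω₀]
  refine (((h.tendsto_toL2 hω₀).norm.pow 2).const_mul (1 / 2)).congr' ?_
  filter_upwards [self_mem_nhdsWithin] with t ht
  rw [enstrophy_eq_norm (h.memLp ht)]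

/-- The kinetic energy y of the difference satisfies y' ≤ (C/ν)Py. Since P = -E'/(2ν), the
integrating factor is exp(cE), which has a finite limit at t = 0 although P may blow up there. The
comparison flow may be a Taylor vortex built on an eigenfunction that is only assumed C². -/
lemma IsSolution.eq_of_isFlow (hν : 0 < ν) (ha : 0 < a) (hb : 0 < b)
    (h : IsSolution ν a b ω₀ ω u) (hω₀ : MemLp ω₀ 2 (vol a b)) (h' : IsFlow ν a b ω' u')
    (hlim : Tendsto (fun t => toL2 a b (ω' t)) (𝓝[>] 0) (𝓝 (toL2 a b ω₀))) (ht : 0 < t) :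
    ∀ p ∈ dom a b, ω t p = ω' t p ∧ u t p = u' t p := by
  obtain ⟨C, hC, hsup⟩ := IsVelocity.sq_le ha hb
  have hf := h.isFlow ha hb
  set y : ℝ → ℝ := fun s => kineticEnergy a b (fun p => u s p - u' s p) with hy
  have hy0 : ∀ s, 0 ≤ y s := fun s => kineticEnergy_nonneg _
  have hvel : ∀ {s}, 0 < s → IsVelocity a b (fun p => ω s p - ω' s p) (fun p => u s p - u' s p) :=
    fun hs => (hf.velocity _ hs).sub ha hb (h'.velocity _ hs) (hf.contDiffOn_velocity hs)
      (h'.contDiffOn_velocity hs)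
  have hvc : ∀ {s}, 0 < s → ContDiffOn ℝ 1 (fun p => u s p - u' s p) (cdom a b) :=
    fun hs => (hf.contDiffOn_velocity hs).sub (h'.contDiffOn_velocity hs)
  have hdc : ∀ {s}, 0 < s → ContinuousOn (fun p => ω s p - ω' s p) (cdom a b) :=
    fun hs => (hf.contDiffOn _ hs).continuousOn.sub (h'.contDiffOn _ hs).continuousOn
  have hder : ∀ s, 0 < s → ∃ y', HasDerivAt y y' s ∧
      y' ≤ C / ν * palinstrophy a b (ω s) * y s := by
    intro s hs
    refine ⟨_, hf.hasDerivAt_kineticEnergy_sub ha hb h' hs, ?_⟩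
    have c0 := hdc hs
    have c1 : ContinuousOn (fun p => (u s p).1) (cdom a b) :=
      (hf.contDiffOn_velocity hs).continuousOn.fst
    have c2 : ContinuousOn (fun p => (u s p).2) (cdom a b) :=
      (hf.contDiffOn_velocity hs).continuousOn.snd
    have c1' : ContinuousOn (fun p => (u' s p).1) (cdom a b) :=
      (h'.contDiffOn_velocity hs).continuousOn.fst
    have c2' : ContinuousOn (fun p => (u' s p).2) (cdom a b) :=
      (h'.contDiffOn_velocity hs).continuousOn.snd
    have hle : ∫ p, (-ν * (ω s p - ω' s p) ^ 2 - (ω s p - ω' s p)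
        * ((u s p).1 * ((u s p).2 - (u' s p).2) - (u s p).2 * ((u s p).1 - (u' s p).1)))
        ∂(vol a b) ≤ ∫ p, 1 / (4 * ν) * (C * (2 * palinstrophy a b (ω s)))
          * (((u s p).1 - (u' s p).1) ^ 2 + ((u s p).2 - (u' s p).2) ^ 2) ∂(vol a b) := by
      refine integral_mono_dom (by fun_prop) (by fun_prop) fun p hp => ?_
      have hu := hsup (ω s) (u s) (h.velocity s hs) (h.contDiffOn_velocity 3 hs)
        (h.contDiffOn 1 hs) (h.bc s hs) p (dom_subset_cdom hp)
      rw [show ∫ q, (dx a b (ω s) q ^ 2 + dy a b (ω s) q ^ 2) ∂(vol a b)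
        = 2 * palinstrophy a b (ω s) by rw [palinstrophy]; ring] at hu
      set d := ω s p - ω' s p
      set v₁ := (u s p).1 - (u' s p).1
      set v₂ := (u s p).2 - (u' s p).2
      set m := (u s p).1 * v₂ - (u s p).2 * v₁ with hm
      -- Completing the square: viscosity absorbs the factor d of the nonlinear term.
      have e1 : -ν * d ^ 2 - d * m ≤ 1 / (4 * ν) * m ^ 2 := by
        have : 1 / (4 * ν) * m ^ 2 - (-ν * d ^ 2 - d * m) = ν * (d + m / (2 * ν)) ^ 2 := by
          field_simp
          ring
        have h2 : 0 ≤ ν * (d + m / (2 * ν)) ^ 2 := by positivity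
        linarith
      have e2 : m ^ 2 ≤ ((u s p).1 ^ 2 + (u s p).2 ^ 2) * (v₁ ^ 2 + v₂ ^ 2) := by
        have : ((u s p).1 ^ 2 + (u s p).2 ^ 2) * (v₁ ^ 2 + v₂ ^ 2) - m ^ 2
          = ((u s p).1 * v₁ + (u s p).2 * v₂) ^ 2 := by rw [hm]; ring
        nlinarith [sq_nonneg ((u s p).1 * v₁ + (u s p).2 * v₂)]
      have e3 := e2.trans (mul_le_mul_of_nonneg_right hu (by positivity))
      refine e1.trans ?_
      rw [mul_assoc]
      exact mul_le_mul_of_nonneg_left e3 (by positivity)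
    refine hle.trans_eq ?_
    rw [integral_const_mul, hy]
    simp only [kineticEnergy, Prod.fst_sub, Prod.snd_sub]
    field_simp
    ring
  -- With this choice cE' = -2νcP = -(C/ν)P cancels the growth rate exactly.
  set c := C / (2 * ν ^ 2) with hc
  have hH : ∀ s, 0 < s → ∃ H', HasDerivAt
      (fun r => y r * Real.exp (c * enstrophy a b (ω r))) H' s ∧ H' ≤ 0 := by
    intro s hs
    obtain ⟨y', hy', hle⟩ := hder s hs
    refine ⟨_, hy'.mul (((h.hasDerivAt_enstrophy ha hb hs).const_mul c).exp), ?_⟩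
    have : y' * Real.exp (c * enstrophy a b (ω s)) + y s * (Real.exp (c * enstrophy a b (ω s))
        * (c * (-2 * ν * palinstrophy a b (ω s))))
        = (y' - C / ν * palinstrophy a b (ω s) * y s) * Real.exp (c * enstrophy a b (ω s)) := by
      rw [hc]
      field_simp
      ring
    rw [this]
    exact mul_nonpos_of_nonpos_of_nonneg (by linarith) (Real.exp_pos _).le
  have hanti : AntitoneOn (fun r => y r * Real.exp (c * enstrophy a b (ω r))) (Ioi 0) := by
    choose! H' hd hn using hH
    refine antitoneOn_of_deriv_nonpos (convex_Ioi 0)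
      (fun s hs => (hd s hs).continuousAt.continuousWithinAt) ?_ ?_
    · rw [interior_Ioi]
      exact fun s hs => (hd s hs).differentiableAt.differentiableWithinAt
    · rw [interior_Ioi]
      intro s hs
      rw [(hd s hs).deriv]
      exact hn s hs
  -- The kinetic energy of the difference is at most b⁻² times its enstrophy, and both vorticities
  -- have the same L² limit.
  have hylim : Tendsto y (𝓝[>] 0) (𝓝 0) := by
    have l1 := ((((h.tendsto_toL2 hω₀).sub hlim).norm.pow 2).const_mul (1 / (2 * b ^ 2)))
    rw [sub_self, norm_zero, zero_pow two_ne_zero, mul_zero] at l1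
    refine squeeze_zero' (Eventually.of_forall hy0) ?_ l1
    filter_upwards [self_mem_nhdsWithin] with s hs
    have := (hvel hs).kineticEnergy_le ha hb (hvc hs) (hdc hs)
    have hm : MemLp (fun p => ω s p - ω' s p) 2 (vol a b) := (h.memLp hs).sub (h'.memLp hs)
    rw [toL2_sub (h.memLp hs) (h'.memLp hs), norm_toL2_sq hm]
    rw [enstrophy] at this
    rw [div_mul_eq_mul_div, le_div_iff₀ (by positivity)]
    simp only [hy]
    linarith
  have hHlim : Tendsto (fun r => y r * Real.exp (c * enstrophy a b (ω r))) (𝓝[>] 0) (𝓝 0) := by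
    have := hylim.mul ((h.tendsto_enstrophy hω₀).const_mul c).rexp
    rwa [zero_mul] at this
  have hyt : y t = 0 := by
    have h1 : y t * Real.exp (c * enstrophy a b (ω t)) ≤ 0 := by
      refine ge_of_tendsto hHlim ?_
      filter_upwards [Ioo_mem_nhdsGT ht] with s hs
      exact hanti hs.1 ht hs.2.le
    have h2 := Real.exp_pos (c * enstrophy a b (ω t))
    nlinarith [hy0 t]
  intro p hp
  exact ⟨sub_eq_zero.1 ((hvel ht).eqOn_zero (hvc ht).continuousOn hyt p hp),
    sub_eq_zero.1 (eq_zero_of_kineticEnergy_eq_zero (hvc ht).continuousOn hyt p hp)⟩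

end Uniqueness

/-! ### Attainment of the initial velocity and positivity at time zero -/

section Initial

lemma exists_tendsto_of_dist_le {E F : Type*} [PseudoMetricSpace E] [PseudoMetricSpace F]
    [CompleteSpace F] {W : ℝ → E} {U : ℝ → F} {W₀ : E} {c : ℝ}
    (hW : Tendsto W (𝓝[>] 0) (𝓝 W₀))
    (h : ∀ s t, 0 < s → 0 < t → dist (U s) (U t) ≤ c * dist (W s) (W t)) :
    ∃ U₀, Tendsto U (𝓝[>] 0) (𝓝 U₀) := by
  rw [← cauchy_map_iff_exists_tendsto, cauchy_map_iff', tendsto_uniformity_iff_dist_tendsto_zero]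
  have h1 := tendsto_uniformity_iff_dist_tendsto_zero.1 (cauchy_map_iff'.1 hW.cauchy_map)
  have h2 := h1.const_mul c
  rw [mul_zero] at h2
  refine squeeze_zero' (Eventually.of_forall fun _ => dist_nonneg) ?_ h2
  filter_upwards [prod_mem_prod self_mem_nhdsWithin self_mem_nhdsWithin] with q hq
  exact h _ _ hq.1 hq.2

variable {ν a b : ℝ} {ω₀ : ℝ × ℝ → ℝ} {ω : ℝ → ℝ × ℝ → ℝ} {u : ℝ → ℝ × ℝ → ℝ × ℝ} {t : ℝ}

lemma memLp_cosMode (j k : ℤ) (θ : ℝ) : MemLp (cosMode a b j k θ) 2 (vol a b) :=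
  memLp_vol (contDiff_cosMode (n := 0) j k θ).continuous.continuousOn

lemma memLp_sinMode (j k : ℤ) (θ : ℝ) : MemLp (sinMode a b j k θ) 2 (vol a b) :=
  memLp_vol (contDiff_sinMode (n := 0) j k θ).continuous.continuousOn

/-- Functions in `L²` with the same cosine coefficients agree. -/
lemma toL2_eq_of_cosMode (ha : 0 < a) (hb : 0 < b) {f : Lp ℝ 2 (vol a b)} {g : ℝ × ℝ → ℝ}
    (hg : MemLp g 2 (vol a b))
    (h : ∀ j k θ, inner ℝ f (toL2 a b (cosMode a b j k θ))
      = ∫ p, g p * cosMode a b j k θ p ∂(vol a b)) : f = toL2 a b g := by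
  have hf : toL2 a b f = f := by rw [toL2_eq (Lp.memLp f), Lp.toLp_coeFn]
  have hfg : MemLp (fun p => f p - g p) 2 (vol a b) := (Lp.memLp f).sub hg
  rw [← hf, toL2_eq_iff (Lp.memLp f) hg]
  have := ae_eq_zero_of_cosMode ha hb (hfg.integrable (by norm_num)) fun j k θ => by
    rw [← inner_toL2 hfg (memLp_cosMode j k θ), ← toL2_sub (Lp.memLp f) hg, inner_sub_left, hf, h,
      inner_toL2 hg (memLp_cosMode j k θ), sub_self]
  filter_upwards [this] with p hp
  exact sub_eq_zero.1 hp

/-- Functions in `L²` with the same sine coefficients agree. -/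
lemma toL2_eq_of_sinMode (ha : 0 < a) (hb : 0 < b) {f : Lp ℝ 2 (vol a b)} {g : ℝ × ℝ → ℝ}
    (hg : MemLp g 2 (vol a b))
    (h : ∀ j k θ, inner ℝ f (toL2 a b (sinMode a b j k θ))
      = ∫ p, g p * sinMode a b j k θ p ∂(vol a b)) : f = toL2 a b g := by
  have hf : toL2 a b f = f := by rw [toL2_eq (Lp.memLp f), Lp.toLp_coeFn]
  have hfg : MemLp (fun p => f p - g p) 2 (vol a b) := (Lp.memLp f).sub hg
  rw [← hf, toL2_eq_iff (Lp.memLp f) hg]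
  have := ae_eq_zero_of_sinMode ha hb (hfg.integrable (by norm_num)) fun j k θ => by
    rw [← inner_toL2 hfg (memLp_sinMode j k θ), ← toL2_sub (Lp.memLp f) hg, inner_sub_left, hf, h,
      inner_toL2 hg (memLp_sinMode j k θ), sub_self]
  filter_upwards [this] with p hp
  exact sub_eq_zero.1 hp

lemma cosMode_zero_zero (θ : ℝ) : cosMode a b 0 0 θ = fun _ => Real.cos θ := by
  funext p; simp [cosMode]

lemma sinMode_zero_right (j : ℤ) (θ : ℝ) : sinMode a b j 0 θ = fun _ => 0 := by
  funext p; simp [sinMode]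

lemma sq_add_sq_ne_zero (ha : 0 < a) (hb : 0 < b) {j k : ℤ} (h : ¬ (j = 0 ∧ k = 0)) :
    (2 * a * j) ^ 2 + (b * k) ^ 2 ≠ 0 := by
  rcases eq_or_ne j 0 with rfl | hj
  · have hk : k ≠ 0 := fun hk => h ⟨rfl, hk⟩
    positivity
  · positivity

lemma IsSolution.isWeakVelocity (ha : 0 < a) (hb : 0 < b) (h : IsSolution ν a b ω₀ ω u)
    (ht : 0 < t) : IsWeakVelocity a b (ω t) (u t) :=
  (h.velocity t ht).isWeakVelocity ha hb (h.contDiffOn_velocity 1 ht)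
    (h.contDiffOn 1 ht).continuousOn

/-- The velocity attains its initial value in `L²`. -/
lemma IsSolution.tendsto_toL2_velocity (ha : 0 < a) (hb : 0 < b) (h : IsSolution ν a b ω₀ ω u)
    (hω₀ : MemLp ω₀ 2 (vol a b)) :
    Tendsto (fun t => toL2 a b (fun p => (u t p).1)) (𝓝[>] 0)
        (𝓝 (toL2 a b (fun p => (u 0 p).1))) ∧
      Tendsto (fun t => toL2 a b (fun p => (u t p).2)) (𝓝[>] 0)
        (𝓝 (toL2 a b (fun p => (u 0 p).2))) := by
  have hW := h.tendsto_toL2 hω₀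
  have hi := h.initial_velocity
  have hv := fun {t} (ht : 0 < t) => h.isWeakVelocity ha hb ht
  have hdist : ∀ s t, 0 < s → 0 < t →
      dist (toL2 a b (fun p => (u s p).1)) (toL2 a b (fun p => (u t p).1)) ^ 2
        + dist (toL2 a b (fun p => (u s p).2)) (toL2 a b (fun p => (u t p).2)) ^ 2
        ≤ (1 / b * dist (toL2 a b (ω s)) (toL2 a b (ω t))) ^ 2 := by
    intro s t hs ht
    have us := h.contDiffOn_velocity 1 hs
    have ut := h.contDiffOn_velocity 1 ht
    have m1 : MemLp (fun p => (u s p).1 - (u t p).1) 2 (vol a b) :=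
      (hv hs).memLp_fst.sub (hv ht).memLp_fst
    have m2 : MemLp (fun p => (u s p).2 - (u t p).2) 2 (vol a b) :=
      (hv hs).memLp_snd.sub (hv ht).memLp_snd
    have m3 : MemLp (fun p => ω s p - ω t p) 2 (vol a b) := (h.memLp hs).sub (h.memLp ht)
    have := ((h.velocity s hs).sub ha hb (h.velocity t ht) us ut).kinetic_le ha hb (us.sub ut)
      ((h.contDiffOn 1 hs).continuousOn.sub (h.contDiffOn 1 ht).continuousOn)
    simp only [Prod.fst_sub, Prod.snd_sub] at this
    rw [integral_add m1.integrable_sq m2.integrable_sq, ← norm_toL2_sq m1, ← norm_toL2_sq m2,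
      ← norm_toL2_sq m3, ← toL2_sub (hv hs).memLp_fst (hv ht).memLp_fst,
      ← toL2_sub (hv hs).memLp_snd (hv ht).memLp_snd, ← toL2_sub (h.memLp hs) (h.memLp ht),
      ← dist_eq_norm, ← dist_eq_norm, ← dist_eq_norm] at this
    rw [mul_pow, div_pow, one_pow, div_mul_eq_mul_div, one_mul, le_div_iff₀ (by positivity)]
    linarith
  -- The velocity is a Lipschitz function of the vorticity in L², so it is Cauchy as t → 0. Its
  -- limit is identified below by its Fourier coefficients.
  obtain ⟨U₁, hU₁⟩ := exists_tendsto_of_dist_le (U := fun t => toL2 a b (fun p => (u t p).1)) hW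
    (c := 1 / b) fun s t hs ht => abs_le_of_sq_le_sq' (by
      nlinarith [hdist s t hs ht, sq_nonneg (dist (toL2 a b (fun p => (u s p).2))
        (toL2 a b (fun p => (u t p).2)))]) (by positivity) |>.2
  obtain ⟨U₂, hU₂⟩ := exists_tendsto_of_dist_le (U := fun t => toL2 a b (fun p => (u t p).2)) hW
    (c := 1 / b) fun s t hs ht => abs_le_of_sq_le_sq' (by
      nlinarith [hdist s t hs ht, sq_nonneg (dist (toL2 a b (fun p => (u s p).1))
        (toL2 a b (fun p => (u t p).1)))]) (by positivity) |>.2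
  have hlimW : ∀ j k θ, Tendsto (fun t => ∫ p, ω t p * sinMode a b j k θ p ∂(vol a b)) (𝓝[>] 0)
      (𝓝 (∫ p, ω₀ p * sinMode a b j k θ p ∂(vol a b))) := by
    intro j k θ
    rw [← inner_toL2 hω₀ (memLp_sinMode j k θ)]
    refine (hW.inner tendsto_const_nhds).congr' ?_
    filter_upwards [self_mem_nhdsWithin] with t ht
    rw [inner_toL2 (h.memLp ht) (memLp_sinMode j k θ)]
  have hlim₁ : ∀ j k θ, Tendsto (fun t => ∫ p, (u t p).1 * cosMode a b j k θ p ∂(vol a b)) (𝓝[>] 0)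
      (𝓝 (inner ℝ U₁ (toL2 a b (cosMode a b j k θ)))) := by
    intro j k θ
    refine (hU₁.inner tendsto_const_nhds).congr' ?_
    filter_upwards [self_mem_nhdsWithin] with t ht
    rw [inner_toL2 (hv ht).memLp_fst (memLp_cosMode j k θ)]
  have hlim₂ : ∀ j k θ, Tendsto (fun t => ∫ p, (u t p).2 * sinMode a b j k θ p ∂(vol a b)) (𝓝[>] 0)
      (𝓝 (inner ℝ U₂ (toL2 a b (sinMode a b j k θ)))) := by
    intro j k θ
    refine (hU₂.inner tendsto_const_nhds).congr' ?_
    filter_upwards [self_mem_nhdsWithin] with t ht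
    rw [inner_toL2 (hv ht).memLp_snd (memLp_sinMode j k θ)]
  -- The constant mode is invisible to divergence and curl; it is fixed by the absence of a mean
  -- flow. All other coefficients are determined by those of the vorticity.
  have e₁ : U₁ = toL2 a b (fun p => (u 0 p).1) := by
    refine toL2_eq_of_cosMode ha hb hi.memLp_fst fun j k θ => ?_
    by_cases h0 : j = 0 ∧ k = 0
    · obtain ⟨rfl, rfl⟩ := h0
      have hl := hlim₁ 0 0 θ
      simp only [cosMode_zero_zero, integral_mul_const] at hl ⊢
      rw [hi.mean_zero, zero_mul]
      refine tendsto_nhds_unique hl (tendsto_const_nhds.congr' ?_)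
      filter_upwards [self_mem_nhdsWithin] with t ht
      rw [(hv ht).mean_zero, zero_mul]
    · refine mul_left_cancel₀ (sq_add_sq_ne_zero ha hb h0) ?_
      rw [(hi.integral_modes ha hb j k θ).1]
      refine tendsto_nhds_unique ((hlim₁ j k θ).const_mul _) (((hlimW j k θ).const_mul _).congr' ?_)
      filter_upwards [self_mem_nhdsWithin] with t ht
      rw [((hv ht).integral_modes ha hb j k θ).1]
  have e₂ : U₂ = toL2 a b (fun p => (u 0 p).2) := by
    refine toL2_eq_of_sinMode ha hb hi.memLp_snd fun j k θ => ?_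
    rcases eq_or_ne k 0 with rfl | hk
    · have hl := hlim₂ j 0 θ
      simp only [sinMode_zero_right, mul_zero, integral_zero] at hl ⊢
      exact tendsto_nhds_unique hl tendsto_const_nhds
    · refine mul_left_cancel₀ (sq_add_sq_ne_zero ha hb fun h0 : j = 0 ∧ k = 0 => hk h0.2) ?_
      -- `IsWeakVelocity.integral_modes` gives the coefficient of u₂ with the phase shifted by π/2;
      -- since phases are arbitrary, this covers every θ.
      obtain ⟨θ', rfl⟩ : ∃ θ', θ = θ' + Real.pi / 2 := ⟨θ - Real.pi / 2, by ring⟩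
      rw [(hi.integral_modes ha hb j k θ').2]
      refine tendsto_nhds_unique ((hlim₂ j k _).const_mul _)
        (((hlimW j k θ').const_mul _).congr' ?_)
      filter_upwards [self_mem_nhdsWithin] with t ht
      rw [((hv ht).integral_modes ha hb j k θ').2]
  exact ⟨e₁ ▸ hU₁, e₂ ▸ hU₂⟩

lemma IsSolution.tendsto_kineticEnergy (ha : 0 < a) (hb : 0 < b) (h : IsSolution ν a b ω₀ ω u)
    (hω₀ : MemLp ω₀ 2 (vol a b)) :
    Tendsto (fun t => kineticEnergy a b (u t)) (𝓝[>] 0) (𝓝 (kineticEnergy a b (u 0))) := by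
  obtain ⟨h1, h2⟩ := h.tendsto_toL2_velocity ha hb hω₀
  rw [kineticEnergy_eq_norm h.initial_velocity.memLp_fst h.initial_velocity.memLp_snd]
  refine (((h1.norm.pow 2).add (h2.norm.pow 2)).const_mul (1 / 2)).congr' ?_
  filter_upwards [self_mem_nhdsWithin] with t ht
  have hv := h.isWeakVelocity ha hb ht
  rw [kineticEnergy_eq_norm hv.memLp_fst hv.memLp_snd]

lemma enstrophy_pos {w : ℝ × ℝ → ℝ} (hw : MemLp w 2 (vol a b)) (hne : ¬ w =ᵐ[vol a b] 0) :
    0 < enstrophy a b w := by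
  refine lt_of_le_of_ne (enstrophy_nonneg w) fun h => hne ?_
  rw [enstrophy, eq_comm, mul_eq_zero, or_iff_right (by norm_num),
    integral_eq_zero_iff_of_nonneg (fun _ => sq_nonneg _) hw.integrable_sq] at h
  filter_upwards [h] with p hp
  simpa using hp

/-- If u₁ = 0 almost everywhere, each sine coefficient of the vorticity with k ≠ 0 vanishes, as it
is a multiple of a coefficient of u₁. The sine modes with k = 0 are zero, so the vorticity vanishes.
-/
lemma IsWeakVelocity.kineticEnergy_pos (ha : 0 < a) (hb : 0 < b) {w : ℝ × ℝ → ℝ}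
    {v : ℝ × ℝ → ℝ × ℝ} (h : IsWeakVelocity a b w v) (hw : MemLp w 2 (vol a b))
    (hne : ¬ w =ᵐ[vol a b] 0) : 0 < kineticEnergy a b v := by
  refine lt_of_le_of_ne (kineticEnergy_nonneg v) fun h0 => hne ?_
  have hint : Integrable (fun p => (v p).1 ^ 2 + (v p).2 ^ 2) (vol a b) :=
    h.memLp_fst.integrable_sq.add h.memLp_snd.integrable_sq
  rw [kineticEnergy, eq_comm, mul_eq_zero, or_iff_right (by norm_num),
    integral_eq_zero_iff_of_nonneg (fun _ => by simp only [Pi.zero_apply]; positivity) hint] at h0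
  have hv1 : ∀ᵐ p ∂(vol a b), (v p).1 = 0 := by
    filter_upwards [h0] with p hp
    have hp : (v p).1 ^ 2 + (v p).2 ^ 2 = 0 := hp
    nlinarith [sq_nonneg (v p).1, sq_nonneg (v p).2]
  refine ae_eq_zero_of_sinMode ha hb (hw.integrable (by norm_num)) fun j k θ => ?_
  rcases eq_or_ne k 0 with rfl | hk
  · simp [sinMode_zero_right]
  have h1 := (h.integral_modes ha hb j k θ).1
  have h2 : ∫ p, (v p).1 * cosMode a b j k θ p ∂(vol a b) = 0 := by
    refine integral_eq_zero_of_ae ?_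
    filter_upwards [hv1] with p hp
    simp [hp]
  rw [h2, mul_zero, eq_comm, mul_eq_zero] at h1
  exact h1.resolve_left (by positivity)

end Initial

/-! ### Taylor vortices -/

section TaylorVortex

variable {ν a b l : ℝ} {w : ℝ × ℝ → ℝ}

/-- The velocity field of an eigenfunction. -/
noncomputable def eigenVelocity (a b l : ℝ) (w : ℝ × ℝ → ℝ) (p : ℝ × ℝ) : ℝ × ℝ :=
  (l⁻¹ * dy a b w p, -l⁻¹ * dx a b w p)

lemma contDiffOn_eigenVelocity (ha : 0 < a) (hb : 0 < b) (hw : ContDiffOn ℝ 2 w (cdom a b)) :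
    ContDiffOn ℝ 1 (eigenVelocity a b l w) (cdom a b) :=
  (contDiffOn_const.mul (contDiffOn_dy ha hb hw (by norm_num))).prodMk
    (contDiffOn_const.mul (contDiffOn_dx ha hb hw (by norm_num)))

lemma isVelocity_eigenVelocity (ha : 0 < a) (hb : 0 < b) (hl : l ≠ 0)
    (hw : w ∈ eigenspace a b l) : IsVelocity a b w (eigenVelocity a b l w) := by
  obtain ⟨hw2, hbc, heq⟩ := hw
  have hw1 : ContDiffOn ℝ 1 w (cdom a b) := hw2.of_le (by norm_num)
  have dw := hw1.differentiableOn one_ne_zero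
  have dwx := (contDiffOn_dx ha hb hw2 (m := 1) (by norm_num)).differentiableOn one_ne_zero
  have dwy := (contDiffOn_dy ha hb hw2 (m := 1) (by norm_num)).differentiableOn one_ne_zero
  constructor
  · intro p hp
    have hp' := dom_subset_cdom hp
    simp only [eigenVelocity]
    rw [dx_const_mul ha hb hp' dwy, dy_const_mul ha hb hp' dwx, dx_dy_comm ha hb hw2 hp']
    ring
  · intro p hp
    have hp' := dom_subset_cdom hp
    have := heq p hp
    simp only [eigenVelocity]
    rw [dx_const_mul ha hb hp' dwx, dy_const_mul ha hb hp' dwy]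
    rw [lap] at this
    field_simp
    linarith
  · intro x hx
    simp only [eigenVelocity, dx_eq_zero_of_wall ha dw (left_mem hb) hbc.bottom x hx, mul_zero]
  · intro x hx
    simp only [eigenVelocity, dx_eq_zero_of_wall ha dw (right_mem hb) hbc.top x hx, mul_zero]
  · intro y hy
    simp only [eigenVelocity, hbc.periodic_dx y hy, dy_periodic ha hb dw hbc.periodic y hy]
  · have := (zeroMean_div ha hb (f := fun _ => 0) contDiffOn_const hw1 (fun _ _ => rfl)
      (fun x hx => by rw [hbc.bottom x hx, hbc.top x hx])).2
    simp only [eigenVelocity]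
    rw [integral_const_mul, mul_eq_zero]
    right
    rw [← this]
    simp [dx]

lemma IsVelocity.const_mul (ha : 0 < a) (hb : 0 < b) {u : ℝ × ℝ → ℝ × ℝ} (h : IsVelocity a b w u)
    (hu : ContDiffOn ℝ 1 u (cdom a b)) (c : ℝ) :
    IsVelocity a b (fun p => c * w p) (fun p => (c * (u p).1, c * (u p).2)) := by
  have d1 : DifferentiableOn ℝ (fun z => (u z).1) (cdom a b) := hu.fst.differentiableOn one_ne_zero
  have d2 : DifferentiableOn ℝ (fun z => (u z).2) (cdom a b) := hu.snd.differentiableOn one_ne_zero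
  constructor
  · intro p hp
    have hp' := dom_subset_cdom hp
    simp only
    rw [dx_const_mul ha hb hp' d1, dy_const_mul ha hb hp' d2]
    linear_combination c * h.div_free p hp
  · intro p hp
    have hp' := dom_subset_cdom hp
    simp only
    rw [dx_const_mul ha hb hp' d2, dy_const_mul ha hb hp' d1]
    linear_combination c * h.curl p hp
  · intro x hx
    simp only [h.bottom x hx, mul_zero]
  · intro x hx
    simp only [h.top x hx, mul_zero]
  · intro y hy
    simp only [h.periodic y hy]
  · simp only
    rw [integral_const_mul, h.mean_zero, mul_zero]

lemma contDiffOn_exp_mul {n : WithTop ℕ∞} {f : ℝ × ℝ → ℝ} (hf : ContDiffOn ℝ n f (cdom a b))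
    (c : ℝ) : SmoothCyl a b n (fun t p => Real.exp (c * t) * f p) :=
  ContDiffOn.mul (by fun_prop) (hf.comp contDiffOn_snd fun _ hq => hq.2)

/-- The stream function of an eigenfunction is -w/l, so the velocity is tangent to the level lines
of w and the advection term vanishes. The equation reduces to the heat equation. -/
lemma isFlow_taylor (ha : 0 < a) (hb : 0 < b) (hl : l ≠ 0) (hw : w ∈ eigenspace a b l) :
    IsFlow ν a b (fun t p => Real.exp (-ν * l * t) * w p)
      (fun t p => (Real.exp (-ν * l * t) * (eigenVelocity a b l w p).1,
        Real.exp (-ν * l * t) * (eigenVelocity a b l w p).2)) := by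
  have hvel := isVelocity_eigenVelocity ha hb hl hw
  obtain ⟨hw2, hbc, heq⟩ := hw
  have hV := contDiffOn_eigenVelocity (l := l) ha hb hw2
  have dw := hw2.differentiableOn (by norm_num : (2 : WithTop ℕ∞) ≠ 0)
  have hexp : ∀ c t : ℝ, HasDerivAt (fun s => Real.exp (-ν * l * s) * c)
      (-ν * l * Real.exp (-ν * l * t) * c) t := fun c t =>
    ((((hasDerivAt_id t).const_mul (-ν * l)).exp).mul_const c).congr_deriv (by simp only [id]; ring)
  refine ⟨contDiffOn_exp_mul hV.fst _, contDiffOn_exp_mul hV.snd _,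
    fun t _ => contDiffOn_const.mul hw2, fun t _ => hvel.const_mul ha hb hV _,
    fun t _ => hbc.const_mul ha hb dw _, fun t _ =>
      ⟨fun p => -ν * l * Real.exp (-ν * l * t) * (eigenVelocity a b l w p).1,
      fun p => -ν * l * Real.exp (-ν * l * t) * (eigenVelocity a b l w p).2,
      contDiffOn_const.mul hV.fst, contDiffOn_const.mul hV.snd, fun y hy => ?_,
      fun p _ => hexp _ t, fun p _ => hexp _ t, fun p hp => ?_⟩⟩
  · simp only [hvel.periodic y hy]
  · have hp' := dom_subset_cdom hp
    rw [dx_const_mul ha hb hp' (hV.snd.differentiableOn one_ne_zero),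
      dy_const_mul ha hb hp' (hV.fst.differentiableOn one_ne_zero), lap_const_mul ha hb hw2 hp',
      dx_const_mul ha hb hp' dw, dy_const_mul ha hb hp' dw]
    simp only [eigenVelocity]
    have h1 := hvel.curl p hp
    simp only [eigenVelocity] at h1
    linear_combination -ν * l * Real.exp (-ν * l * t) * h1
      + ν * Real.exp (-ν * l * t) * heq p hp

lemma tendsto_exp_mul_toL2 (hw : MemLp w 2 (vol a b)) (c : ℝ) :
    Tendsto (fun t => toL2 a b (fun p => Real.exp (c * t) * w p)) (𝓝[>] 0) (𝓝 (toL2 a b w)) := by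
  simp only [toL2_const_mul hw]
  have : Tendsto (fun t : ℝ => Real.exp (c * t)) (𝓝[>] 0) (𝓝 1) := by
    refine tendsto_nhdsWithin_of_tendsto_nhds ?_
    have : Continuous fun t : ℝ => Real.exp (c * t) := by fun_prop
    simpa using this.tendsto 0
  simpa using this.smul_const (toL2 a b w)

end TaylorVortex

/-! ### The quotients Q and Λ -/

section Quotients

variable {ν a b : ℝ} {ω₀ : ℝ × ℝ → ℝ} {ω : ℝ → ℝ × ℝ → ℝ} {u : ℝ → ℝ × ℝ → ℝ × ℝ} {t : ℝ}

/-- The cross term is ∫(v₁ ∂_y w - v₂ ∂ₓw) = ∫w² after integration by parts. Nonnegativity for all c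
is the inequality E² ≤ KP, and a zero defect will force w to be an eigenfunction for c. -/
lemma IsVelocity.integral_defect_eq (ha : 0 < a) (hb : 0 < b) {w : ℝ × ℝ → ℝ}
    {v : ℝ × ℝ → ℝ × ℝ} (h : IsVelocity a b w v) (hv : ContDiffOn ℝ 1 v (cdom a b))
    (hw : ContDiffOn ℝ 1 w (cdom a b)) (hbc : MixedBC a b w) (c : ℝ) :
    ∫ p, ((dy a b w p - c * (v p).1) ^ 2 + (dx a b w p + c * (v p).2) ^ 2) ∂(vol a b)
      = 2 * (palinstrophy a b w - 2 * c * enstrophy a b w + c ^ 2 * kineticEnergy a b v) := by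
  have c1 : ContinuousOn (fun z => (v z).1) (cdom a b) := hv.fst.continuousOn
  have c2 : ContinuousOn (fun z => (v z).2) (cdom a b) := hv.snd.continuousOn
  have c3 := continuousOn_dx ha hb hw
  have c4 := continuousOn_dy ha hb hw
  have e1 := h.integral_mul_eq ha hb hv hw.continuousOn hw hbc.bottom hbc.top hbc.periodic
  have e2 : ∀ p, (dy a b w p - c * (v p).1) ^ 2 + (dx a b w p + c * (v p).2) ^ 2
      = (dx a b w p ^ 2 + dy a b w p ^ 2)
        - 2 * c * ((v p).1 * dy a b w p - (v p).2 * dx a b w p)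
        + c ^ 2 * ((v p).1 ^ 2 + (v p).2 ^ 2) := fun p => by ring
  simp only [e2]
  rw [integral_add (integrable_vol (by fun_prop)) (integrable_vol (by fun_prop)),
    integral_sub (integrable_vol (by fun_prop)) (integrable_vol (by fun_prop)),
    integral_const_mul, integral_const_mul, ← e1, palinstrophy, enstrophy, kineticEnergy]
  simp only [← sq]
  ring

lemma IsVelocity.defect_nonneg (ha : 0 < a) (hb : 0 < b) {w : ℝ × ℝ → ℝ}
    {v : ℝ × ℝ → ℝ × ℝ} (h : IsVelocity a b w v) (hv : ContDiffOn ℝ 1 v (cdom a b))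
    (hw : ContDiffOn ℝ 1 w (cdom a b)) (hbc : MixedBC a b w) (c : ℝ) :
    0 ≤ palinstrophy a b w - 2 * c * enstrophy a b w + c ^ 2 * kineticEnergy a b v := by
  have := h.integral_defect_eq ha hb hv hw hbc c
  have h2 : 0 ≤ ∫ p, ((dy a b w p - c * (v p).1) ^ 2 + (dx a b w p + c * (v p).2) ^ 2) ∂(vol a b) :=
    integral_nonneg fun _ => by positivity
  linarith

lemma IsSolution.defect_nonneg (ha : 0 < a) (hb : 0 < b) (h : IsSolution ν a b ω₀ ω u)
    (ht : 0 < t) (c : ℝ) :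
    0 ≤ palinstrophy a b (ω t) - 2 * c * enstrophy a b (ω t) + c ^ 2 * kineticEnergy a b (u t) :=
  (h.velocity t ht).defect_nonneg ha hb (h.contDiffOn_velocity 1 ht) (h.contDiffOn 1 ht)
    (h.bc t ht) c

lemma IsSolution.kineticEnergy_le (ha : 0 < a) (hb : 0 < b) (h : IsSolution ν a b ω₀ ω u)
    (ht : 0 < t) : b ^ 2 * kineticEnergy a b (u t) ≤ enstrophy a b (ω t) :=
  (h.velocity t ht).kineticEnergy_le ha hb (h.contDiffOn_velocity 1 ht)
    (h.contDiffOn 1 ht).continuousOn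

lemma IsSolution.enstrophy_le (ha : 0 < a) (hb : 0 < b) (h : IsSolution ν a b ω₀ ω u)
    (ht : 0 < t) : b ^ 2 * enstrophy a b (ω t) ≤ palinstrophy a b (ω t) := by
  have hw : ContDiffOn ℝ 1 (ω t) (cdom a b) := h.contDiffOn 1 ht
  have c3 := continuousOn_dx ha hb hw
  have c4 := continuousOn_dy ha hb hw
  have h1 := wirtinger ha hb hw (h.bc t ht).bottom (h.bc t ht).top
  have h2 : ∫ p, dy a b (ω t) p ^ 2 ∂(vol a b)
      ≤ ∫ p, (dx a b (ω t) p ^ 2 + dy a b (ω t) p ^ 2) ∂(vol a b) :=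
    integral_mono_dom (by fun_prop) (by fun_prop) fun p _ => le_add_of_nonneg_left (sq_nonneg _)
  rw [enstrophy, palinstrophy]
  linarith

lemma monotoneOn_of_hasDerivAt_nonneg {f : ℝ → ℝ} {s : ℝ}
    (h : ∀ r, s < r → ∃ f', HasDerivAt f f' r ∧ 0 ≤ f') : MonotoneOn f (Ioi s) := by
  choose! f' hd hn using h
  refine monotoneOn_of_deriv_nonneg (convex_Ioi s)
    (fun r hr => (hd r hr).continuousAt.continuousWithinAt) ?_ ?_
  · rw [interior_Ioi]
    exact fun r hr => (hd r hr).differentiableAt.differentiableWithinAt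
  · rw [interior_Ioi]
    intro r hr
    rw [(hd r hr).deriv]
    exact hn r hr

lemma antitoneOn_of_hasDerivAt_nonpos {f : ℝ → ℝ} {s : ℝ}
    (h : ∀ r, s < r → ∃ f', HasDerivAt f f' r ∧ f' ≤ 0) : AntitoneOn f (Ioi s) := by
  have := monotoneOn_of_hasDerivAt_nonneg (f := fun r => - f r) (s := s) fun r hr => by
    obtain ⟨f', hd, hn⟩ := h r hr
    exact ⟨-f', hd.neg, by linarith⟩
  exact fun x hx y hy hxy => neg_le_neg_iff.1 (this hx hy hxy)

/-- Kinetic energy cannot vanish in finite time (backward uniqueness of the zero solution). -/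
lemma IsSolution.kineticEnergy_pos_of_lt (ha : 0 < a) (hb : 0 < b) (hν : 0 < ν)
    (h : IsSolution ν a b ω₀ ω u) {s : ℝ} (hs : 0 < s) (hK : 0 < kineticEnergy a b (u s))
    (hst : s ≤ t) : 0 < kineticEnergy a b (u t) := by
  -- For the value c of the quotient at time s, (E - cK)exp(2νcr) has derivative -2ν(P - 2cE +
  -- c²K)exp(2νcr) ≤ 0. So E ≤ cK from s on, which is the monotonicity of Q without dividing by K.
  set c := enstrophy a b (ω s) / kineticEnergy a b (u s) with hc
  have hc0 : 0 ≤ c := div_nonneg (enstrophy_nonneg _) hK.le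
  have hexp : ∀ r, HasDerivAt (fun r => Real.exp (2 * ν * c * r))
      (2 * ν * c * Real.exp (2 * ν * c * r)) r := fun r =>
    (((hasDerivAt_id r).const_mul (2 * ν * c)).exp).congr_deriv (by simp; ring)
  have h1 := antitoneOn_of_hasDerivAt_nonpos
    (f := fun r => (enstrophy a b (ω r) - c * kineticEnergy a b (u r)) * Real.exp (2 * ν * c * r))
    (s := 0) fun r hr => by
      refine ⟨_, ((h.hasDerivAt_enstrophy ha hb hr).sub
        (((h.isFlow ha hb).hasDerivAt_kineticEnergy ha hb hr).const_mul c)).mul (hexp r), ?_⟩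
      have := mul_nonneg (mul_nonneg hν.le (h.defect_nonneg ha hb hr c))
        (Real.exp_pos (2 * ν * c * r)).le
      simp only [Pi.sub_apply]
      linarith
  have h2 : ∀ r, s ≤ r → enstrophy a b (ω r) ≤ c * kineticEnergy a b (u r) := by
    intro r hr
    have := h1 (show (0 : ℝ) < s from hs) (show (0 : ℝ) < r from hs.trans_le hr) hr
    simp only at this
    rw [show enstrophy a b (ω s) - c * kineticEnergy a b (u s) = 0 by rw [hc]; field_simp; ring,
      zero_mul] at this
    have h3 := Real.exp_pos (2 * ν * c * r)
    by_contra! hcon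
    nlinarith
  -- Now K' = -2νE ≥ -2νcK, so K decays at most exponentially.
  have h3 := monotoneOn_of_hasDerivAt_nonneg
    (f := fun r => kineticEnergy a b (u r) * Real.exp (2 * ν * c * r)) (s := s) fun r hr => by
      refine ⟨_, ((h.isFlow ha hb).hasDerivAt_kineticEnergy ha hb (hs.trans hr)).mul (hexp r), ?_⟩
      have := mul_nonneg (mul_nonneg hν.le (sub_nonneg.2 (h2 r hr.le)))
        (Real.exp_pos (2 * ν * c * r)).le
      linarith
  have hcont : ∀ r, 0 < r → ContinuousAt
      (fun r => kineticEnergy a b (u r) * Real.exp (2 * ν * c * r)) r := fun r hr =>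
    (((h.isFlow ha hb).hasDerivAt_kineticEnergy ha hb hr).mul (hexp r)).continuousAt
  rcases hst.eq_or_lt with rfl | hst
  · exact hK
  have h4 : kineticEnergy a b (u s) * Real.exp (2 * ν * c * s)
      ≤ kineticEnergy a b (u t) * Real.exp (2 * ν * c * t) := by
    -- Monotonicity is known on the open half-line; the left endpoint is reached by continuity.
    refine le_of_tendsto ((hcont s hs).tendsto.mono_left nhdsWithin_le_nhds :
      Tendsto _ (𝓝[>] s) _) ?_
    filter_upwards [Ioo_mem_nhdsGT hst] with r hr
    exact h3 hr.1 hst hr.2.le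
  exact pos_of_mul_pos_left (lt_of_lt_of_le (by positivity) h4) (Real.exp_pos _).le

lemma IsSolution.kineticEnergy_pos (ha : 0 < a) (hb : 0 < b) (hν : 0 < ν)
    (h : IsSolution ν a b ω₀ ω u) (hω₀ : MemLp ω₀ 2 (vol a b)) (hne : ¬ ω₀ =ᵐ[vol a b] 0)
    (ht : 0 < t) : 0 < kineticEnergy a b (u t) := by
  have h1 : ∀ᶠ s in 𝓝[>] (0 : ℝ), 0 < kineticEnergy a b (u s) :=
    (h.tendsto_kineticEnergy ha hb hω₀).eventually
      (lt_mem_nhds (h.initial_velocity.kineticEnergy_pos ha hb hω₀ hne))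
  obtain ⟨s, hs1, hs2⟩ := (h1.and (Ioo_mem_nhdsGT ht)).exists
  exact h.kineticEnergy_pos_of_lt ha hb hν hs2.1 hs1 hs2.2.le

lemma IsSolution.enstrophy_pos (ha : 0 < a) (hb : 0 < b) (hν : 0 < ν)
    (h : IsSolution ν a b ω₀ ω u) (hω₀ : MemLp ω₀ 2 (vol a b)) (hne : ¬ ω₀ =ᵐ[vol a b] 0)
    (ht : 0 < t) : 0 < enstrophy a b (ω t) :=
  lt_of_lt_of_le (mul_pos (by positivity) (h.kineticEnergy_pos ha hb hν hω₀ hne ht))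
    (h.kineticEnergy_le ha hb ht)

lemma IsSolution.hasDerivAt_Q (ha : 0 < a) (hb : 0 < b) (hν : 0 < ν)
    (h : IsSolution ν a b ω₀ ω u) (hω₀ : MemLp ω₀ 2 (vol a b)) (hne : ¬ ω₀ =ᵐ[vol a b] 0)
    (ht : 0 < t) :
    HasDerivAt (fun s => Q a b (ω s) (u s))
      (-2 * ν * Q a b (ω t) (u t) * (Lam a b (ω t) - Q a b (ω t) (u t))) t := by
  have hK := h.kineticEnergy_pos ha hb hν hω₀ hne ht
  have hE := h.enstrophy_pos ha hb hν hω₀ hne ht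
  refine ((h.hasDerivAt_enstrophy ha hb ht).fun_div
    ((h.isFlow ha hb).hasDerivAt_kineticEnergy ha hb ht) hK.ne').congr_deriv ?_
  rw [Q, Lam]
  field_simp
  ring

/-- The value c = E/K minimizes the quadratic P - 2cE + c²K, and its minimum P - E²/K is
nonnegative. -/
lemma IsSolution.Q_le_Lam (ha : 0 < a) (hb : 0 < b) (hν : 0 < ν)
    (h : IsSolution ν a b ω₀ ω u) (hω₀ : MemLp ω₀ 2 (vol a b)) (hne : ¬ ω₀ =ᵐ[vol a b] 0)
    (ht : 0 < t) : Q a b (ω t) (u t) ≤ Lam a b (ω t) := by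
  have hK := h.kineticEnergy_pos ha hb hν hω₀ hne ht
  have hE := h.enstrophy_pos ha hb hν hω₀ hne ht
  have := h.defect_nonneg ha hb ht (enstrophy a b (ω t) / kineticEnergy a b (u t))
  rw [Q, Lam, div_le_div_iff₀ hK hE]
  have e : palinstrophy a b (ω t) - 2 * (enstrophy a b (ω t) / kineticEnergy a b (u t))
      * enstrophy a b (ω t) + (enstrophy a b (ω t) / kineticEnergy a b (u t)) ^ 2
      * kineticEnergy a b (u t) = (palinstrophy a b (ω t) * kineticEnergy a b (u t)
        - enstrophy a b (ω t) * enstrophy a b (ω t)) / kineticEnergy a b (u t) := by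
    field_simp
    ring
  rw [e] at this
  have h2 := (div_nonneg_iff.1 this).resolve_right fun h3 => absurd h3.2 (not_le.2 hK)
  linarith [h2.1]

lemma IsSolution.sq_le_Q (ha : 0 < a) (hb : 0 < b) (hν : 0 < ν)
    (h : IsSolution ν a b ω₀ ω u) (hω₀ : MemLp ω₀ 2 (vol a b)) (hne : ¬ ω₀ =ᵐ[vol a b] 0)
    (ht : 0 < t) : b ^ 2 ≤ Q a b (ω t) (u t) := by
  rw [Q, le_div_iff₀ (h.kineticEnergy_pos ha hb hν hω₀ hne ht)]
  exact h.kineticEnergy_le ha hb ht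

end Quotients

/-! ### Long-time limits and the case of equality -/

section Limits

variable {ν a b : ℝ} {ω₀ : ℝ × ℝ → ℝ} {ω : ℝ → ℝ × ℝ → ℝ} {u : ℝ → ℝ × ℝ → ℝ × ℝ} {t : ℝ}

/-- The palinstrophy production is controlled by the palinstrophy itself. -/
lemma IsSolution.palinstrophy_deriv_le (ha : 0 < a) (hb : 0 < b) (hν : 0 < ν)
    (h : IsSolution ν a b ω₀ ω u) (ht : 0 < t) (hE : 0 < enstrophy a b (ω t)) {C : ℝ}
    (hC : ∀ p ∈ cdom a b, (u t p).1 ^ 2 + (u t p).2 ^ 2 ≤ C * palinstrophy a b (ω t)) :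
    (-∫ p, lap a b (ω t) p * dt a b ω t p ∂(vol a b))
        + 2 * ν * palinstrophy a b (ω t) ^ 2 / enstrophy a b (ω t)
      ≤ C / (2 * ν) * palinstrophy a b (ω t) ^ 2 := by
  set P := palinstrophy a b (ω t) with hP
  set N := enstrophy a b (ω t) with hN
  set L := P / N with hL
  have hw2 : ContDiffOn ℝ 2 (ω t) (cdom a b) := h.contDiffOn 2 ht
  have hw1 : ContDiffOn ℝ 1 (ω t) (cdom a b) := h.contDiffOn 1 ht
  have hu1 : ContDiffOn ℝ 1 (u t) (cdom a b) := h.contDiffOn_velocity 1 ht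
  have hv := h.velocity t ht
  have hbc := h.bc t ht
  have i1 := zeroMean_green ha hb hw1 hw2 hbc.bottom hbc.top hbc.periodic hbc.periodic_dx
  have i2 := zeroMean_transport ha hb hu1.fst hu1.snd (hw1.mul hw1) hv.div_free hv.bottom hv.top
    hv.periodic_fst (fun y hy => by simp only [hbc.periodic y hy])
  have c0 := hw1.continuousOn
  have c1 := continuousOn_dx ha hb hw1
  have c2 := continuousOn_dy ha hb hw1
  have c3 : ContinuousOn (lap a b (ω t)) (cdom a b) :=
    (continuousOn_dx ha hb (contDiffOn_dx ha hb hw2 (by norm_num))).add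
      (continuousOn_dy ha hb (contDiffOn_dy ha hb hw2 (by norm_num)))
  have c4 : ContinuousOn (fun p => (u t p).1) (cdom a b) := hu1.fst.continuousOn
  have c5 : ContinuousOn (fun p => (u t p).2) (cdom a b) := hu1.snd.continuousOn
  have c6 : ContinuousOn (dt a b ω t) (cdom a b) :=
    (((h.smoothCyl 1).dt ha hb (m := 0) (by simp)).slice ht).continuousOn
  set G : ℝ × ℝ → ℝ := fun p => (u t p).1 * dx a b (ω t) p + (u t p).2 * dy a b (ω t) p with hG
  have cG : ContinuousOn G (cdom a b) := by fun_prop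
  -- For m = Δω + Λω, the left side of the claim equals ∫(-νm² + m u · ∇ω): adding Λω costs nothing
  -- in the advection term because ∫ω u · ∇ω = 0, and it produces the term 2νP²/E. Completing the
  -- square then eliminates m.
  have key := (((i1.const_mul (-(2 * ν * L))).add (i2.const_mul (L / 2))).congr
    (g := fun p => (-ν * (lap a b (ω t) p + L * ω t p) ^ 2 + (lap a b (ω t) p + L * ω t p) * G p)
      - (-(lap a b (ω t) p * dt a b ω t p)
        + 2 * ν * L * (dx a b (ω t) p ^ 2 + dy a b (ω t) p ^ 2) - ν * L ^ 2 * ω t p ^ 2))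
    fun p hp => by
      have hp' := dom_subset_cdom hp
      have d0 := hw1.differentiableOn one_ne_zero
      simp only [hG]
      rw [h.dt_eq ht hp, dx_mul ha hb d0 d0 hp', dy_mul ha hb d0 d0 hp']
      ring).integral_eq (by fun_prop) (by fun_prop)
  have e1 : ∫ p, (-(lap a b (ω t) p * dt a b ω t p)
      + 2 * ν * L * (dx a b (ω t) p ^ 2 + dy a b (ω t) p ^ 2) - ν * L ^ 2 * ω t p ^ 2) ∂(vol a b)
      = (-∫ p, lap a b (ω t) p * dt a b ω t p ∂(vol a b)) + 2 * ν * P ^ 2 / N := by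
    rw [integral_sub (integrable_vol (by fun_prop)) (integrable_vol (by fun_prop)),
      integral_add (integrable_vol (by fun_prop)) (integrable_vol (by fun_prop)),
      integral_neg, integral_const_mul, integral_const_mul,
      show ∫ p, (dx a b (ω t) p ^ 2 + dy a b (ω t) p ^ 2) ∂(vol a b) = 2 * P by
        rw [hP, palinstrophy]; ring,
      show ∫ p, ω t p ^ 2 ∂(vol a b) = 2 * N by rw [hN, enstrophy]; ring, hL]
    field_simp
    ring
  have e2 : ∫ p, (-ν * (lap a b (ω t) p + L * ω t p) ^ 2 + (lap a b (ω t) p + L * ω t p) * G p)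
      ∂(vol a b) ≤ ∫ p, 1 / (4 * ν) * (C * P) * (dx a b (ω t) p ^ 2 + dy a b (ω t) p ^ 2)
      ∂(vol a b) := by
    refine integral_mono_dom (by fun_prop) (by fun_prop) fun p hp => ?_
    have hu := hC p (dom_subset_cdom hp)
    set m := lap a b (ω t) p + L * ω t p
    set X := dx a b (ω t) p
    set Y := dy a b (ω t) p
    have e3 : -ν * m ^ 2 + m * G p ≤ 1 / (4 * ν) * G p ^ 2 := by
      have : 1 / (4 * ν) * G p ^ 2 - (-ν * m ^ 2 + m * G p) = ν * (m - G p / (2 * ν)) ^ 2 := by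
        field_simp
        ring
      have h2 : 0 ≤ ν * (m - G p / (2 * ν)) ^ 2 := by positivity
      linarith
    have e4 : G p ^ 2 ≤ ((u t p).1 ^ 2 + (u t p).2 ^ 2) * (X ^ 2 + Y ^ 2) := by
      have : ((u t p).1 ^ 2 + (u t p).2 ^ 2) * (X ^ 2 + Y ^ 2) - G p ^ 2
        = ((u t p).1 * Y - (u t p).2 * X) ^ 2 := by simp only [hG]; ring
      nlinarith [sq_nonneg ((u t p).1 * Y - (u t p).2 * X)]
    have e5 := e4.trans (mul_le_mul_of_nonneg_right hu (by positivity))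
    refine e3.trans ?_
    rw [mul_assoc]
    exact mul_le_mul_of_nonneg_left e5 (by positivity)
  rw [← e1, ← key]
  refine e2.trans_eq ?_
  rw [integral_const_mul, show ∫ p, (dx a b (ω t) p ^ 2 + dy a b (ω t) p ^ 2) ∂(vol a b) = 2 * P by
        rw [hP, palinstrophy]; ring]
  field_simp
  ring

lemma exists_tendsto_of_antitoneOn {f : ℝ → ℝ} {m : ℝ} (h : AntitoneOn f (Ioi 0))
    (hm : ∀ t, 0 < t → m ≤ f t) : ∃ l, Tendsto f atTop (𝓝 l) := by
  -- Freezing the function before time 1 makes it antitone on the whole line without changing its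
  -- limit.
  have h1 : Antitone fun t => f (max t 1) := fun s t hst =>
    h (show (0 : ℝ) < max s 1 by positivity) (show (0 : ℝ) < max t 1 by positivity)
      (max_le_max_right 1 hst)
  have h2 : BddBelow (range fun t => f (max t 1)) :=
    ⟨m, by rintro _ ⟨t, rfl⟩; exact hm _ (by positivity)⟩
  refine ⟨_, (tendsto_atTop_ciInf h1 h2).congr' ?_⟩
  filter_upwards [eventually_ge_atTop 1] with t ht
  rw [max_eq_left ht]

/-- If a function and its derivative both converge at infinity, the derivative tends to zero. -/
lemma eq_zero_of_tendsto_deriv {f f' : ℝ → ℝ} {l c : ℝ}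
    (hd : ∀ t, 0 < t → HasDerivAt f (f' t) t) (hf : Tendsto f atTop (𝓝 l))
    (hf' : Tendsto f' atTop (𝓝 c)) : c = 0 := by
  -- The mean value theorem on [t, t + 1] gives points s(t) > t where the derivative equals an
  -- increment that tends to zero.
  have h : ∀ t : ℝ, ∃ s, 0 < t → t < s ∧ f' s = f (t + 1) - f t := by
    intro t
    by_cases ht : 0 < t
    · obtain ⟨s, hs, he⟩ := exists_hasDerivAt_eq_slope f f' (lt_add_one t)
        (fun r hr => (hd r (ht.trans_le hr.1)).continuousAt.continuousWithinAt)
        (fun r hr => hd r (ht.trans hr.1))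
      exact ⟨s, fun _ => ⟨hs.1, by rw [he]; simp⟩⟩
    · exact ⟨0, fun h => absurd h ht⟩
  choose s hs using h
  have hs_top : Tendsto s atTop atTop := by
    refine tendsto_atTop_mono' atTop ?_ tendsto_id
    filter_upwards [eventually_gt_atTop 0] with t ht
    exact (hs t ht).1.le
  have h1 : Tendsto (fun t => f (t + 1) - f t) atTop (𝓝 (l - l)) :=
    (hf.comp (tendsto_atTop_add_const_right _ 1 tendsto_id)).sub hf
  rw [sub_self] at h1
  refine tendsto_nhds_unique (hf'.comp hs_top) (h1.congr' ?_)
  filter_upwards [eventually_gt_atTop 0] with t ht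
  exact (hs t ht).2.symm

lemma IsSolution.enstrophy_zero_pos (h : IsSolution ν a b ω₀ ω u) (hω₀ : MemLp ω₀ 2 (vol a b))
    (hne : ¬ ω₀ =ᵐ[vol a b] 0) : 0 < enstrophy a b (ω 0) := by
  have hm : MemLp (ω 0) 2 (vol a b) := (memLp_congr_ae h.initial).2 hω₀
  exact VortexStrip.enstrophy_pos hm fun h0 => hne (h.initial.symm.trans h0)

lemma IsSolution.kineticEnergy_zero_pos (ha : 0 < a) (hb : 0 < b) (h : IsSolution ν a b ω₀ ω u)
    (hω₀ : MemLp ω₀ 2 (vol a b)) (hne : ¬ ω₀ =ᵐ[vol a b] 0) : 0 < kineticEnergy a b (u 0) :=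
  h.initial_velocity.kineticEnergy_pos ha hb hω₀ hne

lemma IsSolution.tendsto_Q_zero (ha : 0 < a) (hb : 0 < b) (h : IsSolution ν a b ω₀ ω u)
    (hω₀ : MemLp ω₀ 2 (vol a b)) (hne : ¬ ω₀ =ᵐ[vol a b] 0) :
    Tendsto (fun t => Q a b (ω t) (u t)) (𝓝[>] 0) (𝓝 (Q a b (ω 0) (u 0))) := by
  have hE0 : enstrophy a b (ω 0) = enstrophy a b ω₀ := by
    rw [enstrophy_eq_norm hω₀, enstrophy_eq_norm ((memLp_congr_ae h.initial).2 hω₀),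
      toL2_congr h.initial]
  rw [Q, hE0]
  exact (h.tendsto_enstrophy hω₀).div (h.tendsto_kineticEnergy ha hb hω₀)
    (h.kineticEnergy_zero_pos ha hb hω₀ hne).ne'

variable (ha : 0 < a) (hb : 0 < b) (hν : 0 < ν) (h : IsSolution ν a b ω₀ ω u)
  (hω₀ : MemLp ω₀ 2 (vol a b)) (hne : ¬ ω₀ =ᵐ[vol a b] 0)
include ha hb hν h hω₀ hne

/-- The derivative of log P - log E is (P' + 2νP²/E)/P ≤ (C/ν)P, which -cE' matches for c = C/(2ν²).
So log Λ + cE is nonincreasing; it is bounded below since P ≥ b²E, and E itself decreases to a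
limit. -/
lemma IsSolution.exists_tendsto_Lam : ∃ l, Tendsto (fun t => Lam a b (ω t)) atTop (𝓝 l) := by
  obtain ⟨C, hC, hsup⟩ := IsVelocity.sq_le ha hb
  have hE := fun {t} (ht : 0 < t) => h.enstrophy_pos ha hb hν hω₀ hne ht
  have hP : ∀ {t}, 0 < t → 0 < palinstrophy a b (ω t) := fun ht =>
    lt_of_lt_of_le (mul_pos (by positivity) (hE ht)) (h.enstrophy_le ha hb ht)
  set c := C / (2 * ν ^ 2) with hc
  have hc0 : 0 < c := by positivity
  have hanti := antitoneOn_of_hasDerivAt_nonpos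
    (f := fun t => Real.log (palinstrophy a b (ω t)) - Real.log (enstrophy a b (ω t))
      + c * enstrophy a b (ω t)) (s := 0) fun t ht => by
      refine ⟨_, (((h.hasDerivAt_palinstrophy ha hb ht).log (hP ht).ne').sub
        ((h.hasDerivAt_enstrophy ha hb ht).log (hE ht).ne')).add
        ((h.hasDerivAt_enstrophy ha hb ht).const_mul c), ?_⟩
      have e := h.palinstrophy_deriv_le ha hb hν ht (hE ht) (C := 2 * C) fun p hp => by
        refine (hsup (ω t) (u t) (h.velocity t ht) (h.contDiffOn_velocity 3 ht)
          (h.contDiffOn 1 ht) (h.bc t ht) p hp).trans_eq ?_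
        rw [palinstrophy]
        ring
      set P := palinstrophy a b (ω t)
      set N := enstrophy a b (ω t)
      set I := -∫ p, lap a b (ω t) p * dt a b ω t p ∂(vol a b)
      have hP' : 0 < P := hP ht
      have hN' : 0 < N := hE ht
      have e2 : I / P - -2 * ν * P / N + c * (-2 * ν * P)
          = (I + 2 * ν * P ^ 2 / N - 2 * C / (2 * ν) * P ^ 2) / P := by
        rw [hc]
        field_simp
        ring
      rw [e2]
      exact div_nonpos_of_nonpos_of_nonneg (by linarith) hP'.le
  have hbelow : ∀ t, 0 < t → Real.log (b ^ 2) ≤ Real.log (palinstrophy a b (ω t))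
      - Real.log (enstrophy a b (ω t)) + c * enstrophy a b (ω t) := by
    intro t ht
    have h1 := Real.log_le_log (by have := hE ht; positivity) (h.enstrophy_le ha hb ht)
    rw [Real.log_mul (by positivity) (hE ht).ne'] at h1
    have h2 := mul_pos hc0 (hE ht)
    linarith
  obtain ⟨l₁, hl₁⟩ := exists_tendsto_of_antitoneOn hanti hbelow
  have hEanti := antitoneOn_of_hasDerivAt_nonpos (f := fun t => enstrophy a b (ω t)) (s := 0)
    fun t ht => ⟨_, h.hasDerivAt_enstrophy ha hb ht, by
      have := mul_pos hν (hP ht)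
      linarith⟩
  obtain ⟨l₂, hl₂⟩ := exists_tendsto_of_antitoneOn hEanti fun t ht => (hE ht).le
  refine ⟨Real.exp (l₁ - c * l₂), ((hl₁.sub (hl₂.const_mul c)).rexp).congr' ?_⟩
  filter_upwards [eventually_gt_atTop 0] with t ht
  rw [add_sub_cancel_right, ← Real.log_div (hP ht).ne' (hE ht).ne',
    Real.exp_log (div_pos (hP ht) (hE ht)), Lam]

lemma IsSolution.deriv_Q_nonpos (ht : 0 < t) :
    -2 * ν * Q a b (ω t) (u t) * (Lam a b (ω t) - Q a b (ω t) (u t)) ≤ 0 := by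
  have h1 : 0 ≤ Q a b (ω t) (u t) :=
    (sq_nonneg b).trans (h.sq_le_Q ha hb hν hω₀ hne ht)
  have h2 := sub_nonneg.2 (h.Q_le_Lam ha hb hν hω₀ hne ht)
  have := mul_nonneg (mul_nonneg hν.le h1) h2
  linarith

lemma IsSolution.antitoneOn_Q_Ioi : AntitoneOn (fun t => Q a b (ω t) (u t)) (Ioi 0) :=
  antitoneOn_of_hasDerivAt_nonpos fun _ ht => ⟨_, h.hasDerivAt_Q ha hb hν hω₀ hne ht,
    h.deriv_Q_nonpos ha hb hν hω₀ hne ht⟩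

lemma IsSolution.exists_tendsto_Q : ∃ q, b ^ 2 ≤ q ∧
    Tendsto (fun t => Q a b (ω t) (u t)) atTop (𝓝 q) := by
  obtain ⟨q, hq⟩ := exists_tendsto_of_antitoneOn (h.antitoneOn_Q_Ioi ha hb hν hω₀ hne)
    fun t ht => h.sq_le_Q ha hb hν hω₀ hne ht
  refine ⟨q, ge_of_tendsto hq ?_, hq⟩
  filter_upwards [eventually_gt_atTop 0] with t ht
  exact h.sq_le_Q ha hb hν hω₀ hne ht

/-- If Λ → l, then Q' → -2νq(l - q), and this limit must be zero because Q converges. As q ≥ b² > 0,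
it follows that l = q. -/
lemma IsSolution.tendsto_Lam {q : ℝ} (hb2 : b ^ 2 ≤ q)
    (hq : Tendsto (fun t => Q a b (ω t) (u t)) atTop (𝓝 q)) :
    Tendsto (fun t => Lam a b (ω t)) atTop (𝓝 q) := by
  obtain ⟨l, hl⟩ := h.exists_tendsto_Lam ha hb hν hω₀ hne
  have := eq_zero_of_tendsto_deriv (fun t ht => h.hasDerivAt_Q ha hb hν hω₀ hne ht) hq
    ((hq.const_mul (-2 * ν)).mul (hl.sub hq))
  have hq0 : 0 < q := lt_of_lt_of_le (by positivity) hb2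
  rw [mul_eq_zero, or_iff_right (by
    have := mul_pos hν hq0
    intro h0
    linarith), sub_eq_zero] at this
  rwa [← this]

lemma IsSolution.antitoneOn_Q : AntitoneOn (fun t => Q a b (ω t) (u t)) (Ici 0) := by
  have hanti := h.antitoneOn_Q_Ioi ha hb hν hω₀ hne
  intro s hs t ht hst
  rcases (show (0 : ℝ) ≤ s from hs).eq_or_lt with rfl | hs'
  · rcases hst.eq_or_lt with rfl | ht'
    · exact le_rfl
    · refine ge_of_tendsto (h.tendsto_Q_zero ha hb hω₀ hne) ?_
      filter_upwards [Ioo_mem_nhdsGT ht'] with r hr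
      exact hanti hr.1 ht' hr.2.le
  · exact hanti hs' (hs'.trans_le hst) hst

lemma IsSolution.limit_le_Q {q : ℝ} (hq : Tendsto (fun t => Q a b (ω t) (u t)) atTop (𝓝 q))
    (ht : 0 ≤ t) : q ≤ Q a b (ω t) (u t) := by
  refine le_of_tendsto hq ?_
  filter_upwards [eventually_ge_atTop t] with s hs
  exact h.antitoneOn_Q ha hb hν hω₀ hne ht (show (0 : ℝ) ≤ s from ht.trans hs) hs

/-- If the Rayleigh quotient is constant, the solution is a planar Taylor vortex. -/
lemma IsSolution.exists_eigenfunction {q : ℝ}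
    (hq : Tendsto (fun t => Q a b (ω t) (u t)) atTop (𝓝 q)) (hq0 : q = Q a b (ω 0) (u 0)) :
    ∃ k : ℕ, 1 ≤ k ∧ ∃ w ∈ E a b k, ω₀ =ᵐ[vol a b] w ∧
      ∀ t, 0 < t → ∀ p ∈ dom a b, ω t p = Real.exp (-ν * mu a b k * t) * w p := by
  -- Q is squeezed between its limit and its initial value, which coincide.
  have hconst : ∀ t, 0 ≤ t → Q a b (ω t) (u t) = q := fun t ht => le_antisymm
    (hq0 ▸ h.antitoneOn_Q ha hb hν hω₀ hne (le_refl (0 : ℝ)) ht ht)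
    (h.limit_le_Q ha hb hν hω₀ hne hq ht)
  have hqpos : 0 < q := by
    rw [← hconst 1 zero_le_one]
    exact lt_of_lt_of_le (by positivity) (h.sq_le_Q ha hb hν hω₀ hne one_pos)
  have hLam : ∀ t, 0 < t → Lam a b (ω t) = q := by
    intro t ht
    have h1 : HasDerivAt (fun s => Q a b (ω s) (u s)) 0 t := by
      refine (hasDerivAt_const t q).congr_of_eventuallyEq ?_
      filter_upwards [Ioi_mem_nhds ht] with s hs
      exact hconst s (le_of_lt hs)
    have h2 := (h.hasDerivAt_Q ha hb hν hω₀ hne ht).unique h1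
    rw [hconst t ht.le, mul_eq_zero, or_iff_right (by
      have := mul_pos hν hqpos
      intro h0
      linarith), sub_eq_zero] at h2
    exact h2
  -- Q = Λ = q makes the defect with c = q vanish, and hence its continuous integrand.
  have hgrad : ∀ t, 0 < t → ∀ p ∈ dom a b, dx a b (ω t) p = -q * (u t p).2 ∧
      dy a b (ω t) p = q * (u t p).1 := by
    intro t ht p hp
    have hu1 : ContDiffOn ℝ 1 (u t) (cdom a b) := h.contDiffOn_velocity 1 ht
    have hw1 : ContDiffOn ℝ 1 (ω t) (cdom a b) := h.contDiffOn 1 ht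
    have c1 : ContinuousOn (fun z => (u t z).1) (cdom a b) := hu1.fst.continuousOn
    have c2 : ContinuousOn (fun z => (u t z).2) (cdom a b) := hu1.snd.continuousOn
    have c3 := continuousOn_dx ha hb hw1
    have c4 := continuousOn_dy ha hb hw1
    have hK := h.kineticEnergy_pos ha hb hν hω₀ hne ht
    have hE := h.enstrophy_pos ha hb hν hω₀ hne ht
    have e1 : enstrophy a b (ω t) = q * kineticEnergy a b (u t) := by
      rw [← hconst t ht.le, Q, div_mul_cancel₀ _ hK.ne']
    have e2 : palinstrophy a b (ω t) = q * enstrophy a b (ω t) := by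
      rw [← hLam t ht, Lam, div_mul_cancel₀ _ hE.ne']
    have e3 := (h.velocity t ht).integral_defect_eq ha hb hu1 hw1 (h.bc t ht) q
    rw [e2, e1, show q * (q * kineticEnergy a b (u t)) - 2 * q * (q * kineticEnergy a b (u t))
      + q ^ 2 * kineticEnergy a b (u t) = 0 by ring, mul_zero] at e3
    have e4 := eq_zero_of_integral_eq_zero (by fun_prop) (fun _ _ => by positivity) e3 p hp
    have e5 := sq_nonneg (dy a b (ω t) p - q * (u t p).1)
    have e6 := sq_nonneg (dx a b (ω t) p + q * (u t p).2)
    have e7 : dy a b (ω t) p - q * (u t p).1 = 0 := by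
      rw [← sq_eq_zero_iff]; linarith
    have e8 : dx a b (ω t) p + q * (u t p).2 = 0 := by
      rw [← sq_eq_zero_iff]; linarith
    exact ⟨by linarith, by linarith⟩
  have hlap : ∀ t, 0 < t → ∀ p ∈ dom a b, lap a b (ω t) p = -q * ω t p := by
    intro t ht p hp
    have hp' := dom_subset_cdom hp
    have hu1 : ContDiffOn ℝ 1 (u t) (cdom a b) := h.contDiffOn_velocity 1 ht
    rw [lap, dx_congr_dom (fun r hr => (hgrad t ht r hr).1) hp,
      dy_congr_dom (fun r hr => (hgrad t ht r hr).2) hp,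
      dx_const_mul ha hb hp' (hu1.snd.differentiableOn one_ne_zero),
      dy_const_mul ha hb hp' (hu1.fst.differentiableOn one_ne_zero),
      ← (h.velocity t ht).curl p hp]
    ring
  have hdt : ∀ t, 0 < t → ∀ p ∈ dom a b, dt a b ω t p = -ν * q * ω t p := by
    intro t ht p hp
    rw [h.dt_eq ht hp, hlap t ht p hp, (hgrad t ht p hp).1, (hgrad t ht p hp).2]
    ring
  -- The profile is extrapolated back from time 1, where ω is smooth; ω₀ is only in L² and is
  -- identified with it at the end by the limit t → 0.
  set w : ℝ × ℝ → ℝ := fun p => Real.exp (ν * q) * ω 1 p with hw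
  have hsol : ∀ t, 0 < t → ∀ p ∈ dom a b, ω t p = Real.exp (-ν * q * t) * w p := by
    intro t ht p hp
    have hd : ∀ s, 0 < s → HasDerivAt (fun s => ω s p * Real.exp (ν * q * s)) 0 s := by
      intro s hs
      have h1 : HasDerivAt (fun s => Real.exp (ν * q * s)) (ν * q * Real.exp (ν * q * s)) s :=
        (((hasDerivAt_id s).const_mul (ν * q)).exp).congr_deriv (by simp only [id]; ring)
      refine ((h.hasDerivAt hs (dom_subset_cdom hp)).mul h1).congr_deriv ?_
      rw [hdt s hs p hp]
      ring
    have hc := (convex_Ioi (0 : ℝ)).is_const_of_fderivWithin_eq_zero (𝕜 := ℝ)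
      (f := fun s => ω s p * Real.exp (ν * q * s))
      (fun s hs => (hd s hs).differentiableAt.differentiableWithinAt)
      (fun s hs => by
        rw [fderivWithin_of_isOpen isOpen_Ioi hs, (hd s hs).hasFDerivAt.fderiv]
        ext
        simp) (show t ∈ Ioi (0:ℝ) from ht) (show (1:ℝ) ∈ Ioi (0:ℝ) from Set.mem_Ioi.2 zero_lt_one)
    simp only [mul_one] at hc
    rw [hw]
    calc ω t p = (ω t p * Real.exp (ν * q * t)) * Real.exp (-ν * q * t) := by
          rw [mul_assoc, ← Real.exp_add, show ν * q * t + -ν * q * t = 0 by ring, Real.exp_zero,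
            mul_one]
      _ = _ := by rw [hc]; ring
  have hw2 : ContDiffOn ℝ 2 (ω 1) (cdom a b) := h.contDiffOn 2 one_pos
  have hwE : w ∈ eigenspace a b q := by
    refine ⟨contDiffOn_const.mul hw2,
      (h.bc 1 one_pos).const_mul ha hb (hw2.differentiableOn (by norm_num)) _, fun p hp => ?_⟩
    rw [hw, lap_const_mul ha hb hw2 (dom_subset_cdom hp), hlap 1 one_pos p hp]
    ring
  have heig : IsEigenvalue a b q := by
    refine ⟨w, hwE, ?_⟩
    by_contra! hcon
    refine (h.enstrophy_pos ha hb hν hω₀ hne one_pos).ne' ?_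
    rw [enstrophy, integral_congr_dom (g := fun _ => 0) fun p hp => by
      have := hcon p hp
      rw [hw, mul_eq_zero, or_iff_right (Real.exp_ne_zero _)] at this
      simp [this]]
    simp
  obtain ⟨k, hk, hmu⟩ := exists_mu_eq ha hb heig hqpos
  refine ⟨k, hk, w, by rw [E, hmu]; exact hwE, ?_, by rw [hmu]; exact hsol⟩
  have hwm : MemLp w 2 (vol a b) := memLp_vol hwE.1.continuousOn
  rw [← toL2_eq_iff hω₀ hwm]
  refine tendsto_nhds_unique (h.tendsto_toL2 hω₀)
    ((tendsto_exp_mul_toL2 hwm (-ν * q)).congr' ?_)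
  filter_upwards [self_mem_nhdsWithin] with t ht
  exact toL2_congr (ae_mem_dom.mono fun p hp => (hsol t ht p hp).symm)

/-- Eigenfunctions evolve as planar Taylor vortices, with constant Rayleigh quotient. -/
lemma IsSolution.limit_eq_of_eigenfunction {q : ℝ}
    (hq : Tendsto (fun t => Q a b (ω t) (u t)) atTop (𝓝 q)) {k : ℕ} {w : ℝ × ℝ → ℝ}
    (hw : w ∈ E a b k) (hw₀ : ω₀ =ᵐ[vol a b] w) : q = Q a b (ω 0) (u 0) := by
  -- Since ω₀ ≠ 0, `w` is a genuine eigenfunction, so μ_k is an eigenvalue and positive; k ≥ 1 need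
  -- not be assumed.
  have heig : IsEigenvalue a b (mu a b k) := by
    refine ⟨w, hw, ?_⟩
    by_contra! hcon
    exact hne (hw₀.trans (ae_mem_dom.mono hcon))
  have hl := (heig.pos ha hb).ne'
  have hwm : MemLp w 2 (vol a b) := memLp_vol hw.1.continuousOn
  have hflow := isFlow_taylor (ν := ν) ha hb hl hw
  have heq := fun {t} (ht : 0 < t) => h.eq_of_isFlow hν ha hb hω₀ hflow (by
    rw [toL2_congr hw₀]
    exact tendsto_exp_mul_toL2 hwm _) ht
  -- For positive times the solution is the Taylor vortex, and the common factor exp(-2νμ_k t) of E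
  -- and K cancels.
  have hQ : ∀ t, 0 < t → Q a b (ω t) (u t) = Q a b w (eigenVelocity a b (mu a b k) w) := by
    intro t ht
    set e := Real.exp (-ν * mu a b k * t) with he
    have h1 : enstrophy a b (ω t) = e ^ 2 * enstrophy a b w := by
      rw [enstrophy, integral_congr_dom (g := fun p => e ^ 2 * w p ^ 2) fun p hp => by
        simp only [(heq ht p hp).1]; ring]
      rw [integral_const_mul, enstrophy]
      ring
    have h2 : kineticEnergy a b (u t) = e ^ 2 * kineticEnergy a b (eigenVelocity a b (mu a b k) w) := by
      rw [kineticEnergy, integral_congr_dom (g := fun p => e ^ 2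
        * ((eigenVelocity a b (mu a b k) w p).1 ^ 2 + (eigenVelocity a b (mu a b k) w p).2 ^ 2))
        fun p hp => by simp only [(heq ht p hp).2]; ring]
      rw [integral_const_mul, kineticEnergy]
      ring
    rw [Q, h1, h2, mul_div_mul_left _ _ (by positivity), Q]
  have h0 := tendsto_nhds_unique (h.tendsto_Q_zero ha hb hω₀ hne)
    (tendsto_const_nhds.congr' (by
      filter_upwards [self_mem_nhdsWithin] with t ht
      exact (hQ t ht).symm))
  rw [h0]
  refine tendsto_nhds_unique hq (tendsto_const_nhds.congr' ?_)
  filter_upwards [eventually_gt_atTop 0] with t ht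
  exact (hQ t ht).symm

end Limits

end VortexStrip

/-! ### The theorem -/

open VortexStrip in
theorem lemma3 (ν a b : ℝ) (hν : 0 < ν) (ha : 0 < a) (hb : 0 < b)
    (ω₀ : ℝ × ℝ → ℝ) (hω₀ : MemLp ω₀ 2 (vol a b)) (hne : ¬ ω₀ =ᵐ[vol a b] 0) :
    ∃ q : ℝ, ∀ (ω : ℝ → ℝ × ℝ → ℝ) (u : ℝ → ℝ × ℝ → ℝ × ℝ), IsSolution ν a b ω₀ ω u →
      (∀ t, 0 ≤ t → 0 < enstrophy a b (ω t) ∧ 0 < kineticEnergy a b (u t)) ∧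
      (∀ t, 0 < t → ∃ Q' : ℝ, HasDerivAt (fun s => Q a b (ω s) (u s)) Q' t ∧ Q' ≤ 0) ∧
      AntitoneOn (fun t => Q a b (ω t) (u t)) (Ici 0) ∧
      Tendsto (fun t => Q a b (ω t) (u t)) atTop (𝓝 q) ∧
      mu a b 1 ≤ q ∧ q ≤ Q a b (ω 0) (u 0) ∧
      (q = Q a b (ω 0) (u 0) ↔ ∃ k : ℕ, 1 ≤ k ∧ ∃ w ∈ E a b k, ω₀ =ᵐ[vol a b] w) ∧
      (q = Q a b (ω 0) (u 0) ↔ IsTaylorVortex ν a b ω) ∧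
      Tendsto (fun t => Lam a b (ω t)) atTop (𝓝 q) := by
  -- The number q is chosen before the solution, so one limit must serve all solutions. The bound b²
  -- ≤ q yields both μ₁ ≤ q and q > 0.
  suffices H : ∃ q : ℝ, b ^ 2 ≤ q ∧ ∀ (ω : ℝ → ℝ × ℝ → ℝ) (u : ℝ → ℝ × ℝ → ℝ × ℝ),
      IsSolution ν a b ω₀ ω u → Tendsto (fun t => Q a b (ω t) (u t)) atTop (𝓝 q) by
    obtain ⟨q, hbq, hq⟩ := H
    refine ⟨q, fun ω u h => ?_⟩
    have hlim := hq ω u h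
    have hE0 := h.enstrophy_zero_pos hω₀ hne
    have hK0 := h.kineticEnergy_zero_pos ha hb hω₀ hne
    have hiff : q = Q a b (ω 0) (u 0) ↔ ∃ k : ℕ, 1 ≤ k ∧ ∃ w ∈ E a b k, ω₀ =ᵐ[vol a b] w := by
      constructor
      · intro he
        obtain ⟨k, hk, w, hw, hw₀, -⟩ := h.exists_eigenfunction ha hb hν hω₀ hne hlim he
        exact ⟨k, hk, w, hw, hw₀⟩
      · rintro ⟨k, -, w, hw, hw₀⟩
        exact h.limit_eq_of_eigenfunction ha hb hν hω₀ hne hlim hw hw₀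
    refine ⟨fun t ht => ?_, fun t ht => ⟨_, h.hasDerivAt_Q ha hb hν hω₀ hne ht,
      h.deriv_Q_nonpos ha hb hν hω₀ hne ht⟩, h.antitoneOn_Q ha hb hν hω₀ hne, hlim,
      (mu_one_le ha hb).trans hbq, h.limit_le_Q ha hb hν hω₀ hne hlim le_rfl, hiff, ?_,
      h.tendsto_Lam ha hb hν hω₀ hne hbq hlim⟩
    · rcases ht.eq_or_lt with rfl | ht
      · exact ⟨hE0, hK0⟩
      · exact ⟨h.enstrophy_pos ha hb hν hω₀ hne ht, h.kineticEnergy_pos ha hb hν hω₀ hne ht⟩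
    · constructor
      · intro he
        obtain ⟨k, hk, w, hw, hw₀, hsol⟩ := h.exists_eigenfunction ha hb hν hω₀ hne hlim he
        refine ⟨k, hk, w, hw, fun t ht => ?_⟩
        rcases ht.eq_or_lt with rfl | ht
        · simpa using h.initial.trans hw₀
        · exact ae_mem_dom.mono (hsol t ht)
      · rintro ⟨k, hk, w, hw, hsol⟩
        refine hiff.2 ⟨k, hk, w, hw, h.initial.symm.trans ?_⟩
        simpa using hsol 0 le_rfl
  -- If a solution exists, its limit is taken, and uniqueness carries it over to every other one.
  -- Otherwise there is nothing to prove about solutions, and b² is an arbitrary admissible value.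
  by_cases hex : ∃ (ω : ℝ → ℝ × ℝ → ℝ) (u : ℝ → ℝ × ℝ → ℝ × ℝ), IsSolution ν a b ω₀ ω u
  · obtain ⟨ω, u, h⟩ := hex
    obtain ⟨q, hbq, hq⟩ := h.exists_tendsto_Q ha hb hν hω₀ hne
    refine ⟨q, hbq, fun ω' u' h' => hq.congr' ?_⟩
    filter_upwards [eventually_gt_atTop 0] with t ht
    have heq := h.eq_of_isFlow hν ha hb hω₀ (h'.isFlow ha hb) (h'.tendsto_toL2 hω₀) ht
    rw [Q, Q, enstrophy, enstrophy, kineticEnergy, kineticEnergy,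
      integral_congr_dom (f := fun p => ω t p ^ 2) (g := fun p => ω' t p ^ 2)
        fun p hp => by simp only [(heq p hp).1],
      integral_congr_dom (f := fun p => (u t p).1 ^ 2 + (u t p).2 ^ 2)
        (g := fun p => (u' t p).1 ^ 2 + (u' t p).2 ^ 2) fun p hp => by simp only [(heq p hp).2]]
  · exact ⟨b ^ 2, le_rfl, fun ω u h => absurd ⟨ω, u, h⟩ hex⟩
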